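/- **Notation.** On $\mathbb{R}^3$ let $P=-i\nabla$ and $\langle x\rangle=(1+|x|^2)^{1/2}$. For $k,s\in\mathbb{R}$ let $H^{k,s}$ be the space of tempered distributions $u$ with $\|u\|_{H^{k,s}}=\|\langle x\rangle^{s}(1-\Delta)^{k/2}u\|_{L^2}<\infty$ (the completion of the Schwartz space in this norm), and let $\mathscr{B}(k,s;k',s')$ be the space of bounded operators from $H^{k,s}$ to $H^{k',s'}$ with the operator norm. **Assumptions.** Let $\beta>5$. Let $V\colon\mathbb{R}^3\to\mathbb{R}$ be measurable with $|V(x)|\lesssim\langle x\rangle^{-\beta}$, let $B\in C^1(\mathbb{R}^3;\mathbb{R}^3)$ satisfy $\nabla\cdot B=0$ and $|B(x)|\lesssim\langle x\rangle^{-\beta-1}$, and let $A\in C^1(\mathbb{R}^3;\mathbb{R}^3)$ be a vector potential with $\operatorname{rot}A=B$ and $|A(x)|\lesssim\langle x\rangle^{-\beta}$. Let $H=(P-A)^2+V$ be the self-adjoint operator on $L^2(\mathbb{R}^3)$ with form domain $H^{1,0}$ (so its domain is $\{u\in H^{1,0} : Hu\in L^2\}$, with $Hu$ in the sense of distributions),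 and let $W=H+\Delta=-P\cdot A-A\cdot P+|A|^2+V$. Assume that zero is a regular point of $H$: the only $u\in\bigcap_{t>1/2}H^{1,-t}$ with $Hu=0$ in the sense of distributions is $u=0$. For $\operatorname{Re}\kappa>0$ with $-\kappa^2$ in the resolvent set of $H$ put $R(\kappa)=(H+\kappa^2)^{-1}$. For $j=0,1$ let $G_j$ be the operator with integral kernel $$G_j(x,y)=(-1)^j\frac{|x-y|^{j-1}}{4\pi\, j!},$$ extended by continuity from Schwartz functions to $H^{-1,s}$. **Theorem.** 1. For every $s>1$ the operator $$F_0=(I+G_0W)^{-1}G_0$$ is well defined and belongs to $\mathscr{B}(-1,s;1,-s)$. In detail, for every $t$ with $\tfrac12<t<\beta-\tfrac12$, $t\le s$ and $s+t\ge2$: $G_0$ belongs to $\mathscr{B}(-1,s;1,-t)$; $G_0W$ is bounded on $H^{1,-t}$, as the composition of $W\in\mathscr{B}(1,-t;-1,\beta-t)$ and $G_0\in\mathscr{B}(-1,\beta-t;1,-t)$; $I+G_0W$ has a bounded inverse on $H^{1,-t}$; and $F_0$ is the composition $H^{-1,s}\xrightarrow{\,G_0\,}H^{1,-t}\xrightarrow{(I+G_0W)^{-1}}H^{1,-t}\subset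 H^{1,-s}$. 2. For every $s>\tfrac32$ the operator $$F_1=(I+G_0W)^{-1}G_1(I+WG_0)^{-1}$$ is well defined and belongs to $\mathscr{B}(-1,s;1,-s)$. In detail, for every $t$ with $\tfrac32<t<\beta-\tfrac12$ and $t\le s$: $G_1$ belongs to $\mathscr{B}(-1,t;1,-t)$; $WG_0$ is bounded on $H^{-1,t}$, as the composition of $G_0\in\mathscr{B}(-1,t;1,t-\beta)$ and $W\in\mathscr{B}(1,t-\beta;-1,t)$; $I+WG_0$ has a bounded inverse on $H^{-1,t}$; $I+G_0W$ has a bounded inverse on $H^{1,-t}$, with $G_0W$ as in part 1; and $F_1$ is the composition $H^{-1,s}\subset H^{-1,t}\xrightarrow{(I+WG_0)^{-1}}H^{-1,t}\xrightarrow{\,G_1\,}H^{1,-t}\xrightarrow{(I+G_0W)^{-1}}H^{1,-t}\subset H^{1,-s}$. 3. For every $s>\tfrac52$, with $F_0$ and $F_1$ as in parts 1 and 2, $$R(\kappa)=F_0+\kappa F_1+\mathcal{O}(\kappa^2)\quad\text{in }\mathscr{B}(-1,s;1,-s)\quad\text{as }\kappa\to0,\ \operatorname{Re}\kappa>0.$$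 That is, there are $\delta,C>0$ such that for all $\kappa$ with $\operatorname{Re}\kappa>0$ and $|\kappa|<\delta$ the number $-\kappa^2$ is in the resolvent set of $H$, the restriction of $R(\kappa)$ to $L^2\cap H^{-1,s}$ extends to an operator in $\mathscr{B}(-1,s;1,-s)$, again denoted $R(\kappa)$, and $\|R(\kappa)-F_0-\kappa F_1\|\le C|\kappa|^2$ in $\mathscr{B}(-1,s;1,-s)$. -/

import Mathlib

open MeasureTheory Filter Topology Asymptotics TemperedDistribution
open scoped SchwartzMap LineDeriv Laplacian ContDiff

noncomputable section

namespace MagneticThreshold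

/-- Euclidean three-space. -/
abbrev E3 : Type := EuclideanSpace ℝ (Fin 3)

/-- Tempered distributions on three-space. -/
abbrev Dist3 : Type := 𝓢'(E3, ℂ)

/-- The Hilbert space `L²(ℝ³)`. -/
abbrev L2 : Type := Lp ℂ 2 (volume : Measure E3)

/-! ### Weighted Sobolev spaces -/

/-- The weight `⟨x⟩ ^ s = (1 + |x|²) ^ (s / 2)`, as a complex valued function. -/
def weight (s : ℝ) (x : E3) : ℂ := (((1 + ‖x‖ ^ 2) ^ (s / 2) : ℝ) : ℂ)

/-- The symbol of `(1 - Δ) ^ (k / 2)`. With the Fourier transform `∫ exp (-2πi x·ξ) f x dx`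
used in Mathlib, `-Δ` has the symbol `(2π|ξ|)²`. -/
def besselSymbol (k : ℝ) (ξ : E3) : ℂ := weight k ((2 * Real.pi) • ξ)

theorem hasTemperateGrowth_weight (s : ℝ) : (weight s).HasTemperateGrowth := by
  unfold weight
  fun_prop

theorem hasTemperateGrowth_besselSymbol (k : ℝ) : (besselSymbol k).HasTemperateGrowth := by
  have h : Function.HasTemperateGrowth
      (fun ξ : E3 => ((2 * Real.pi) • ContinuousLinearMap.id ℝ E3) ξ) :=
    ContinuousLinearMap.hasTemperateGrowth _
  exact (hasTemperateGrowth_weight k).comp h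

theorem weight_mul_neg (s : ℝ) : weight (-s) * weight s = fun _ => 1 := by
  funext x
  have hx : (0 : ℝ) < 1 + ‖x‖ ^ 2 := by positivity
  simp only [weight, Pi.mul_apply]
  rw [← Complex.ofReal_mul, ← Real.rpow_add hx]
  simp [neg_div]

theorem besselSymbol_mul_neg (k : ℝ) : besselSymbol (-k) * besselSymbol k = fun _ => 1 := by
  funext ξ
  exact congrFun (weight_mul_neg k) ((2 * Real.pi) • ξ)

/-- The map `u ↦ ⟨x⟩ ^ s (1 - Δ) ^ (k / 2) u` on tempered distributions. -/
def weightedBessel (k s : ℝ) : Dist3 →L[ℂ] Dist3 :=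
  smulLeftCLM ℂ (weight s) ∘L fourierMultiplierCLM ℂ (besselSymbol k)

theorem weightedBessel_injective (k s : ℝ) : Function.Injective (weightedBessel k s) := by
  have h₁ : Function.LeftInverse (smulLeftCLM (E := E3) ℂ (weight (-s)))
      (smulLeftCLM ℂ (weight s)) := by
    intro u
    rw [smulLeftCLM_smulLeftCLM_apply (hasTemperateGrowth_weight _) (hasTemperateGrowth_weight _),
      mul_comm, weight_mul_neg, smulLeftCLM_const, one_smul]
  have h₂ : Function.LeftInverse (fourierMultiplierCLM (E := E3) ℂ (besselSymbol (-k)))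
      (fourierMultiplierCLM ℂ (besselSymbol k)) := by
    intro u
    rw [fourierMultiplierCLM_fourierMultiplierCLM_apply (hasTemperateGrowth_besselSymbol _)
      (hasTemperateGrowth_besselSymbol _), mul_comm, besselSymbol_mul_neg, fourierMultiplierCLM_const]
    simp
  exact h₁.injective.comp h₂.injective

/-- The inclusion of `L²` into tempered distributions. -/
abbrev l2ToDist : L2 →L[ℂ] Dist3 := Lp.toTemperedDistributionCLM ℂ (volume : Measure E3) 2

theorem l2ToDist_injective : Function.Injective l2ToDist :=
  LinearMap.ker_eq_bot.mp (Lp.ker_toTemperedDistributionCLM_eq_bot (F := ℂ))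

/-- The tempered distributions `u` with `⟨x⟩ ^ s (1 - Δ) ^ (k / 2) u ∈ L²`. -/
def weightedSobolev (k s : ℝ) : Submodule ℂ Dist3 :=
  (LinearMap.range (l2ToDist : L2 →ₗ[ℂ] Dist3)).comap (weightedBessel k s : Dist3 →ₗ[ℂ] Dist3)

/-- The weighted Sobolev space `H^{k,s}` as a type of its own, which will carry the norm
`‖⟨x⟩ ^ s (1 - Δ) ^ (k / 2) u‖` of `L²` (and not the topology of tempered distributions). -/
def WSob (k s : ℝ) : Type := ↥(weightedSobolev k s)

namespace WSob

variable {k s : ℝ}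

instance : AddCommGroup (WSob k s) := inferInstanceAs (AddCommGroup ↥(weightedSobolev k s))

instance : Module ℂ (WSob k s) := inferInstanceAs (Module ℂ ↥(weightedSobolev k s))

/-- The inclusion of `H^{k,s}` into tempered distributions. -/
def toDist : WSob k s →ₗ[ℂ] Dist3 := (weightedSobolev k s).subtype

theorem toDist_injective : Function.Injective (toDist : WSob k s →ₗ[ℂ] Dist3) :=
  Subtype.val_injective

theorem exists_l2 (u : WSob k s) : ∃ f : L2, l2ToDist f = weightedBessel k s (toDist u) :=
  u.2

/-- The map `u ↦ ⟨x⟩ ^ s (1 - Δ) ^ (k / 2) u` from `H^{k,s}` to `L²`. -/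
def toL2 : WSob k s →ₗ[ℂ] L2 where
  toFun u := (exists_l2 u).choose
  map_add' u v := by
    apply l2ToDist_injective
    refine (exists_l2 (u + v)).choose_spec.trans ?_
    rw [map_add l2ToDist, (exists_l2 u).choose_spec, (exists_l2 v).choose_spec, map_add, map_add]
  map_smul' c u := by
    apply l2ToDist_injective
    refine (exists_l2 (c • u)).choose_spec.trans ?_
    rw [RingHom.id_apply, map_smul l2ToDist, (exists_l2 u).choose_spec, map_smul, map_smul]

theorem l2ToDist_toL2 (u : WSob k s) : l2ToDist (toL2 u) = weightedBessel k s (toDist u) :=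
  (exists_l2 u).choose_spec

theorem toL2_injective : Function.Injective (toL2 : WSob k s →ₗ[ℂ] L2) := by
  intro u v h
  apply toDist_injective
  apply weightedBessel_injective k s
  rw [← l2ToDist_toL2, ← l2ToDist_toL2, h]

/-- The norm of `H^{k,s}`, that is `‖u‖ = ‖⟨x⟩ ^ s (1 - Δ) ^ (k / 2) u‖` in `L²`. -/
instance : NormedAddCommGroup (WSob k s) :=
  NormedAddCommGroup.induced (WSob k s) L2 (toL2 : WSob k s →ₗ[ℂ] L2) toL2_injective

instance : NormedSpace ℂ (WSob k s) :=
  NormedSpace.induced ℂ (WSob k s) L2 (toL2 : WSob k s →ₗ[ℂ] L2)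

theorem norm_eq (u : WSob k s) : ‖u‖ = ‖toL2 u‖ := rfl

end WSob

open WSob (toDist)

/-! ### Fields and potentials -/

/-- The partial derivative of the `k`-th component of `F` in the `j`-th direction. -/
def partialD (F : E3 → E3) (j k : Fin 3) (x : E3) : ℝ :=
  fderiv ℝ F x (EuclideanSpace.single j 1) k

/-- The rotation of a vector field. -/
def curl (F : E3 → E3) (x : E3) : E3 :=
  !₂[partialD F 1 2 x - partialD F 2 1 x,
     partialD F 2 0 x - partialD F 0 2 x,
     partialD F 0 1 x - partialD F 1 0 x]

/-- The standing assumption on the electric potential `V` and the magnetic field `B`, with decay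
rate `β`: `|V(x)| ≲ ⟨x⟩ ^ (-β)`, and `B` is continuously differentiable and divergence free with
`|B(x)| ≲ ⟨x⟩ ^ (-β - 1)`. -/
structure FieldAssumption (β : ℝ) (V : E3 → ℝ) (B : E3 → E3) : Prop where
  aestronglyMeasurable_V : AEStronglyMeasurable V volume
  decay_V : ∃ C : ℝ, ∀ x, |V x| ≤ C * (1 + ‖x‖ ^ 2) ^ (-β / 2)
  contDiff_B : ContDiff ℝ 1 B
  div_B : ∀ x, ∑ j, partialD B j j x = 0
  decay_B : ∃ C : ℝ, ∀ x, ‖B x‖ ≤ C * (1 + ‖x‖ ^ 2) ^ ((-β - 1) / 2)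

/-- The choice of gauge: `A` is a `C¹` vector potential of `B` with `|A(x)| ≲ ⟨x⟩ ^ (-β)`. -/
structure IsVectorPotential (β : ℝ) (B A : E3 → E3) : Prop where
  contDiff_A : ContDiff ℝ 1 A
  curl_A : ∀ x, curl A x = B x
  decay_A : ∃ C : ℝ, ∀ x, ‖A x‖ ≤ C * (1 + ‖x‖ ^ 2) ^ (-β / 2)

/-! ### The magnetic Schrödinger operator in the sense of distributions -/

/-- The tempered distribution `u` is given by the function `f`. The integrability against all
Schwartz functions makes `f` locally integrable, hence unique up to null sets. -/
def Represents (f : E3 → ℂ) (u : Dist3) : Prop :=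
  ∀ φ : 𝓢(E3, ℂ), Integrable (fun x => φ x * f x) ∧ u φ = ∫ x, φ x * f x

/-- `v = a u` for a real function `a` and a tempered distribution `u` that is a function. -/
def IsMul (a : E3 → ℝ) (u v : Dist3) : Prop :=
  ∃ f : E3 → ℂ, Represents f u ∧ Represents (fun x => (a x : ℂ) * f x) v

/-- The component `P_j = -i ∂_j` of the momentum operator. -/
def momentum (j : Fin 3) (u : Dist3) : Dist3 :=
  (-Complex.I) • ∂_{(EuclideanSpace.single j (1 : ℝ) : E3)} u

/-- `d = (P_j - A_j) u`, expressed as `A_j u = P_j u - d`. -/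
def IsMagneticMomentum (A : E3 → E3) (j : Fin 3) (u d : Dist3) : Prop :=
  IsMul (fun x => A x j) u (momentum j u - d)

/-- `h = H u` in the sense of distributions, where `H = (P - A)² + V`: with
`d_j = (P_j - A_j) u`, `e_j = (P_j - A_j) d_j` and `c = V u`, one has `h = e_1 + e_2 + e_3 + c`. -/
def IsHamiltonian (A : E3 → E3) (V : E3 → ℝ) (u h : Dist3) : Prop :=
  ∃ (d e : Fin 3 → Dist3) (c : Dist3),
    (∀ j, IsMagneticMomentum A j u (d j)) ∧ (∀ j, IsMagneticMomentum A j (d j) (e j)) ∧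
      IsMul V u c ∧ h = ∑ j, e j + c

/-- `w = W u`, where `W = H + Δ`; expressed as `H u = w - Δ u`. -/
def IsPerturbation (A : E3 → E3) (V : E3 → ℝ) (u w : Dist3) : Prop :=
  IsHamiltonian A V u (w - Δ u)

/-- Zero is a regular point of `H`: the only `u` with `H u = 0` in the sense of distributions that
lies in `H^{1,-t}` for every `t > 1/2` is `u = 0`. -/
def IsRegularPoint (A : E3 → E3) (V : E3 → ℝ) : Prop :=
  ∀ u : Dist3, (∀ t : ℝ, 1 / 2 < t → u ∈ weightedSobolev 1 (-t)) → IsHamiltonian A V u 0 → u = 0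

/-! ### The resolvent -/

/-- The graph of the self-adjoint operator `H` on `L²`: `u` lies in its domain and `H u = g`.
The form domain is `H^{1,0}`, and the domain consists of all `u` in the form domain for which the
distribution `H u` is in `L²`. -/
def InGraph (A : E3 → E3) (V : E3 → ℝ) (u g : L2) : Prop :=
  l2ToDist u ∈ weightedSobolev 1 0 ∧ IsHamiltonian A V (l2ToDist u) (l2ToDist g)

/-- `z` is in the resolvent set of `H` and `T = (H - z)⁻¹`, a bounded operator on `L²`. -/
def IsResolvent (A : E3 → E3) (V : E3 → ℝ) (z : ℂ) (T : L2 →L[ℂ] L2) : Prop :=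
  (∀ f : L2, InGraph A V (T f) (f + z • T f)) ∧
    ∀ u g : L2, InGraph A V u g → T (g - z • u) = u

/-- `-κ²` is in the resolvent set of `H`, and the bounded operator `R` from `H^{-1,s}` to
`H^{1,-s}` agrees with `(H + κ²)⁻¹` on the dense subspace `H^{-1,s} ∩ L²` of `H^{-1,s}`; that is,
`R` is `R(κ)` regarded as an operator from `H^{-1,s}` to `H^{1,-s}`. -/
def IsWeightedResolvent (A : E3 → E3) (V : E3 → ℝ) (s : ℝ) (κ : ℂ)
    (R : WSob (-1) s →L[ℂ] WSob 1 (-s)) : Prop :=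
  ∃ T : L2 →L[ℂ] L2, IsResolvent A V (-κ ^ 2) T ∧
    ∀ (f : L2) (u : WSob (-1) s), toDist u = l2ToDist f → toDist (R u) = l2ToDist (T f)

/-! ### The operators `G_j` and the coefficients of the expansion -/

/-- The kernel `G_j(x,y) = (-1) ^ j |x - y| ^ (j - 1) / (4π j!)`. -/
def greenKernel (j : ℕ) (x y : E3) : ℝ :=
  (-1) ^ j * ‖x - y‖ ^ ((j : ℤ) - 1) / (4 * Real.pi * (j.factorial : ℝ))

/-- The bounded operator `G` from `H^{-1,s}` to `H^{1,r}` is the operator `G_j` with the above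
kernel: it is given by the kernel on Schwartz functions, which are dense in `H^{-1,s}`. -/
def IsGreen (j : ℕ) {s r : ℝ} (G : WSob (-1) s →L[ℂ] WSob 1 r) : Prop :=
  ∀ (φ : 𝓢(E3, ℂ)) (u : WSob (-1) s), toDist u = (φ : Dist3) →
    Represents (fun x => ∫ y, (greenKernel j x y : ℂ) * φ y) (toDist (G u))

/-- The bounded operator `T` from `H^{1,r}` to `H^{-1,s}` is `W`. -/
def IsPerturbationOp (A : E3 → E3) (V : E3 → ℝ) {r s : ℝ}
    (T : WSob 1 r →L[ℂ] WSob (-1) s) : Prop :=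
  ∀ u : WSob 1 r, IsPerturbation A V (toDist u) (toDist (T u))

/-- `K = G_0 W` as a bounded operator on `H^{1,-t}`, where `W` maps `H^{1,-t}` to `H^{-1,β-t}`
and `G_0` maps `H^{-1,β-t}` to `H^{1,-t}`. -/
def IsGW (β : ℝ) (A : E3 → E3) (V : E3 → ℝ) (t : ℝ) (K : WSob 1 (-t) →L[ℂ] WSob 1 (-t)) : Prop :=
  ∃ (W : WSob 1 (-t) →L[ℂ] WSob (-1) (β - t)) (G : WSob (-1) (β - t) →L[ℂ] WSob 1 (-t)),
    IsPerturbationOp A V W ∧ IsGreen 0 G ∧ K = G ∘L W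

/-- `K = W G_0` as a bounded operator on `H^{-1,t}`, where `G_0` maps `H^{-1,t}` to `H^{1,t-β}`
and `W` maps `H^{1,t-β}` to `H^{-1,t}`. -/
def IsWG (β : ℝ) (A : E3 → E3) (V : E3 → ℝ) (t : ℝ) (K : WSob (-1) t →L[ℂ] WSob (-1) t) : Prop :=
  ∃ (G : WSob (-1) t →L[ℂ] WSob 1 (t - β)) (W : WSob 1 (t - β) →L[ℂ] WSob (-1) t),
    IsGreen 0 G ∧ IsPerturbationOp A V W ∧ K = W ∘L G

/-- `L` is the bounded two-sided inverse of `I + K`. -/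
def IsInverseOneAdd {X : Type*} [NormedAddCommGroup X] [NormedSpace ℂ X] (K L : X →L[ℂ] X) : Prop :=
  L ∘L (ContinuousLinearMap.id ℂ X + K) = ContinuousLinearMap.id ℂ X ∧
    (ContinuousLinearMap.id ℂ X + K) ∘L L = ContinuousLinearMap.id ℂ X

/-- `L = (I + G_0 W)⁻¹` in the bounded operators on `H^{1,-t}`. -/
def IsInvGW (β : ℝ) (A : E3 → E3) (V : E3 → ℝ) (t : ℝ) (L : WSob 1 (-t) →L[ℂ] WSob 1 (-t)) : Prop :=
  ∃ K, IsGW β A V t K ∧ IsInverseOneAdd K L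

/-- `L = (I + W G_0)⁻¹` in the bounded operators on `H^{-1,t}`. -/
def IsInvWG (β : ℝ) (A : E3 → E3) (V : E3 → ℝ) (t : ℝ) (L : WSob (-1) t →L[ℂ] WSob (-1) t) : Prop :=
  ∃ K, IsWG β A V t K ∧ IsInverseOneAdd K L

/-- The bounded operator `F` from `H^{-1,s}` to `H^{1,-s}` is `F_0 = (I + G_0 W)⁻¹ G_0`.
For every `t` with `1/2 < t < β - 1/2`, `t ≤ s` and `s + t ≥ 2`, the operator `I + G_0 W` is
boundedly invertible on `H^{1,-t}`, and `F` is the composition of `G_0` from `H^{-1,s}` to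
`H^{1,-t}`, this inverse, and the embedding of `H^{1,-t}` into `H^{1,-s}`. -/
def IsF0 (β : ℝ) (A : E3 → E3) (V : E3 → ℝ) (s : ℝ) (F : WSob (-1) s →L[ℂ] WSob 1 (-s)) : Prop :=
  ∀ t : ℝ, 1 / 2 < t → t < β - 1 / 2 → t ≤ s → 2 ≤ s + t →
    ∃ (L : WSob 1 (-t) →L[ℂ] WSob 1 (-t)) (G : WSob (-1) s →L[ℂ] WSob 1 (-t)),
      IsInvGW β A V t L ∧ IsGreen 0 G ∧ ∀ u, toDist (F u) = toDist (L (G u))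

/-- The bounded operator `F` from `H^{-1,s}` to `H^{1,-s}` is
`F_1 = (I + G_0 W)⁻¹ G_1 (I + W G_0)⁻¹`. For every `t` with `3/2 < t < β - 1/2` and `t ≤ s`, the
operators `I + W G_0` on `H^{-1,t}` and `I + G_0 W` on `H^{1,-t}` are boundedly invertible, and `F`
is the composition of the embedding of `H^{-1,s}` into `H^{-1,t}`, the first inverse, `G_1` from
`H^{-1,t}` to `H^{1,-t}`, the second inverse, and the embedding of `H^{1,-t}` into `H^{1,-s}`. -/
def IsF1 (β : ℝ) (A : E3 → E3) (V : E3 → ℝ) (s : ℝ) (F : WSob (-1) s →L[ℂ] WSob 1 (-s)) : Prop :=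
  ∀ t : ℝ, 3 / 2 < t → t < β - 1 / 2 → t ≤ s →
    ∃ (L : WSob 1 (-t) →L[ℂ] WSob 1 (-t)) (G : WSob (-1) t →L[ℂ] WSob 1 (-t))
      (L' : WSob (-1) t →L[ℂ] WSob (-1) t),
      IsInvGW β A V t L ∧ IsGreen 1 G ∧ IsInvWG β A V t L' ∧
        ∀ u : WSob (-1) s, ∃ v : WSob (-1) t,
          toDist v = toDist u ∧ toDist (F u) = toDist (L (G (L' v)))

end MagneticThreshold

end

open MeasureTheory Filter Topology Asymptotics TemperedDistribution
open scoped SchwartzMap LineDeriv Laplacian ContDiff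

noncomputable section

namespace MagneticThreshold

open WSob (toDist)

/-! ### Weights, multiplication operators and the identification of `H^{k,s}` with `L²` -/

/-! Let G(κ) = (-Δ + κ²)⁻¹, the convolution with exp(-κ|z|)/(4π|z|). Since H + κ² = (-Δ + κ²)(I +
G(κ)W), the resolvent is R(κ) = (I + G(κ)W)⁻¹G(κ). The multiplier (|ξ|² + κ²)⁻¹ becomes singular as
κ → 0, but the kernel does not: Taylor's formula in Re κ ≥ 0 gives G(κ) = G₀ + κG₁ + O(κ²), with a
remainder kernel bounded by |κ|²|x - y|/(4π). Such a kernel is bounded from weight t to weight -t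
when t > 5/2 (`exists_bound_expansion`).

The inverse persists at κ = 0. Multiplication by A or V gains β powers of ⟨x⟩, and giving up a
little of this gain makes W compact (`exists_compact_perturbationOp`), so the Fredholm alternative
applies to I + G₀W. If u = -G₀Wu, then Hu = 0, and reinserting u into this equation improves its
decay until u lies in every H^{1,-t} with t > 1/2; regularity of zero gives u = 0
(`eq_zero_of_greenRel_neg`, `exists_inverse`). The inverse of I + WG₀ follows from (I + WG₀)⁻¹ = I -
W(I + G₀W)⁻¹G₀. An exact identity (`inverse_comp_sub_eq`) transfers the expansion of G(κ) to (I +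
G(κ)W)⁻¹G(κ), and `exists_isResolvent` identifies this operator with the resolvent on L².

The estimates all take place in weighted L². The multipliers (1 - Δ)^{-1/2} and ∂_j(1 - Δ)^{-1/2}
preserve every L^{2,s} (`symbolsPreserve`), because their commutators with coordinates are
multipliers of the same kind; fractional weights come from interpolation. Since G(κ) = ⟨D⟩⁻¹(I + (1
- κ²)G(κ))⟨D⟩⁻¹, where ⟨D⟩ = (1 - Δ)^{1/2}, it remains to bound convolutions between weighted L²
spaces, which is done by Schur's test (`exists_isConv_inv`, `exists_isConv_weight`).

Operators on spaces with different weights are compared through the underlying distributions.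
Multiplication, convolution and H are relations that determine their output, so F₀ and F₁ do not
depend on the auxiliary exponent t. -/

theorem weight_mul (s t : ℝ) : weight s * weight t = weight (s + t) := by
  funext x
  have hx : (0 : ℝ) < 1 + ‖x‖ ^ 2 := by positivity
  simp only [weight, Pi.mul_apply]
  rw [← Complex.ofReal_mul, ← Real.rpow_add hx]
  congr 2
  ring

theorem weight_mul_apply (s t : ℝ) (x : E3) : weight s x * weight t x = weight (s + t) x :=
  congrFun (weight_mul s t) x

theorem weight_zero : weight 0 = fun _ => 1 := by
  funext x
  simp [weight]

theorem norm_weight (s : ℝ) (x : E3) : ‖weight s x‖ = (1 + ‖x‖ ^ 2) ^ (s / 2) := by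
  rw [weight, Complex.norm_real, Real.norm_of_nonneg (by positivity)]

theorem norm_weight_le_one {s : ℝ} (hs : s ≤ 0) (x : E3) : ‖weight s x‖ ≤ 1 := by
  rw [norm_weight]
  exact Real.rpow_le_one_of_one_le_of_nonpos (by nlinarith [sq_nonneg ‖x‖]) (by linarith)

theorem norm_weight_mono {s t : ℝ} (h : s ≤ t) (x : E3) : ‖weight s x‖ ≤ ‖weight t x‖ := by
  rw [norm_weight, norm_weight]
  exact Real.rpow_le_rpow_of_exponent_le (by nlinarith [sq_nonneg ‖x‖]) (by linarith)

theorem weight_ne_zero (s : ℝ) (x : E3) : weight s x ≠ 0 := by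
  rw [← norm_pos_iff, norm_weight]
  positivity

theorem continuous_weight (s : ℝ) : Continuous (weight s) :=
  (hasTemperateGrowth_weight s).1.continuous

theorem besselSymbol_mul (k l : ℝ) : besselSymbol k * besselSymbol l = besselSymbol (k + l) := by
  funext ξ
  exact congrFun (weight_mul k l) ((2 * Real.pi) • ξ)

theorem besselSymbol_zero : besselSymbol 0 = fun _ => 1 := by
  funext ξ
  simp [besselSymbol, weight]

/-- Multiplication of tempered distributions by `⟨x⟩ ^ s`. -/
def wmul (s : ℝ) : Dist3 →L[ℂ] Dist3 := smulLeftCLM ℂ (weight s)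

/-- The Bessel potential `(1 - Δ) ^ (k / 2)` on tempered distributions. -/
def bessel (k : ℝ) : Dist3 →L[ℂ] Dist3 := fourierMultiplierCLM ℂ (besselSymbol k)

theorem wmul_wmul (s t : ℝ) (u : Dist3) : wmul s (wmul t u) = wmul (s + t) u := by
  rw [wmul, wmul, smulLeftCLM_smulLeftCLM_apply (hasTemperateGrowth_weight _)
    (hasTemperateGrowth_weight _), mul_comm, weight_mul, wmul]

theorem wmul_zero (u : Dist3) : wmul 0 u = u := by
  rw [wmul, weight_zero, smulLeftCLM_const, one_smul]

theorem bessel_bessel (k l : ℝ) (u : Dist3) : bessel k (bessel l u) = bessel (k + l) u := by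
  rw [bessel, bessel, fourierMultiplierCLM_fourierMultiplierCLM_apply
    (hasTemperateGrowth_besselSymbol _) (hasTemperateGrowth_besselSymbol _), mul_comm,
    besselSymbol_mul, bessel]

theorem bessel_zero (u : Dist3) : bessel 0 u = u := by
  rw [bessel, besselSymbol_zero, fourierMultiplierCLM_const]
  simp

theorem mem_weightedSobolev {k s : ℝ} {u : Dist3} :
    u ∈ weightedSobolev k s ↔ ∃ f : L2, l2ToDist f = wmul s (bessel k u) := by
  simp only [weightedSobolev, Submodule.mem_comap, LinearMap.mem_range]
  rfl

/-- Multiplication by a bounded function on `L²`. -/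
def mulL2 {a : E3 → ℂ} (ha : MemLp a ⊤ (volume : Measure E3)) : L2 →L[ℂ] L2 :=
  (ContinuousLinearMap.mul ℂ ℂ).holderL volume ⊤ 2 2 ha.toLp

theorem coeFn_mulL2 {a : E3 → ℂ} (ha : MemLp a ⊤ (volume : Measure E3)) (f : L2) :
    mulL2 ha f =ᵐ[volume] fun x => a x * f x := by
  filter_upwards [(ContinuousLinearMap.mul ℂ ℂ).coeFn_holder (r := 2) ha.toLp f, ha.coeFn_toLp]
    with x h₁ h₂
  rw [← h₂]
  exact h₁

theorem memLp_top_of_bound {a : E3 → ℂ} (ha : AEStronglyMeasurable a volume) (C : ℝ)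
    (h : ∀ x, ‖a x‖ ≤ C) : MemLp a ⊤ (volume : Measure E3) :=
  MeasureTheory.memLp_top_of_bound ha C (Eventually.of_forall h)

theorem norm_mulL2_le {a : E3 → ℂ} (ha : MemLp a ⊤ (volume : Measure E3)) {C : ℝ} (hC : 0 ≤ C)
    (h : ∀ x, ‖a x‖ ≤ C) : ‖mulL2 ha‖ ≤ C := by
  refine ContinuousLinearMap.opNorm_le_bound _ hC fun f => ?_
  refine Lp.norm_le_mul_norm_of_ae_le_mul ?_
  filter_upwards [coeFn_mulL2 ha f] with x hx
  rw [hx, norm_mul]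
  gcongr
  exact h x

theorem l2ToDist_apply (f : L2) (φ : 𝓢(E3, ℂ)) : l2ToDist f φ = ∫ x, φ x * f x := by
  simp [l2ToDist]

theorem schwartz_apply (f φ : 𝓢(E3, ℂ)) : (f : Dist3) φ = ∫ x, φ x * f x := by
  simp

theorem integrable_schwartz_mul_l2 (φ : 𝓢(E3, ℂ)) (f : L2) :
    Integrable (fun x => φ x * f x) (volume : Measure E3) :=
  MemLp.integrable_mul (φ.memLp 2) (Lp.memLp f)

theorem l2ToDist_mulL2 {a : E3 → ℂ} (ha : MemLp a ⊤ (volume : Measure E3))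
    (h : a.HasTemperateGrowth) (f : L2) :
    l2ToDist (mulL2 ha f) = smulLeftCLM ℂ a (l2ToDist f) := by
  ext φ
  rw [smulLeftCLM_apply_apply, l2ToDist_apply, l2ToDist_apply]
  refine integral_congr_ae ?_
  filter_upwards [coeFn_mulL2 ha f] with x hx
  rw [hx, SchwartzMap.smulLeftCLM_apply_apply h, smul_eq_mul]
  ring

theorem memLp_weight {s : ℝ} (hs : s ≤ 0) : MemLp (weight s) ⊤ (volume : Measure E3) :=
  memLp_top_of_bound (continuous_weight s).aestronglyMeasurable 1 (norm_weight_le_one hs)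

theorem besselSymbol_hasBound {k : ℝ} (hk : k ≤ 0) (ξ : E3) : ‖besselSymbol k ξ‖ ≤ 1 :=
  norm_weight_le_one hk _

/-- A Fourier multiplier with a bounded symbol on `L²`. -/
def fourierMulL2 {m : E3 → ℂ} (hm : MemLp m ⊤ (volume : Measure E3)) : L2 →L[ℂ] L2 :=
  ((Lp.fourierTransformₗᵢ E3 ℂ).symm.toContinuousLinearEquiv : L2 →L[ℂ] L2) ∘L mulL2 hm ∘L
    ((Lp.fourierTransformₗᵢ E3 ℂ).toContinuousLinearEquiv : L2 →L[ℂ] L2)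

open FourierTransform in
theorem l2ToDist_fourierMulL2 {m : E3 → ℂ} (hm : MemLp m ⊤ (volume : Measure E3))
    (h : m.HasTemperateGrowth) (f : L2) :
    l2ToDist (fourierMulL2 hm f) = fourierMultiplierCLM ℂ m (l2ToDist f) := by
  have h₁ : 𝓕 (l2ToDist f) = l2ToDist (𝓕 f) := Lp.fourier_toTemperedDistribution_eq f
  have h₂ : 𝓕⁻ (l2ToDist (mulL2 hm (𝓕 f))) = l2ToDist (𝓕⁻ (mulL2 hm (𝓕 f))) :=
    Lp.fourierInv_toTemperedDistribution_eq _
  rw [fourierMultiplierCLM_apply, h₁, ← l2ToDist_mulL2 hm h, h₂]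
  rfl

theorem norm_fourierMulL2_le {m : E3 → ℂ} (hm : MemLp m ⊤ (volume : Measure E3)) {C : ℝ}
    (hC : 0 ≤ C) (h : ∀ x, ‖m x‖ ≤ C) : ‖fourierMulL2 hm‖ ≤ C := by
  refine ContinuousLinearMap.opNorm_le_bound _ hC fun f => ?_
  simp only [fourierMulL2, ContinuousLinearMap.comp_apply]
  refine (LinearIsometryEquiv.norm_map _ _).le.trans ?_
  refine ((mulL2 hm).le_opNorm _).trans ?_
  refine (mul_le_mul (norm_mulL2_le hm hC h) (LinearIsometryEquiv.norm_map _ _).le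
    (norm_nonneg _) hC)

/-! ### Isometry with `L²` and completeness -/

/-- The element of `H^{k,s}` with a given weighted Bessel potential. -/
theorem exists_toL2_eq (k s : ℝ) (f : L2) : ∃ u : WSob k s, WSob.toL2 u = f := by
  have h : wmul s (bessel k (bessel (-k) (wmul (-s) (l2ToDist f)))) = l2ToDist f := by
    rw [bessel_bessel, add_neg_cancel, bessel_zero, wmul_wmul, add_neg_cancel, wmul_zero]
  let u : WSob k s := ⟨bessel (-k) (wmul (-s) (l2ToDist f)), mem_weightedSobolev.2 ⟨f, h.symm⟩⟩
  exact ⟨u, l2ToDist_injective ((WSob.l2ToDist_toL2 u).trans h)⟩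

/-- The isometry `u ↦ ⟨x⟩ ^ s (1 - Δ) ^ (k / 2) u` of `H^{k,s}` onto `L²`. -/
def wsobEquiv (k s : ℝ) : WSob k s ≃ₗᵢ[ℂ] L2 where
  toLinearEquiv := LinearEquiv.ofBijective WSob.toL2 ⟨WSob.toL2_injective, exists_toL2_eq k s⟩
  norm_map' _ := rfl

theorem l2ToDist_wsobEquiv {k s : ℝ} (u : WSob k s) :
    l2ToDist (wsobEquiv k s u) = wmul s (bessel k (toDist u)) :=
  WSob.l2ToDist_toL2 u

theorem toDist_wsobEquiv_symm {k s : ℝ} (f : L2) :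
    toDist ((wsobEquiv k s).symm f) = bessel (-k) (wmul (-s) (l2ToDist f)) := by
  have h := l2ToDist_wsobEquiv ((wsobEquiv k s).symm f)
  rw [LinearIsometryEquiv.apply_symm_apply] at h
  rw [h, wmul_wmul, neg_add_cancel, wmul_zero, bessel_bessel, neg_add_cancel, bessel_zero]

theorem toDist_eq_bessel {k s : ℝ} (u : WSob k s) :
    toDist u = bessel (-k) (wmul (-s) (l2ToDist (wsobEquiv k s u))) := by
  rw [← toDist_wsobEquiv_symm, LinearIsometryEquiv.symm_apply_apply]

instance (k s : ℝ) : CompleteSpace (WSob k s) :=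
  (completeSpace_congr (e := (wsobEquiv k s).toEquiv)
    (wsobEquiv k s).isometry.isUniformEmbedding).2 inferInstance

theorem continuous_toDist {k s : ℝ} : Continuous (toDist : WSob k s →ₗ[ℂ] Dist3) := by
  have : (toDist : WSob k s →ₗ[ℂ] Dist3) =
      fun u => bessel (-k) (wmul (-s) (l2ToDist (wsobEquiv k s u))) := by
    funext u
    exact toDist_eq_bessel u
  rw [this]
  exact (bessel (-k)).continuous.comp ((wmul (-s)).continuous.comp
    (l2ToDist.continuous.comp (wsobEquiv k s).continuous))

/-- The inclusion of `H^{k,s}` into tempered distributions as a continuous map. -/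
def toDistCLM (k s : ℝ) : WSob k s →L[ℂ] Dist3 := ⟨toDist, continuous_toDist⟩

theorem toDist_mem {k s : ℝ} (u : WSob k s) : toDist u ∈ weightedSobolev k s := u.2

theorem exists_toDist_eq {k s : ℝ} {u : Dist3} (hu : u ∈ weightedSobolev k s) :
    ∃ v : WSob k s, toDist v = u := ⟨⟨u, hu⟩, rfl⟩

section Lift

variable {X : Type*} [NormedAddCommGroup X] [NormedSpace ℂ X] [CompleteSpace X] {k s : ℝ}

/-- A continuous map into tempered distributions with values in `H^{k,s}` is continuous into
`H^{k,s}`, by the closed graph theorem. -/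
def liftWSob (T : X →L[ℂ] Dist3) (hT : ∀ x, T x ∈ weightedSobolev k s) : X →L[ℂ] WSob k s :=
  ContinuousLinearMap.ofSeqClosedGraph
    (g := (LinearMap.codRestrict (weightedSobolev k s) (T : X →ₗ[ℂ] Dist3) hT : X →ₗ[ℂ] WSob k s))
    (by
      intro u x y hu hy
      apply WSob.toDist_injective
      have h₁ := ((continuous_toDist (k := k) (s := s)).tendsto y).comp hy
      have h₂ := (T.continuous.tendsto x).comp hu
      exact tendsto_nhds_unique h₁ h₂)

@[simp]
theorem toDist_liftWSob (T : X →L[ℂ] Dist3) (hT : ∀ x, T x ∈ weightedSobolev k s) (x : X) :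
    toDist (liftWSob T hT x) = T x := rfl

end Lift

/-- A continuous operator on tempered distributions mapping `H^{k,s}` to `H^{l,r}`, as a bounded
operator. -/
def restrictWSob {k s l r : ℝ} (T : Dist3 →L[ℂ] Dist3)
    (hT : ∀ u ∈ weightedSobolev k s, T u ∈ weightedSobolev l r) : WSob k s →L[ℂ] WSob l r :=
  liftWSob (T ∘L toDistCLM k s) fun u => hT _ (toDist_mem u)

@[simp]
theorem toDist_restrictWSob {k s l r : ℝ} (T : Dist3 →L[ℂ] Dist3)
    (hT : ∀ u ∈ weightedSobolev k s, T u ∈ weightedSobolev l r) (u : WSob k s) :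
    toDist (restrictWSob T hT u) = T (toDist u) := rfl

/-! ### Membership rules and embeddings for the weighted spaces. -/

theorem bessel_mem_iff {k l s : ℝ} {u : Dist3} :
    bessel k u ∈ weightedSobolev l s ↔ u ∈ weightedSobolev (l + k) s := by
  rw [mem_weightedSobolev, mem_weightedSobolev, bessel_bessel]

theorem mem_weightedSobolev_zero {s : ℝ} {u : Dist3} :
    u ∈ weightedSobolev 0 s ↔ ∃ f : L2, l2ToDist f = wmul s u := by
  rw [mem_weightedSobolev, bessel_zero]

theorem wmul_mem_iff {s r : ℝ} {u : Dist3} :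
    wmul r u ∈ weightedSobolev 0 s ↔ u ∈ weightedSobolev 0 (s + r) := by
  rw [mem_weightedSobolev_zero, mem_weightedSobolev_zero, wmul_wmul]

theorem smulLeft_mem {a : E3 → ℂ} (ha : a.HasTemperateGrowth) (C : ℝ) (h : ∀ x, ‖a x‖ ≤ C) {s : ℝ}
    {u : Dist3} (hu : u ∈ weightedSobolev 0 s) : smulLeftCLM ℂ a u ∈ weightedSobolev 0 s := by
  obtain ⟨f, hf⟩ := mem_weightedSobolev_zero.1 hu
  have ha' := memLp_top_of_bound ha.1.continuous.aestronglyMeasurable C h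
  refine mem_weightedSobolev_zero.2 ⟨mulL2 ha' f, ?_⟩
  rw [l2ToDist_mulL2 ha' ha, hf, wmul, smulLeftCLM_smulLeftCLM_apply (hasTemperateGrowth_weight _) ha,
    smulLeftCLM_smulLeftCLM_apply ha (hasTemperateGrowth_weight _), mul_comm]

theorem weightedSobolev_zero_mono {s t : ℝ} (h : s ≤ t) {u : Dist3}
    (hu : u ∈ weightedSobolev 0 t) : u ∈ weightedSobolev 0 s := by
  obtain ⟨f, hf⟩ := mem_weightedSobolev_zero.1 hu
  have hw := memLp_weight (sub_nonpos.2 h)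
  refine mem_weightedSobolev_zero.2 ⟨mulL2 hw f, ?_⟩
  rw [l2ToDist_mulL2 hw (hasTemperateGrowth_weight _), hf]
  change wmul (s - t) (wmul t u) = _
  rw [wmul_wmul, sub_add_cancel]

theorem weightedSobolev_mono {k s t : ℝ} (h : s ≤ t) {u : Dist3}
    (hu : u ∈ weightedSobolev k t) : u ∈ weightedSobolev k s := by
  have := weightedSobolev_zero_mono h (bessel_mem_iff.2 ((zero_add k).symm ▸ hu))
  have h2 := bessel_mem_iff.1 this
  rwa [zero_add] at h2

/-- The embedding of `H^{k,t}` into `H^{k,s}` for `s ≤ t`. -/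
def embed {k t s : ℝ} (h : s ≤ t) : WSob k t →L[ℂ] WSob k s :=
  restrictWSob (ContinuousLinearMap.id ℂ Dist3) fun _ hu => weightedSobolev_mono h hu

@[simp]
theorem toDist_embed {k t s : ℝ} (h : s ≤ t) (u : WSob k t) : toDist (embed h u) = toDist u := by
  rw [embed, toDist_restrictWSob, ContinuousLinearMap.id_apply]

/-! ### Distributions represented by functions -/

/-- A smooth bump equal to 1 on the compact set is an admissible test function, and on that set its
product with `f` is `f`. -/
theorem Represents.locallyIntegrable {f : E3 → ℂ} {u : Dist3} (h : Represents f u) :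
    LocallyIntegrable f volume := by
  rw [locallyIntegrable_iff]
  intro K hK
  obtain ⟨g, hg₁, hg₂, hg₃⟩ : ∃ g : E3 → ℝ, ContDiff ℝ ∞ g ∧ HasCompactSupport g ∧
      ∀ x ∈ K, g x = 1 := by
    obtain ⟨R, hR⟩ := hK.isBounded.subset_closedBall (0 : E3)
    let b : ContDiffBump (0 : E3) := ⟨max R 1, max R 1 + 1, by positivity, by linarith⟩
    refine ⟨b, b.contDiff, b.hasCompactSupport, fun x hx => b.one_of_mem_closedBall ?_⟩
    exact Metric.closedBall_subset_closedBall (le_max_left _ _) (hR hx)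
  have h₁ : HasCompactSupport (Complex.ofRealCLM ∘ g) := hg₂.comp_left rfl
  have h₂ : ContDiff ℝ ∞ (Complex.ofRealCLM ∘ g) := by fun_prop
  have h₃ := (h (h₁.toSchwartzMap h₂)).1.integrableOn (s := K)
  refine h₃.congr_fun ?_ hK.measurableSet
  intro x hx
  simp [hg₃ x hx]

/-- Locally integrable functions with the same integrals against test functions agree almost
everywhere. Multiplication by a nonsmooth function is thereby a well defined partial operation on
distributions. -/
theorem Represents.unique {f g : E3 → ℂ} {u : Dist3} (hf : Represents f u) (hg : Represents g u) :
    f =ᵐ[volume] g := by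
  refine ae_eq_of_integral_contDiff_smul_eq hf.locallyIntegrable hg.locallyIntegrable ?_
  intro φ hφ hc
  have h₁ : HasCompactSupport (Complex.ofRealCLM ∘ φ) := hc.comp_left rfl
  have h₂ : ContDiff ℝ ∞ (Complex.ofRealCLM ∘ φ) := by fun_prop
  have := (hf (h₁.toSchwartzMap h₂)).2.symm.trans (hg (h₁.toSchwartzMap h₂)).2
  simpa using this

theorem Represents.congr {f g : E3 → ℂ} {u : Dist3} (hf : Represents f u) (h : f =ᵐ[volume] g) :
    Represents g u := by
  intro φ
  have h' : (fun x => φ x * f x) =ᵐ[volume] fun x => φ x * g x := by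
    filter_upwards [h] with x hx
    rw [hx]
  exact ⟨(hf φ).1.congr h', (hf φ).2.trans (integral_congr_ae h')⟩

theorem Represents.eq {f : E3 → ℂ} {u v : Dist3} (hu : Represents f u) (hv : Represents f v) :
    u = v := by
  ext φ
  rw [(hu φ).2, (hv φ).2]

theorem IsMul.unique {a : E3 → ℝ} {u v v' : Dist3} (h : IsMul a u v) (h' : IsMul a u v') :
    v = v' := by
  obtain ⟨f, hf, hv⟩ := h
  obtain ⟨g, hg, hv'⟩ := h'
  refine hv.eq (hv'.congr ?_)
  filter_upwards [hf.unique hg] with x hx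
  rw [hx]

/-- Each intermediate distribution is determined by the previous one, so `H u` has at most one
value. This is what allows realizations of `W` on different spaces to be identified. -/
theorem IsHamiltonian.unique {A : E3 → E3} {V : E3 → ℝ} {u h h' : Dist3}
    (H : IsHamiltonian A V u h) (H' : IsHamiltonian A V u h') : h = h' := by
  obtain ⟨d, e, c, hd, he, hc, rfl⟩ := H
  obtain ⟨d', e', c', hd', he', hc', rfl⟩ := H'
  have h₁ : ∀ j, d j = d' j := fun j => sub_right_injective ((hd j).unique (hd' j))
  have h₂ : ∀ j, e j = e' j := fun j =>
    sub_right_injective ((he j).unique ((h₁ j).symm ▸ he' j))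
  rw [hc.unique hc', Finset.sum_congr rfl fun j _ => h₂ j]

/-- The function representing an element of a weighted `L²` space. -/
def wfun {s : ℝ} (u : WSob 0 s) (x : E3) : ℂ := weight (-s) x * wsobEquiv 0 s u x

theorem represents_wmul {r : ℝ} (f : L2) :
    Represents (fun x => weight r x * f x) (wmul r (l2ToDist f)) := by
  intro φ
  have hw := hasTemperateGrowth_weight r
  have h : (fun x => φ x * (weight r x * f x)) =
      fun x => SchwartzMap.smulLeftCLM ℂ (weight r) φ x * f x := by
    funext x
    rw [SchwartzMap.smulLeftCLM_apply_apply hw, smul_eq_mul]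
    ring
  rw [h]
  refine ⟨integrable_schwartz_mul_l2 _ f, ?_⟩
  rw [wmul, smulLeftCLM_apply_apply, l2ToDist_apply]

theorem represents_wfun {s : ℝ} (u : WSob 0 s) : Represents (wfun u) (toDist u) := by
  have h := represents_wmul (r := -s) (wsobEquiv 0 s u)
  rwa [l2ToDist_wsobEquiv, bessel_zero, wmul_wmul, neg_add_cancel, wmul_zero] at h

/-- Multiplication by a function `a` with `⟨x⟩ ^ β a` bounded, as a map between weighted `L²`
spaces. -/
theorem exists_mulOp {a : E3 → ℝ} (ha : AEStronglyMeasurable a volume) {C β s r : ℝ}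
    (hC : ∀ x, |a x| ≤ C * (1 + ‖x‖ ^ 2) ^ (-β / 2)) (hr : r ≤ s + β) :
    ∃ M : WSob 0 s →L[ℂ] WSob 0 r, ∀ u, IsMul a (toDist u) (toDist (M u)) := by
  -- Transported to L² on both sides, multiplication by `a` becomes multiplication by ⟨x⟩^{r-s} a,
  -- which is bounded because r - s - β ≤ 0.
  have hb : MemLp (fun x => weight (r - s) x * (a x : ℂ)) ⊤ (volume : Measure E3) := by
    refine memLp_top_of_bound ?_ |C| fun x => ?_
    · exact (continuous_weight _).aestronglyMeasurable.mul
        (Complex.continuous_ofReal.comp_aestronglyMeasurable ha)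
    · rw [norm_mul, norm_weight, Complex.norm_real, Real.norm_eq_abs]
      have hx : (1 : ℝ) ≤ 1 + ‖x‖ ^ 2 := by nlinarith [sq_nonneg ‖x‖]
      calc (1 + ‖x‖ ^ 2) ^ ((r - s) / 2) * |a x|
          ≤ (1 + ‖x‖ ^ 2) ^ ((r - s) / 2) * (|C| * (1 + ‖x‖ ^ 2) ^ (-β / 2)) := by
            gcongr
            exact (hC x).trans (by gcongr; exact le_abs_self C)
        _ = |C| * (1 + ‖x‖ ^ 2) ^ ((r - s) / 2 + -β / 2) := by
            rw [Real.rpow_add (by positivity)]; ring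
        _ ≤ |C| * 1 := by
            gcongr
            exact Real.rpow_le_one_of_one_le_of_nonpos hx (by linarith)
        _ = |C| := mul_one _
  refine ⟨((wsobEquiv 0 r).symm.toContinuousLinearEquiv : L2 →L[ℂ] WSob 0 r) ∘L mulL2 hb ∘L
    ((wsobEquiv 0 s).toContinuousLinearEquiv : WSob 0 s →L[ℂ] L2), fun u => ⟨wfun u,
    represents_wfun u, ?_⟩⟩
  refine (represents_wfun _).congr ?_
  have h : wsobEquiv 0 r ((((wsobEquiv 0 r).symm.toContinuousLinearEquiv : L2 →L[ℂ] WSob 0 r) ∘L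
    mulL2 hb ∘L ((wsobEquiv 0 s).toContinuousLinearEquiv : WSob 0 s →L[ℂ] L2)) u) =
      mulL2 hb (wsobEquiv 0 s u) := (wsobEquiv 0 r).apply_symm_apply _
  filter_upwards [coeFn_mulL2 hb (wsobEquiv 0 s u)] with x hx
  rw [wfun, wfun, h, hx, ← mul_assoc, ← mul_assoc, weight_mul_apply]
  rw [show -r + (r - s) = -s by ring]
  ring

/-! ### Interpolation between weighted `L²` spaces -/

section Interpolation

theorem lintegral_sq_enorm (f : L2) : ∫⁻ x, ‖f x‖ₑ ^ 2 = ‖f‖ₑ ^ 2 := by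
  rw [Lp.enorm_def, eLpNorm_eq_lintegral_rpow_enorm_toReal (by norm_num) (by norm_num)]
  rw [← ENNReal.rpow_natCast, ← ENNReal.rpow_mul]
  simp

/-- The function `λ ^ (-2θ-1) min(1, λ²)`. -/
def interpWeight (θ l : ℝ) : ℝ := l ^ (-2 * θ - 1) * min 1 (l ^ 2)

theorem interpWeight_nonneg (θ : ℝ) {l : ℝ} (hl : 0 < l) : 0 ≤ interpWeight θ l := by
  unfold interpWeight
  positivity

/-- The minimum switches at 1. Below it the function is l^{1-2θ}, integrable since θ < 1; above it
l^{-2θ-1}, integrable since θ > 0. -/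
theorem integrableOn_interpWeight {θ : ℝ} (h₀ : 0 < θ) (h₁ : θ < 1) :
    IntegrableOn (interpWeight θ) (Set.Ioi 0) := by
  rw [← Set.Ioc_union_Ioi_eq_Ioi (zero_le_one' ℝ)]
  refine IntegrableOn.union ?_ ?_
  · have : IntegrableOn (fun l : ℝ => l ^ (1 - 2 * θ)) (Set.Ioc 0 1) := by
      rw [← intervalIntegrable_iff_integrableOn_Ioc_of_le zero_le_one]
      exact intervalIntegral.intervalIntegrable_rpow' (by linarith)
    refine this.congr_fun (fun l hl => ?_) measurableSet_Ioc
    rw [interpWeight, min_eq_right (by nlinarith [hl.1, hl.2]), ← Real.rpow_natCast,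
      ← Real.rpow_add hl.1]
    push_cast
    ring_nf
  · have : IntegrableOn (fun l : ℝ => l ^ (-2 * θ - 1)) (Set.Ioi 1) :=
      integrableOn_Ioi_rpow_of_lt (by linarith) one_pos
    refine this.congr_fun (fun l hl => ?_) measurableSet_Ioi
    have : (1 : ℝ) < l := hl
    rw [interpWeight, min_eq_left (by nlinarith), mul_one]

theorem integral_interpWeight_pos {θ : ℝ} (h₀ : 0 < θ) (h₁ : θ < 1) :
    0 < ∫ l in Set.Ioi 0, interpWeight θ l := by
  have h : ∫ l in Set.Ioi (1 : ℝ), l ^ (-2 * θ - 1) ≤ ∫ l in Set.Ioi 0, interpWeight θ l := by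
    have : ∫ l in Set.Ioi (1 : ℝ), l ^ (-2 * θ - 1) = ∫ l in Set.Ioi 1, interpWeight θ l := by
      refine setIntegral_congr_fun measurableSet_Ioi fun l hl => ?_
      have : (1 : ℝ) < l := hl
      simp only [interpWeight]
      rw [min_eq_left (by nlinarith), mul_one]
    rw [this]
    refine setIntegral_mono_set (integrableOn_interpWeight h₀ h₁) ?_
      (Set.Ioi_subset_Ioi zero_le_one).eventuallyLE
    filter_upwards [self_mem_ae_restrict measurableSet_Ioi] with l hl
    exact interpWeight_nonneg θ hl
  refine lt_of_lt_of_le ?_ h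
  rw [integral_Ioi_rpow_of_lt (by linarith) one_pos, Real.one_rpow,
    show -2 * θ - 1 + 1 = -(2 * θ) by ring, neg_div_neg_eq]
  positivity

/-- The substitution l ↦ wl extracts the power w^{2θ}. Up to a constant, w^{2θ} is thus a
superposition of the truncated weights min(1, (lw)²), for which an estimate can be obtained by
splitting the function. -/
theorem lintegral_interpWeight {θ : ℝ} (h₀ : 0 < θ) (h₁ : θ < 1) {w : ℝ} (hw : 0 < w) :
    ∫⁻ l in Set.Ioi 0, ENNReal.ofReal (l ^ (-2 * θ - 1) * min 1 ((l * w) ^ 2)) =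
      ENNReal.ofReal (w ^ (2 * θ)) * ENNReal.ofReal (∫ l in Set.Ioi 0, interpWeight θ l) := by
  have heq : ∀ l ∈ Set.Ioi (0 : ℝ), l ^ (-2 * θ - 1) * min 1 ((l * w) ^ 2) =
      w ^ (2 * θ + 1) * interpWeight θ (w * l) := by
    intro l hl
    have hl' : (0 : ℝ) < l := hl
    rw [interpWeight, Real.mul_rpow hw.le hl'.le, ← mul_assoc, ← mul_assoc, ← Real.rpow_add hw,
      mul_comm w l]
    rw [show 2 * θ + 1 + (-2 * θ - 1) = 0 by ring, Real.rpow_zero, one_mul]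
  rw [setLIntegral_congr_fun measurableSet_Ioi fun l hl => by rw [heq l hl]]
  have hint : IntegrableOn (fun l => interpWeight θ (w * l)) (Set.Ioi 0) := by
    have := (integrableOn_Ioi_comp_mul_left_iff (interpWeight θ) 0 hw).2
      (by rw [mul_zero]; exact integrableOn_interpWeight h₀ h₁)
    exact this
  rw [← ofReal_integral_eq_lintegral_ofReal (hint.const_mul _), integral_const_mul,
    integral_comp_mul_left_Ioi _ _ hw, mul_zero, smul_eq_mul, ← ENNReal.ofReal_mul (by positivity),
    ← mul_assoc]
  · congr 2
    rw [Real.rpow_add hw, Real.rpow_one]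
    field_simp
  · filter_upwards [self_mem_ae_restrict measurableSet_Ioi] with l hl
    have hl' : (0 : ℝ) < l := hl
    exact mul_nonneg (by positivity) (interpWeight_nonneg θ (by positivity))

theorem enorm_add_sq_le (a b : ℂ) : ‖a + b‖ₑ ^ 2 ≤ 2 * ‖a‖ₑ ^ 2 + 2 * ‖b‖ₑ ^ 2 := by
  have h : ‖a + b‖ ^ 2 ≤ 2 * ‖a‖ ^ 2 + 2 * ‖b‖ ^ 2 := by
    have := norm_add_le a b
    have h1 := norm_nonneg (a + b)
    nlinarith [sq_nonneg (‖a‖ - ‖b‖)]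
  have := ENNReal.ofReal_le_ofReal h
  rw [ENNReal.ofReal_add (by positivity) (by positivity), ENNReal.ofReal_mul (by norm_num),
    ENNReal.ofReal_mul (by norm_num), ENNReal.ofReal_pow (norm_nonneg _),
    ENNReal.ofReal_pow (norm_nonneg _), ENNReal.ofReal_pow (norm_nonneg _)] at this
  simpa only [ofReal_norm, ENNReal.ofReal_ofNat] using this

variable {w : E3 → ℝ} {T : L2 →L[ℂ] L2} {C : ENNReal}

/-- The function is split at the level lw = 1. Where lw > 1 the unweighted bound is used with min ≤
1; where lw ≤ 1 the function w f is in L² and the weighted bound is used with min ≤ (lw)². The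
constant is independent of l. -/
theorem lintegral_min_weight_le (hw : Continuous w) (hpos : ∀ x, 0 < w x)
    (hT : ∀ f g : L2, (∀ᵐ x, g x = w x * f x) →
      ∫⁻ x, ENNReal.ofReal (w x) ^ 2 * ‖T f x‖ₑ ^ 2 ≤ C * ∫⁻ x, ‖g x‖ₑ ^ 2)
    {l : ℝ} (hl : 0 < l) (f : L2) :
    ∫⁻ x, ENNReal.ofReal (min 1 ((l * w x) ^ 2)) * ‖T f x‖ₑ ^ 2 ≤
      2 * (‖T‖ₑ ^ 2 + C) * ∫⁻ x, ENNReal.ofReal (min 1 ((l * w x) ^ 2)) * ‖f x‖ₑ ^ 2 := by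
  classical
  let S : Set E3 := {x | l * w x ≤ 1}
  have hS : MeasurableSet S := measurableSet_le (by fun_prop) measurable_const
  have hm₁ : MemLp (S.indicator fun _ => (1 : ℂ)) ⊤ (volume : Measure E3) :=
    memLp_top_of_bound (measurable_const.indicator hS).aestronglyMeasurable 1 fun x => by
      by_cases hx : x ∈ S <;> simp [hx]
  have hm₀ : MemLp (Sᶜ.indicator fun _ => (1 : ℂ)) ⊤ (volume : Measure E3) :=
    memLp_top_of_bound (measurable_const.indicator hS.compl).aestronglyMeasurable 1 fun x => by
      by_cases hx : x ∈ S <;> simp [hx]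
  have hm₂ : MemLp (S.indicator fun x => (w x : ℂ)) ⊤ (volume : Measure E3) := by
    refine memLp_top_of_bound ?_ l⁻¹ fun x => ?_
    · exact ((Complex.measurable_ofReal.comp hw.measurable).indicator hS).aestronglyMeasurable
    · by_cases hx : x ∈ S
      · rw [Set.indicator_of_mem hx, Complex.norm_real, Real.norm_of_nonneg (hpos x).le,
          ← one_div, le_div_iff₀ hl, mul_comm]
        exact hx
      · rw [Set.indicator_of_notMem hx, norm_zero]
        positivity
  set f₁ := mulL2 hm₁ f with hf₁
  set f₀ := mulL2 hm₀ f with hf₀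
  set g := mulL2 hm₂ f with hg
  have hsum : f = f₀ + f₁ := by
    refine Lp.ext ?_
    filter_upwards [coeFn_mulL2 hm₁ f, coeFn_mulL2 hm₀ f, Lp.coeFn_add f₀ f₁] with x h₁ h₂ h₃
    rw [h₃, Pi.add_apply, hf₀, hf₁, h₁, h₂]
    by_cases hx : x ∈ S <;> simp [hx]
  have hgf : ∀ᵐ x, g x = w x * f₁ x := by
    filter_upwards [coeFn_mulL2 hm₁ f, coeFn_mulL2 hm₂ f] with x h₁ h₂
    rw [hg, h₂, hf₁, h₁]
    by_cases hx : x ∈ S <;> simp [hx]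
  have hTf : ∀ᵐ x, T f x = T f₀ x + T f₁ x := by
    have : T f = T f₀ + T f₁ := by rw [← map_add, ← hsum]
    rw [this]
    exact Lp.coeFn_add _ _
  have hmeas : ∀ h : L2, AEMeasurable (fun x => ‖h x‖ₑ ^ 2) (volume : Measure E3) := fun h =>
    (Lp.aestronglyMeasurable h).enorm.pow_const 2
  have e₀ : ∫⁻ x, ‖f₀ x‖ₑ ^ 2 ≤ ∫⁻ x, ENNReal.ofReal (min 1 ((l * w x) ^ 2)) * ‖f x‖ₑ ^ 2 := by
    refine lintegral_mono_ae ?_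
    filter_upwards [coeFn_mulL2 hm₀ f] with x h₁
    rw [hf₀, h₁]
    by_cases hx : x ∈ S
    · simp [hx]
    · have : 1 ≤ (l * w x) ^ 2 := by
        have : 1 < l * w x := not_le.1 hx
        nlinarith
      simp [hx, min_eq_left this]
  have e₁ : ENNReal.ofReal l ^ 2 * ∫⁻ x, ‖g x‖ₑ ^ 2 ≤
      ∫⁻ x, ENNReal.ofReal (min 1 ((l * w x) ^ 2)) * ‖f x‖ₑ ^ 2 := by
    rw [← lintegral_const_mul'' _ (hmeas g)]
    refine lintegral_mono_ae ?_
    filter_upwards [coeFn_mulL2 hm₂ f] with x h₁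
    rw [hg, h₁]
    by_cases hx : x ∈ S
    · have h2 : l * w x ≤ 1 := hx
      have h3 : 0 < l * w x := mul_pos hl (hpos x)
      rw [min_eq_right (by nlinarith), Set.indicator_of_mem hx, enorm_mul, mul_pow, ← mul_assoc,
        ← mul_pow, ENNReal.ofReal_pow h3.le, ENNReal.ofReal_mul hl.le]
      rw [← ofReal_norm (w x : ℂ), Complex.norm_real, Real.norm_of_nonneg (hpos x).le]
    · simp [hx]
  have key : ∀ᵐ x, ENNReal.ofReal (min 1 ((l * w x) ^ 2)) * ‖T f x‖ₑ ^ 2 ≤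
      2 * ‖T f₀ x‖ₑ ^ 2 +
        2 * (ENNReal.ofReal l ^ 2 * (ENNReal.ofReal (w x) ^ 2 * ‖T f₁ x‖ₑ ^ 2)) := by
    filter_upwards [hTf] with x hx
    rw [hx]
    calc ENNReal.ofReal (min 1 ((l * w x) ^ 2)) * ‖T f₀ x + T f₁ x‖ₑ ^ 2
        ≤ ENNReal.ofReal (min 1 ((l * w x) ^ 2)) *
          (2 * ‖T f₀ x‖ₑ ^ 2 + 2 * ‖T f₁ x‖ₑ ^ 2) := by gcongr; exact enorm_add_sq_le _ _
      _ = ENNReal.ofReal (min 1 ((l * w x) ^ 2)) * (2 * ‖T f₀ x‖ₑ ^ 2) +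
          ENNReal.ofReal (min 1 ((l * w x) ^ 2)) * (2 * ‖T f₁ x‖ₑ ^ 2) := mul_add _ _ _
      _ ≤ 1 * (2 * ‖T f₀ x‖ₑ ^ 2) +
          (ENNReal.ofReal l ^ 2 * ENNReal.ofReal (w x) ^ 2) * (2 * ‖T f₁ x‖ₑ ^ 2) := by
          gcongr
          · rw [← ENNReal.ofReal_one]
            exact ENNReal.ofReal_le_ofReal (min_le_left _ _)
          · rw [← mul_pow, ← ENNReal.ofReal_mul hl.le, ← ENNReal.ofReal_pow
              (mul_pos hl (hpos x)).le]
            exact ENNReal.ofReal_le_ofReal (min_le_right _ _)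
      _ = _ := by ring
  calc _ ≤ ∫⁻ x, (2 * ‖T f₀ x‖ₑ ^ 2 +
        2 * (ENNReal.ofReal l ^ 2 * (ENNReal.ofReal (w x) ^ 2 * ‖T f₁ x‖ₑ ^ 2))) :=
        lintegral_mono_ae key
    _ = 2 * (∫⁻ x, ‖T f₀ x‖ₑ ^ 2) + 2 * (ENNReal.ofReal l ^ 2 *
        ∫⁻ x, ENNReal.ofReal (w x) ^ 2 * ‖T f₁ x‖ₑ ^ 2) := by
        have hm : AEMeasurable (fun x => ENNReal.ofReal (w x) ^ 2 * ‖T f₁ x‖ₑ ^ 2)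
          (volume : Measure E3) :=
          (hw.measurable.ennreal_ofReal.pow_const 2).aemeasurable.mul (hmeas (T f₁))
        rw [lintegral_add_left' ((hmeas (T f₀)).const_mul 2), lintegral_const_mul'' _ (hmeas _),
          lintegral_const_mul'' _ (hm.const_mul _), lintegral_const_mul'' _ hm]
    _ ≤ 2 * (‖T‖ₑ ^ 2 * (∫⁻ x, ‖f₀ x‖ₑ ^ 2)) + 2 * (ENNReal.ofReal l ^ 2 *
        (C * ∫⁻ x, ‖g x‖ₑ ^ 2)) := by
        gcongr
        · rw [lintegral_sq_enorm, lintegral_sq_enorm, ← mul_pow]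
          gcongr
          exact T.le_opENorm f₀
        · exact hT f₁ g hgf
    _ = 2 * (‖T‖ₑ ^ 2 * (∫⁻ x, ‖f₀ x‖ₑ ^ 2) + C * (ENNReal.ofReal l ^ 2 * ∫⁻ x, ‖g x‖ₑ ^ 2)) := by
        ring
    _ ≤ 2 * (‖T‖ₑ ^ 2 * (∫⁻ x, ENNReal.ofReal (min 1 ((l * w x) ^ 2)) * ‖f x‖ₑ ^ 2) +
        C * ∫⁻ x, ENNReal.ofReal (min 1 ((l * w x) ^ 2)) * ‖f x‖ₑ ^ 2) := by
        gcongr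
    _ = _ := by ring

/-- An operator bounded on `L²` and on `L²(w² dx)` is bounded on `L²(w ^ (2θ) dx)`, `0 < θ < 1`. -/
theorem lintegral_interpolate (hw : Continuous w) (hpos : ∀ x, 0 < w x)
    (hT : ∀ f g : L2, (∀ᵐ x, g x = w x * f x) →
      ∫⁻ x, ENNReal.ofReal (w x) ^ 2 * ‖T f x‖ₑ ^ 2 ≤ C * ∫⁻ x, ‖g x‖ₑ ^ 2)
    (hC : C ≠ ⊤) {θ : ℝ} (h₀ : 0 < θ) (h₁ : θ < 1) (f : L2) :
    ∫⁻ x, ENNReal.ofReal (w x ^ (2 * θ)) * ‖T f x‖ₑ ^ 2 ≤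
      2 * (‖T‖ₑ ^ 2 + C) * ∫⁻ x, ENNReal.ofReal (w x ^ (2 * θ)) * ‖f x‖ₑ ^ 2 := by
  set I := ENNReal.ofReal (∫ l in Set.Ioi 0, interpWeight θ l) with hI
  have hI0 : I ≠ 0 := by simpa [hI] using integral_interpWeight_pos h₀ h₁
  have hIt : I ≠ ⊤ := ENNReal.ofReal_ne_top
  have hwm : Measurable w := hw.measurable
  -- Tonelli's theorem and the superposition formula express the norm with weight w^{2θ} through the
  -- truncated norms, both for `f` and for `T f`.
  have key : ∀ h : L2, I * ∫⁻ x, ENNReal.ofReal (w x ^ (2 * θ)) * ‖h x‖ₑ ^ 2 =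
      ∫⁻ l in Set.Ioi 0, ENNReal.ofReal (l ^ (-2 * θ - 1)) *
        ∫⁻ x, ENNReal.ofReal (min 1 ((l * w x) ^ 2)) * ‖h x‖ₑ ^ 2 := by
    intro h
    have hm : AEMeasurable (fun x => ‖h x‖ₑ ^ 2) (volume : Measure E3) :=
      (Lp.aestronglyMeasurable h).enorm.pow_const 2
    have hm2 : AEMeasurable (Function.uncurry fun (l : ℝ) (x : E3) =>
        ENNReal.ofReal (l ^ (-2 * θ - 1) * min 1 ((l * w x) ^ 2)) * ‖h x‖ₑ ^ 2)
        ((volume.restrict (Set.Ioi 0)).prod (volume : Measure E3)) := by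
      have : Measurable fun p : ℝ × E3 =>
          ENNReal.ofReal (p.1 ^ (-2 * θ - 1) * min 1 ((p.1 * w p.2) ^ 2)) := by fun_prop
      exact this.aemeasurable.mul hm.comp_snd
    calc I * ∫⁻ x, ENNReal.ofReal (w x ^ (2 * θ)) * ‖h x‖ₑ ^ 2
        = ∫⁻ x, ∫⁻ l in Set.Ioi 0,
          ENNReal.ofReal (l ^ (-2 * θ - 1) * min 1 ((l * w x) ^ 2)) * ‖h x‖ₑ ^ 2 := by
          have hmw : AEMeasurable (fun x => ENNReal.ofReal (w x ^ (2 * θ)) * ‖h x‖ₑ ^ 2)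
            (volume : Measure E3) := (hwm.pow_const _).ennreal_ofReal.aemeasurable.mul hm
          rw [← lintegral_const_mul'' _ hmw]
          refine lintegral_congr fun x => ?_
          have hmx : Measurable fun l : ℝ =>
            ENNReal.ofReal (l ^ (-2 * θ - 1) * min 1 ((l * w x) ^ 2)) := by fun_prop
          rw [lintegral_mul_const _ hmx, lintegral_interpWeight h₀ h₁ (hpos x)]
          ring
      _ = ∫⁻ l in Set.Ioi 0, ∫⁻ x,
          ENNReal.ofReal (l ^ (-2 * θ - 1) * min 1 ((l * w x) ^ 2)) * ‖h x‖ₑ ^ 2 :=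
          (lintegral_lintegral_swap hm2).symm
      _ = _ := by
          refine setLIntegral_congr_fun measurableSet_Ioi fun l hl => ?_
          have hl' : (0 : ℝ) < l := hl
          have hmx : AEMeasurable (fun x => ENNReal.ofReal (min 1 ((l * w x) ^ 2)) * ‖h x‖ₑ ^ 2)
            (volume : Measure E3) := (by fun_prop : Measurable fun x =>
              ENNReal.ofReal (min 1 ((l * w x) ^ 2))).aemeasurable.mul hm
          rw [← lintegral_const_mul'' _ hmx]
          refine lintegral_congr fun x => ?_
          rw [ENNReal.ofReal_mul (by positivity)]
          ring
  have hle : I * ∫⁻ x, ENNReal.ofReal (w x ^ (2 * θ)) * ‖T f x‖ₑ ^ 2 ≤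
      I * (2 * (‖T‖ₑ ^ 2 + C) * ∫⁻ x, ENNReal.ofReal (w x ^ (2 * θ)) * ‖f x‖ₑ ^ 2) := by
    rw [key (T f), mul_left_comm, key f]
    rw [← lintegral_const_mul' _ _ (ENNReal.mul_ne_top (by norm_num)
      (ENNReal.add_ne_top.2 ⟨ENNReal.pow_ne_top enorm_ne_top, hC⟩))]
    refine setLIntegral_mono' measurableSet_Ioi fun l hl => ?_
    refine (mul_le_mul' le_rfl (lintegral_min_weight_le hw hpos hT hl f)).trans ?_
    exact (mul_left_comm _ _ _).le
  exact (ENNReal.mul_le_mul_iff_right hI0 hIt).1 hle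

end Interpolation

/-! ### An algebra of symbols preserving the weighted spaces -/

/-- The standard basis vectors. -/
abbrev basisVec (j : Fin 3) : E3 := EuclideanSpace.single j 1

theorem inner_basisVec (x : E3) (j : Fin 3) : inner ℝ x (basisVec j) = x j := by
  simp [basisVec, EuclideanSpace.inner_single_right]

theorem hasFDerivAt_weight (s : ℝ) (x : E3) :
    HasFDerivAt (weight s) (Complex.ofRealCLM ∘L
      ((s * (1 + ‖x‖ ^ 2) ^ (s / 2 - 1)) • (innerSL ℝ x : E3 →L[ℝ] ℝ))) x := by
  have h₁ : HasFDerivAt (fun y : E3 => 1 + ‖y‖ ^ 2) (2 • (innerSL ℝ x)) x :=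
    ((hasStrictFDerivAt_norm_sq x).hasFDerivAt).const_add 1
  have hx : (1 + ‖x‖ ^ 2 : ℝ) ≠ 0 := by positivity
  have h₂ := h₁.rpow_const (p := s / 2) (Or.inl hx)
  have h₃ := Complex.ofRealCLM.hasFDerivAt.comp x h₂
  convert! h₃ using 2
  rw [two_smul, ← two_smul ℝ, smul_smul]
  congr 1
  ring

theorem fderiv_weight (s : ℝ) (x v : E3) :
    fderiv ℝ (weight s) x v = s * (inner ℝ x v : ℝ) * weight (s - 2) x := by
  rw [(hasFDerivAt_weight s x).fderiv]
  simp only [ContinuousLinearMap.comp_apply, _root_.smul_apply, innerSL_apply_apply,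
    Complex.ofRealCLM_apply, smul_eq_mul, weight]
  rw [show (s - 2) / 2 = s / 2 - 1 by ring]
  push_cast
  ring

theorem fderiv_besselSymbol (k : ℝ) (ξ v : E3) : fderiv ℝ (besselSymbol k) ξ v =
    (2 * Real.pi) ^ 2 * k * (inner ℝ ξ v : ℝ) * besselSymbol (k - 2) ξ := by
  have h := (hasFDerivAt_weight k ((2 * Real.pi) • ξ)).comp ξ
    (((2 * Real.pi) • ContinuousLinearMap.id ℝ E3).hasFDerivAt (x := ξ))
  have h' : HasFDerivAt (besselSymbol k) _ ξ := h
  rw [h'.fderiv, ContinuousLinearMap.comp_apply, ← (hasFDerivAt_weight k _).fderiv, fderiv_weight]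
  simp only [_root_.smul_apply, ContinuousLinearMap.id_apply, inner_smul_left,
    inner_smul_right, besselSymbol]
  rw [show (starRingEnd ℝ) (2 * Real.pi) = 2 * Real.pi from rfl]
  push_cast
  ring

/-- The symbol `2πξ_j (1 + |2πξ|²) ^ (-1/2)`. -/
def rieszSymbol (j : Fin 3) (ξ : E3) : ℂ :=
  (2 * Real.pi) * ((inner ℝ ξ (basisVec j) : ℝ) : ℂ) * besselSymbol (-1) ξ

theorem hasTemperateGrowth_rieszSymbol (j : Fin 3) : (rieszSymbol j).HasTemperateGrowth := by
  have := hasTemperateGrowth_besselSymbol (-1)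
  unfold rieszSymbol
  fun_prop

/-- The term with ⟨2πξ⟩⁻³ is regrouped as a product of two Riesz symbols and one Bessel symbol, so
that the derivative is visibly in the algebra of symbols. -/
theorem fderiv_rieszSymbol (j i : Fin 3) (ξ : E3) : fderiv ℝ (rieszSymbol j) ξ (basisVec i) =
    (2 * Real.pi) * (if i = j then 1 else 0) * besselSymbol (-1) ξ +
      (-(2 * Real.pi)) * (rieszSymbol i ξ * (rieszSymbol j ξ * besselSymbol (-1) ξ)) := by
  have h₁ : HasFDerivAt (fun y : E3 => (2 * Real.pi : ℂ) * ((inner ℝ y (basisVec j) : ℝ) : ℂ))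
      ((2 * Real.pi : ℂ) • (Complex.ofRealCLM ∘L (innerSL ℝ (basisVec j) : E3 →L[ℝ] ℝ))) ξ := by
    have h := (Complex.ofRealCLM ∘L (innerSL ℝ (basisVec j) : E3 →L[ℝ] ℝ)).hasFDerivAt (x := ξ)
    have h2 := h.const_mul (2 * Real.pi : ℂ)
    refine h2.congr_of_eventuallyEq (Eventually.of_forall fun y => ?_)
    simp [real_inner_comm]
  have h₂ := ((hasTemperateGrowth_besselSymbol (-1)).1.differentiable (by simp) ξ).hasFDerivAt
  have h₃ : HasFDerivAt (rieszSymbol j) _ ξ := h₁.mul h₂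
  have hb : besselSymbol (-1 - 2) ξ =
      besselSymbol (-1) ξ * besselSymbol (-1) ξ * besselSymbol (-1) ξ := by
    have h := congrFun (besselSymbol_mul (-1) (-1)) ξ
    have h' := congrFun (besselSymbol_mul (-1 + -1) (-1)) ξ
    simp only [Pi.mul_apply] at h h'
    rw [h, h']
    norm_num
  have hij : (inner ℝ (basisVec j) (basisVec i) : ℝ) = if i = j then 1 else 0 := by
    rw [inner_basisVec]
    simp [basisVec, eq_comm]
  rw [h₃.fderiv]
  simp only [_root_.add_apply, _root_.smul_apply, fderiv_besselSymbol,
    ContinuousLinearMap.comp_apply, innerSL_apply_apply, hij, hb, rieszSymbol, smul_eq_mul,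
    Complex.ofRealCLM_apply]
  split_ifs <;> push_cast <;> ring

/-- The function `x_j ⟨x⟩⁻¹`. -/
def coordRatio (j : Fin 3) (x : E3) : ℂ := ((inner ℝ x (basisVec j) : ℝ) : ℂ) * weight (-1) x

theorem hasTemperateGrowth_coordRatio (j : Fin 3) : (coordRatio j).HasTemperateGrowth := by
  have := hasTemperateGrowth_weight (-1)
  unfold coordRatio
  fun_prop

theorem norm_coordRatio_le (j : Fin 3) (x : E3) : ‖coordRatio j x‖ ≤ 1 := by
  rw [coordRatio, norm_mul, norm_weight, Complex.norm_real, inner_basisVec, neg_div,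
    Real.rpow_neg (by positivity), ← Real.sqrt_eq_rpow, mul_inv_le_iff₀ (by positivity), one_mul]
  have h : ‖x j‖ ≤ ‖x‖ := PiLp.norm_apply_le x j
  refine Real.le_sqrt_of_sq_le ?_
  have : ‖x j‖ ^ 2 ≤ ‖x‖ ^ 2 := by gcongr
  linarith

theorem norm_rieszSymbol_le (j : Fin 3) (ξ : E3) : ‖rieszSymbol j ξ‖ ≤ 1 := by
  have h : rieszSymbol j ξ = coordRatio j ((2 * Real.pi) • ξ) := by
    simp [rieszSymbol, coordRatio, besselSymbol, inner_smul_left]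
  rw [h]
  exact norm_coordRatio_le j _

/-- The algebra of symbols generated by `(1 + |2πξ|²) ^ (-1/2)` and `2πξ_j (1 + |2πξ|²) ^ (-1/2)`.
It consists of bounded functions and is closed under differentiation. -/
inductive IsSymbol : (E3 → ℂ) → Prop
  | const (z : ℂ) : IsSymbol fun _ => z
  | bessel : IsSymbol (besselSymbol (-1))
  | riesz (j : Fin 3) : IsSymbol (rieszSymbol j)
  | add {m n : E3 → ℂ} : IsSymbol m → IsSymbol n → IsSymbol (m + n)
  | mul {m n : E3 → ℂ} : IsSymbol m → IsSymbol n → IsSymbol (m * n)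

namespace IsSymbol

theorem hasTemperateGrowth {m : E3 → ℂ} (hm : IsSymbol m) : m.HasTemperateGrowth := by
  induction hm with
  | const z => exact .const z
  | bessel => exact hasTemperateGrowth_besselSymbol _
  | riesz j => exact hasTemperateGrowth_rieszSymbol j
  | add _ _ h₁ h₂ => exact h₁.add h₂
  | mul _ _ h₁ h₂ => exact h₁.mul h₂

theorem bounded {m : E3 → ℂ} (hm : IsSymbol m) : ∃ C, ∀ ξ, ‖m ξ‖ ≤ C := by
  induction hm with
  | const z => exact ⟨‖z‖, fun _ => le_rfl⟩
  | bessel => exact ⟨1, besselSymbol_hasBound (by norm_num)⟩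
  | riesz j => exact ⟨1, norm_rieszSymbol_le j⟩
  | add _ _ h₁ h₂ =>
    obtain ⟨C, hC⟩ := h₁
    obtain ⟨D, hD⟩ := h₂
    exact ⟨C + D, fun ξ => (norm_add_le _ _).trans (add_le_add (hC ξ) (hD ξ))⟩
  | mul _ _ h₁ h₂ =>
    obtain ⟨C, hC⟩ := h₁
    obtain ⟨D, hD⟩ := h₂
    refine ⟨C * D, fun ξ => ?_⟩
    rw [Pi.mul_apply, norm_mul]
    exact mul_le_mul (hC ξ) (hD ξ) (norm_nonneg _) ((norm_nonneg _).trans (hC ξ))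

theorem memLp {m : E3 → ℂ} (hm : IsSymbol m) : MemLp m ⊤ (volume : Measure E3) := by
  obtain ⟨C, hC⟩ := hm.bounded
  exact memLp_top_of_bound hm.hasTemperateGrowth.1.continuous.aestronglyMeasurable C hC

theorem differentiableAt {m : E3 → ℂ} (hm : IsSymbol m) (ξ : E3) : DifferentiableAt ℝ m ξ :=
  hm.hasTemperateGrowth.1.differentiable (by simp) ξ

/-- Only the generators need a computation; sums and products follow from linearity and the Leibniz
rule. -/
theorem deriv {m : E3 → ℂ} (hm : IsSymbol m) (j : Fin 3) :
    ∃ n, IsSymbol n ∧ ∀ ξ, fderiv ℝ m ξ (basisVec j) = n ξ := by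
  induction hm with
  | const z => exact ⟨fun _ => 0, .const 0, fun ξ => by simp⟩
  | bessel =>
    refine ⟨_, (IsSymbol.const (-(2 * Real.pi))).mul
      ((IsSymbol.riesz j).mul (.mul .bessel .bessel)), fun ξ => ?_⟩
    have h := congrFun (besselSymbol_mul (-1) (-1)) ξ
    have h' := congrFun (besselSymbol_mul (-1 + -1) (-1)) ξ
    simp only [Pi.mul_apply] at h h'
    simp only [Pi.mul_apply, rieszSymbol, fderiv_besselSymbol]
    rw [show (-1 - 2 : ℝ) = -1 + -1 + -1 by norm_num, ← h', ← h]
    push_cast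
    ring
  | riesz i =>
    refine ⟨_, ((IsSymbol.const (2 * Real.pi * (if j = i then 1 else 0))).mul .bessel).add
      ((IsSymbol.const (-(2 * Real.pi))).mul
      ((IsSymbol.riesz j).mul ((IsSymbol.riesz i).mul .bessel))), fun ξ => ?_⟩
    rw [fderiv_rieszSymbol]
    rfl
  | add hm hn h₁ h₂ =>
    obtain ⟨m', hm', h₁⟩ := h₁
    obtain ⟨n', hn', h₂⟩ := h₂
    refine ⟨_, hm'.add hn', fun ξ => ?_⟩
    rw [fderiv_add (hm.differentiableAt ξ) (hn.differentiableAt ξ), _root_.add_apply,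
      h₁, h₂]
    rfl
  | @mul m n hm hn h₁ h₂ =>
    obtain ⟨m', hm', h₁⟩ := h₁
    obtain ⟨n', hn', h₂⟩ := h₂
    refine ⟨_, (hm.mul hn').add (hn.mul hm'), fun ξ => ?_⟩
    rw [fderiv_mul (hm.differentiableAt ξ) (hn.differentiableAt ξ), _root_.add_apply,
      _root_.smul_apply, _root_.smul_apply, h₁, h₂]
    rfl

end IsSymbol

/-- Leibniz rule for the product of a tempered distribution with a function. -/
theorem lineDeriv_smulLeftCLM {a b : E3 → ℂ} (ha : a.HasTemperateGrowth)
    (hb : b.HasTemperateGrowth) {v : E3} (h : ∀ x, fderiv ℝ a x v = b x) (u : Dist3) :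
    ∂_{v} (smulLeftCLM ℂ a u) = smulLeftCLM ℂ b u + smulLeftCLM ℂ a (∂_{v} u) := by
  ext φ
  have key : ∂_{v} (SchwartzMap.smulLeftCLM ℂ a φ) =
      SchwartzMap.smulLeftCLM ℂ b φ + SchwartzMap.smulLeftCLM ℂ a (∂_{v} φ) := by
    ext x
    have hd : DifferentiableAt ℝ a x := ha.1.differentiable (by simp) x
    have hfun : (SchwartzMap.smulLeftCLM ℂ a φ : E3 → ℂ) = fun y => a y * φ y := by
      funext y
      rw [SchwartzMap.smulLeftCLM_apply_apply ha, smul_eq_mul]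
    rw [SchwartzMap.lineDerivOp_apply_eq_fderiv, hfun, fderiv_fun_mul hd φ.differentiableAt]
    simp only [_root_.add_apply, _root_.smul_apply, h,
      SchwartzMap.smulLeftCLM_apply_apply ha,
      SchwartzMap.smulLeftCLM_apply_apply hb, SchwartzMap.lineDerivOp_apply_eq_fderiv, smul_eq_mul]
    ring
  rw [lineDerivOp_apply_apply, smulLeftCLM_apply_apply, map_neg, map_neg,
    _root_.add_apply, smulLeftCLM_apply_apply, smulLeftCLM_apply_apply,
    lineDerivOp_apply_apply, map_neg]
  have : SchwartzMap.smulLeftCLM ℂ a (∂_{v} φ) =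
    ∂_{v} (SchwartzMap.smulLeftCLM ℂ a φ) - SchwartzMap.smulLeftCLM ℂ b φ := by
    rw [key]; abel
  rw [this, map_sub]
  ring

/-- Multiplication by the `j`-th coordinate. -/
def coordMul (j : Fin 3) : Dist3 →L[ℂ] Dist3 :=
  smulLeftCLM ℂ fun x : E3 => ((inner ℝ x (basisVec j) : ℝ) : ℂ)

open FourierTransform in
-- On the Fourier side multiplication by x_j is a multiple of ∂_j, so the commutator of x_j with
-- m(D) is the single Leibniz term in which the derivative falls on m.
theorem coordMul_fourierMultiplier {m n : E3 → ℂ} (hm : m.HasTemperateGrowth)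
    (hn : n.HasTemperateGrowth) {j : Fin 3} (h : ∀ ξ, fderiv ℝ m ξ (basisVec j) = n ξ) (u : Dist3) :
    coordMul j (fourierMultiplierCLM ℂ m u) = fourierMultiplierCLM ℂ m (coordMul j u) -
      (2 * Real.pi * Complex.I)⁻¹ • fourierMultiplierCLM ℂ n u := by
  have hc : (2 * Real.pi * Complex.I : ℂ) ≠ 0 := by simp [Real.pi_ne_zero]
  have h₁ := fourierInv_lineDerivOp_eq (smulLeftCLM ℂ m (𝓕 u)) (basisVec j)
  rw [lineDeriv_smulLeftCLM hm hn h, lineDerivOp_fourier_eq] at h₁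
  rw [FourierTransform.fourier_smul, map_smul, fourierInv_add, fourierInv_smul] at h₁
  simp only [fourierMultiplierCLM_apply, coordMul]
  have h₂ := congrArg (fun z => (2 * Real.pi * Complex.I : ℂ)⁻¹ • z) h₁
  simp only [smul_add, neg_smul, smul_neg, smul_smul, inv_mul_cancel₀ hc, one_smul] at h₂
  rw [← neg_eq_iff_eq_neg] at h₂
  rw [← h₂]
  abel

/-! ### Boundedness of Fourier multipliers on weighted `L²` spaces -/

theorem hasTemperateGrowth_coord (j : Fin 3) :
    Function.HasTemperateGrowth fun x : E3 => ((inner ℝ x (basisVec j) : ℝ) : ℂ) := by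
  fun_prop

theorem coordMul_eq (j : Fin 3) (u : Dist3) :
    coordMul j u = smulLeftCLM ℂ (coordRatio j) (wmul 1 u) := by
  rw [wmul, smulLeftCLM_smulLeftCLM_apply (hasTemperateGrowth_weight _)
    (hasTemperateGrowth_coordRatio j), coordMul]
  congr 2
  funext x
  rw [Pi.mul_apply, coordRatio, mul_left_comm, weight_mul_apply]
  simp [weight]

theorem coordMul_mem {s : ℝ} {u : Dist3} (hu : u ∈ weightedSobolev 0 (s + 1)) (j : Fin 3) :
    coordMul j u ∈ weightedSobolev 0 s := by
  rw [coordMul_eq]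
  exact smulLeft_mem (hasTemperateGrowth_coordRatio j) 1 (norm_coordRatio_le j) (wmul_mem_iff.2 hu)

theorem sum_coord_sq (x : E3) : ∑ j, ((inner ℝ x (basisVec j) : ℝ) : ℂ) ^ 2 = (‖x‖ ^ 2 : ℝ) := by
  simp_rw [inner_basisVec, EuclideanSpace.real_norm_sq_eq]
  push_cast
  rfl

/-- From ⟨x⟩² = 1 + Σ x_j². This trades powers of ⟨x⟩ for coordinates, whose commutators with
multipliers are explicit. -/
theorem wmul_add_two (s : ℝ) (u : Dist3) :
    wmul (s + 2) u = wmul s u + ∑ j, coordMul j (coordMul j (wmul s u)) := by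
  have h : weight (s + 2) = weight s + fun x => ∑ j : Fin 3,
      weight s x * ((inner ℝ x (basisVec j) : ℝ) : ℂ) ^ 2 := by
    funext x
    rw [Pi.add_apply, ← Finset.mul_sum, sum_coord_sq, ← weight_mul_apply]
    simp only [weight]
    rw [div_self two_ne_zero, Real.rpow_one]
    push_cast
    ring
  have hg : ∀ j : Fin 3, Function.HasTemperateGrowth fun x : E3 =>
      weight s x * ((inner ℝ x (basisVec j) : ℝ) : ℂ) ^ 2 := fun j => by
    have := hasTemperateGrowth_weight s
    fun_prop
  rw [wmul, h, smulLeftCLM_add (hasTemperateGrowth_weight s) (.sum fun j _ => hg j),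
    smulLeftCLM_sum (fun j _ => hg j), _root_.add_apply, _root_.sum_apply]
  congr 1
  refine Finset.sum_congr rfl fun j _ => ?_
  rw [coordMul, wmul, smulLeftCLM_smulLeftCLM_apply (hasTemperateGrowth_weight _)
    (hasTemperateGrowth_coord j), smulLeftCLM_smulLeftCLM_apply
    ((hasTemperateGrowth_weight _).mul (hasTemperateGrowth_coord j)) (hasTemperateGrowth_coord j)]
  congr 2
  funext x
  simp only [Pi.mul_apply]
  ring

/-- From ⟨x⟩ = ⟨x⟩⁻¹ + Σ (x_j⟨x⟩⁻¹) x_j, where all coefficients are bounded. -/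
theorem mem_of_coordMul_mem {s : ℝ} {u : Dist3} (hu : u ∈ weightedSobolev 0 s)
    (h : ∀ j, coordMul j u ∈ weightedSobolev 0 s) : u ∈ weightedSobolev 0 (s + 1) := by
  rw [← wmul_mem_iff, show (1 : ℝ) = -1 + 2 by norm_num, wmul_add_two]
  refine add_mem ?_ (sum_mem fun j _ => ?_)
  · exact wmul_mem_iff.2 (weightedSobolev_zero_mono (by linarith) hu)
  · have : coordMul j (coordMul j (wmul (-1) u)) = smulLeftCLM ℂ (coordRatio j) (coordMul j u) := by
      rw [coordMul_eq j (coordMul j (wmul (-1) u)), coordMul, wmul, wmul,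
        smulLeftCLM_smulLeftCLM_apply (hasTemperateGrowth_weight _) (hasTemperateGrowth_coord j),
        smulLeftCLM_smulLeftCLM_apply ((hasTemperateGrowth_weight _).mul
          (hasTemperateGrowth_coord j)) (hasTemperateGrowth_weight _),
        mul_right_comm, weight_mul, neg_add_cancel, weight_zero]
      congr 2
      rw [show (fun _ => (1 : ℂ)) = (1 : E3 → ℂ) from rfl, one_mul]
    rw [this]
    exact smulLeft_mem (hasTemperateGrowth_coordRatio j) 1 (norm_coordRatio_le j) (h j)

/-- All symbols of the algebra preserve the space `L^{2,s}`. -/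
def SymbolsPreserve (s : ℝ) : Prop :=
  ∀ m, IsSymbol m → ∀ u ∈ weightedSobolev 0 s, fourierMultiplierCLM ℂ m u ∈ weightedSobolev 0 s

theorem symbolsPreserve_zero : SymbolsPreserve 0 := by
  intro m hm u hu
  obtain ⟨f, hf⟩ := mem_weightedSobolev_zero.1 hu
  rw [wmul_zero] at hf
  refine mem_weightedSobolev_zero.2 ⟨fourierMulL2 hm.memLp f, ?_⟩
  rw [l2ToDist_fourierMulL2 hm.memLp hm.hasTemperateGrowth, hf, wmul_zero]

/-- It suffices to control x_j m(D)u, which is m(D)(x_j u) plus a multiple of (∂_j m)(D)u; both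
inputs have weight s, and ∂_j m is again in the algebra. -/
theorem SymbolsPreserve.succ {s : ℝ} (h : SymbolsPreserve s) : SymbolsPreserve (s + 1) := by
  intro m hm u hu
  have hu' : u ∈ weightedSobolev 0 s := weightedSobolev_zero_mono (by linarith) hu
  refine mem_of_coordMul_mem (h m hm u hu') fun j => ?_
  obtain ⟨n, hn, hmn⟩ := hm.deriv j
  rw [coordMul_fourierMultiplier hm.hasTemperateGrowth hn.hasTemperateGrowth hmn]
  exact sub_mem (h m hm _ (coordMul_mem hu j)) (Submodule.smul_mem _ _ (h n hn u hu'))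

/-- No duality is needed: u = ⟨x⟩⁻²u + Σ x_j(x_j⟨x⟩⁻²u), and the outer x_j is moved to the left of
m(D). All multipliers then act at weight s + 1, and the remaining x_j costs one power. -/
theorem SymbolsPreserve.pred {s : ℝ} (h : SymbolsPreserve (s + 1)) : SymbolsPreserve s := by
  intro m hm u hu
  have hdec : u = wmul (-2) u + ∑ j, coordMul j (coordMul j (wmul (-2) u)) := by
    rw [← wmul_add_two, neg_add_cancel, wmul_zero]
  have h₂ : wmul (-2) u ∈ weightedSobolev 0 (s + 1 + 1) :=
    wmul_mem_iff.2 (by convert! hu using 2; ring)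
  have h₁ : wmul (-2) u ∈ weightedSobolev 0 (s + 1) := weightedSobolev_zero_mono (by linarith) h₂
  rw [hdec, map_add, map_sum]
  refine add_mem (weightedSobolev_zero_mono (by linarith) (h m hm _ h₁)) (sum_mem fun j _ => ?_)
  obtain ⟨n, hn, hmn⟩ := hm.deriv j
  have hv := coordMul_mem h₂ j
  have key := coordMul_fourierMultiplier hm.hasTemperateGrowth hn.hasTemperateGrowth hmn
    (coordMul j (wmul (-2) u))
  rw [eq_sub_iff_add_eq] at key
  rw [← key]
  exact add_mem (coordMul_mem (h m hm _ hv) j) (Submodule.smul_mem _ _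
    (weightedSobolev_zero_mono (by linarith) (h n hn _ hv)))

theorem mem_weightedSobolev_zero_of_lintegral {s : ℝ} {f : L2}
    (h : ∫⁻ x, ‖weight s x * f x‖ₑ ^ 2 < ⊤) : l2ToDist f ∈ weightedSobolev 0 s := by
  have hmeas : AEStronglyMeasurable (fun x => weight s x * f x) (volume : Measure E3) :=
    (continuous_weight s).aestronglyMeasurable.mul (Lp.aestronglyMeasurable f)
  have hL : MemLp (fun x => weight s x * f x) 2 (volume : Measure E3) := by
    refine ⟨hmeas, ?_⟩
    rw [eLpNorm_lt_top_iff_lintegral_rpow_enorm_lt_top (by norm_num) (by norm_num)]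
    simpa using h
  refine mem_weightedSobolev_zero.2 ⟨hL.toLp, ?_⟩
  have h₁ := represents_wmul (r := 0) hL.toLp
  rw [wmul_zero] at h₁
  refine h₁.eq ((represents_wmul f).congr ?_)
  filter_upwards [hL.coeFn_toLp] with x hx
  rw [hx, weight_zero, one_mul]

theorem weight_eq_rpow (s : ℝ) (x : E3) : ‖weight s x‖ = ‖weight 1 x‖ ^ s := by
  rw [norm_weight, norm_weight, ← Real.rpow_mul (by positivity)]
  congr 1
  ring

/-- Interpolation between the weights 0 (Plancherel) and 1 (one commutator). -/
theorem symbolsPreserve_of_mem_Icc {s : ℝ} (h₀ : 0 ≤ s) (h₁ : s ≤ 1) : SymbolsPreserve s := by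
  rcases h₀.eq_or_lt with rfl | h₀
  · exact symbolsPreserve_zero
  rcases h₁.eq_or_lt with rfl | h₁
  · simpa using symbolsPreserve_zero.succ
  intro m hm u hu
  have h1 : SymbolsPreserve 1 := by simpa using symbolsPreserve_zero.succ
  set S : WSob 0 1 →L[ℂ] WSob 0 1 := restrictWSob (fourierMultiplierCLM ℂ m) (h1 m hm) with hS
  set T : L2 →L[ℂ] L2 := fourierMulL2 hm.memLp with hT
  have hTd : ∀ f, l2ToDist (T f) = fourierMultiplierCLM ℂ m (l2ToDist f) :=
    l2ToDist_fourierMulL2 hm.memLp hm.hasTemperateGrowth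
  have hw : Continuous fun x : E3 => ‖weight 1 x‖ := (continuous_weight 1).norm
  have hpos : ∀ x : E3, 0 < ‖weight 1 x‖ := fun x => norm_pos_iff.2 (weight_ne_zero 1 x)
  have hnorm : ∀ x : E3, ((‖weight 1 x‖ : ℝ) : ℂ) = weight 1 x := fun x => by
    rw [norm_weight, weight]
  -- The closed graph theorem has turned preservation of L^{2,1} into a bounded operator `S`; its
  -- norm gives the quantitative bound with weight ⟨x⟩² that the interpolation requires.
  have key : ∀ f g : L2, (∀ᵐ x, g x = ((‖weight 1 x‖ : ℝ) : ℂ) * f x) →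
      ∫⁻ x, ENNReal.ofReal ‖weight 1 x‖ ^ 2 * ‖T f x‖ₑ ^ 2 ≤
        ‖S‖ₑ ^ 2 * ∫⁻ x, ‖g x‖ₑ ^ 2 := by
    intro f g hfg
    set v : WSob 0 1 := (wsobEquiv 0 1).symm g with hv
    have hvd : toDist v = l2ToDist f := by
      have h₁ := represents_wmul (r := 0) f
      rw [wmul_zero] at h₁
      rw [hv, toDist_wsobEquiv_symm, neg_zero, bessel_zero]
      refine (represents_wmul g).eq (h₁.congr ?_)
      filter_upwards [hfg] with x hx
      rw [hx, hnorm, ← mul_assoc, weight_mul_apply, neg_add_cancel]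
    have hSv : ∀ᵐ x, T f x = weight (-1) x * wsobEquiv 0 1 (S v) x := by
      have h₁ := represents_wmul (r := 0) (T f)
      rw [wmul_zero, hTd, ← hvd] at h₁
      filter_upwards [h₁.unique (represents_wfun (S v))] with x hx
      rwa [weight_zero, one_mul] at hx
    have : ∫⁻ x, ENNReal.ofReal ‖weight 1 x‖ ^ 2 * ‖T f x‖ₑ ^ 2 =
        ∫⁻ x, ‖wsobEquiv 0 1 (S v) x‖ₑ ^ 2 := by
      refine lintegral_congr_ae ?_
      filter_upwards [hSv] with x hx
      rw [hx, ofReal_norm, ← mul_pow, ← enorm_mul, ← mul_assoc, weight_mul_apply, add_neg_cancel,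
        weight_zero, one_mul]
    rw [this, lintegral_sq_enorm, lintegral_sq_enorm, ← mul_pow]
    gcongr
    have h₂ : ‖wsobEquiv 0 1 (S v)‖ₑ = ‖S v‖ₑ := by
      rw [← ofReal_norm, ← ofReal_norm, LinearIsometryEquiv.norm_map]
    have h₃ : ‖v‖ₑ = ‖g‖ₑ := by
      rw [← ofReal_norm, ← ofReal_norm, hv, LinearIsometryEquiv.norm_map]
    rw [h₂, ← h₃]
    exact S.le_opENorm v
  obtain ⟨f, hf⟩ := mem_weightedSobolev_zero.1 (weightedSobolev_zero_mono h₀.le hu)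
  obtain ⟨g, hg⟩ := mem_weightedSobolev_zero.1 hu
  rw [wmul_zero] at hf
  have hfg : ∀ᵐ x, weight s x * f x = g x := by
    have h₁ := represents_wmul (r := 0) g
    rw [wmul_zero, hg, ← hf] at h₁
    filter_upwards [(represents_wmul f).unique h₁] with x hx
    rwa [weight_zero, one_mul] at hx
  have hsq : ∀ (x : E3) (z : ℂ), ENNReal.ofReal (‖weight 1 x‖ ^ (2 * s)) * ‖z‖ₑ ^ 2 =
      ‖weight s x * z‖ₑ ^ 2 := by
    intro x z
    rw [enorm_mul, mul_pow, ← ofReal_norm (weight s x), weight_eq_rpow s, ← ENNReal.ofReal_pow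
      (by positivity), ← Real.rpow_mul_natCast (norm_nonneg _)]
    congr 3
    push_cast
    ring
  have hint := lintegral_interpolate hw hpos key (ENNReal.pow_ne_top enorm_ne_top) h₀ h₁ f
  simp_rw [hsq] at hint
  rw [← hf, ← hTd]
  refine mem_weightedSobolev_zero_of_lintegral (hint.trans_lt ?_)
  refine ENNReal.mul_lt_top (ENNReal.mul_lt_top (by norm_num) ?_) ?_
  · exact ENNReal.add_lt_top.2 ⟨ENNReal.pow_lt_top enorm_lt_top, ENNReal.pow_lt_top enorm_lt_top⟩
  · rw [lintegral_congr_ae (g := fun x => ‖g x‖ₑ ^ 2) (by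
      filter_upwards [hfg] with x hx
      rw [hx]), lintegral_sq_enorm]
    exact ENNReal.pow_lt_top enorm_lt_top

/-- The Fourier multipliers with symbols in the algebra are bounded on all weighted `L²` spaces. -/
theorem symbolsPreserve (s : ℝ) : SymbolsPreserve s := by
  -- From the fractional part of s, which lies in [0, 1], every weight is reached by integer steps
  -- up or down.
  have h : ∀ n : ℤ, SymbolsPreserve (Int.fract s + n) := by
    intro n
    induction n using Int.induction_on with
    | zero => simpa using symbolsPreserve_of_mem_Icc (Int.fract_nonneg s) (Int.fract_lt_one s).le
    | succ i hi =>
      have := hi.succ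
      push_cast at this ⊢
      rwa [add_assoc] at this
    | pred i hi =>
      refine SymbolsPreserve.pred ?_
      push_cast at hi ⊢
      rw [show Int.fract s + (-(i : ℝ) - 1) + 1 = Int.fract s + -(i : ℝ) by ring]
      exact hi
  simpa [Int.fract_add_floor] using h ⌊s⌋

/-! ### Compactness of `a(x) m(D)` for functions `a` and `m` vanishing at infinity -/

section Compactness

/-- The operator `f ↦ (x ↦ k(x) f)` for a square integrable family of functionals `k`. -/
def dualKernelOp : Lp (L2 →L[ℂ] ℂ) 2 (volume : Measure E3) →L[ℂ] L2 →L[ℂ] L2 :=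
  (ContinuousLinearMap.compLpL₂ 2 (volume : Measure E3)
    (ContinuousLinearMap.id ℂ (L2 →L[ℂ] ℂ)).flip).flip

theorem coeFn_dualKernelOp (k : Lp (L2 →L[ℂ] ℂ) 2 (volume : Measure E3)) (f : L2) :
    dualKernelOp k f =ᵐ[volume] fun x => k x f :=
  ((ContinuousLinearMap.id ℂ (L2 →L[ℂ] ℂ)).flip f).coeFn_compLpL k

/-- A Hilbert–Schmidt argument: a constant functional on a set of finite measure gives an operator
of rank at most one, such families span a dense subspace, and compact operators are closed in norm.
-/
theorem isCompactOperator_dualKernelOp (k : Lp (L2 →L[ℂ] ℂ) 2 (volume : Measure E3)) :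
    IsCompactOperator (dualKernelOp k) := by
  refine Lp.induction (p := 2) (by norm_num) (motive := fun k => IsCompactOperator (dualKernelOp k))
    ?_ ?_ ?_ k
  · intro c S hs hμs
    have : dualKernelOp (Lp.simpleFunc.indicatorConst 2 hs hμs.ne c :
        Lp (L2 →L[ℂ] ℂ) 2 (volume : Measure E3)) =
        (ContinuousLinearMap.toSpanSingleton ℂ (indicatorConstLp 2 hs hμs.ne (1 : ℂ))) ∘L c := by
      ext1 f
      refine Lp.ext ?_
      rw [Lp.simpleFunc.coe_indicatorConst, ContinuousLinearMap.comp_apply,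
        ContinuousLinearMap.toSpanSingleton_apply]
      filter_upwards [coeFn_dualKernelOp (indicatorConstLp 2 hs hμs.ne c) f,
        indicatorConstLp_coeFn (p := 2) (hs := hs) (hμs := hμs.ne) (c := c),
        indicatorConstLp_coeFn (p := 2) (hs := hs) (hμs := hμs.ne) (c := (1 : ℂ)),
        Lp.coeFn_smul (c f) (indicatorConstLp 2 hs hμs.ne (1 : ℂ))] with x h₁ h₂ h₃ h₄
      rw [h₁, h₄, Pi.smul_apply, h₂, h₃]
      by_cases hx : x ∈ S <;> simp [hx]
    rw [this]
    have hc : IsCompactOperator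
        (ContinuousLinearMap.toSpanSingleton ℂ (indicatorConstLp 2 hs hμs.ne (1 : ℂ)) : ℂ →L[ℂ] L2) :=
      (isCompactOperator_id (E := ℂ)).clm_comp _
    exact hc.comp_clm c
  · intro f g hf hg _ h₁ h₂
    rw [map_add]
    exact h₁.add h₂
  · exact isClosed_setOfPred_isCompactOperator.preimage dualKernelOp.continuous

open FourierTransform in
-- The transform on L² is not given pointwise. The integral formula is checked by pairing with
-- Schwartz functions, where the transform can be moved to the test function by Fubini.
theorem coeFn_fourierInv_l2 (h : L2) (hi : Integrable h (volume : Measure E3)) :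
    (𝓕⁻ h : L2) =ᵐ[volume] 𝓕⁻ (h : E3 → ℂ) := by
  have h₁ : Represents (𝓕⁻ h : L2) (l2ToDist (𝓕⁻ h)) := by
    have := represents_wmul (r := 0) (𝓕⁻ h)
    simpa only [weight_zero, one_mul, wmul_zero] using this
  have hL : Continuous fun p : E3 × E3 => (-innerₗ E3) p.1 p.2 :=
    (continuous_inner (𝕜 := ℝ) (E := E3)).neg
  have hcont : Continuous (𝓕⁻ (h : E3 → ℂ)) :=
    VectorFourier.fourierIntegral_continuous Real.continuous_fourierChar hL hi
  have hbound : ∀ x, ‖𝓕⁻ (h : E3 → ℂ) x‖ ≤ ∫ ξ, ‖h ξ‖ := fun x =>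
    VectorFourier.norm_fourierIntegral_le_integral_norm _ _ _ _ _
  have h₂ : Represents (𝓕⁻ (h : E3 → ℂ)) (l2ToDist (𝓕⁻ h)) := by
    intro φ
    refine ⟨φ.integrable.mul_bdd (c := ∫ ξ, ‖h ξ‖) hcont.aestronglyMeasurable
      (Eventually.of_forall hbound), ?_⟩
    have e₁ : 𝓕⁻ (l2ToDist h) = l2ToDist (𝓕⁻ h) := Lp.fourierInv_toTemperedDistribution_eq h
    rw [← e₁, fourierInv_apply, l2ToDist_apply]
    have := VectorFourier.integral_fourierIntegral_smul_eq_flip (μ := volume) (ν := volume)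
      (L := -innerₗ E3) (f := φ) (g := h) Real.continuous_fourierChar hL
      φ.integrable hi
    have hflip : (-innerₗ E3).flip = -innerₗ E3 := by
      ext x y
      simp [real_inner_comm]
    rw [hflip] at this
    rw [SchwartzMap.fourierInv_coe]
    exact this
  exact h₁.unique h₂

/-- The plane wave functional `g ↦ ∫ m(ξ) exp(2πi x·ξ) g(ξ) dξ`. -/
theorem exists_planeWave {m : E3 → ℂ} (hm : Continuous m) (R : ℝ) :
    ∃ k : E3 → (L2 →L[ℂ] ℂ), Continuous k ∧ (∃ C, ∀ x, ‖k x‖ ≤ C) ∧ ∀ x (g : L2),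
      k x g = ∫ ξ, (Real.fourierChar (inner ℝ ξ x) : ℂ) *
        ((Metric.closedBall (0 : E3) R).indicator m ξ * g ξ) := by
  set S := Metric.closedBall (0 : E3) R with hS
  have hSm : MeasurableSet S := Metric.isClosed_closedBall.measurableSet
  have hb : MemLp (S.indicator m) 2 (volume : Measure E3) := by
    obtain ⟨C, hC⟩ := (isCompact_closedBall (0 : E3) R).exists_bound_of_continuousOn hm.continuousOn
    have h1 : MemLp (S.indicator fun _ => (C : ℂ)) 2 (volume : Measure E3) :=
      memLp_indicator_const 2 hSm _ (Or.inr measure_closedBall_lt_top.ne)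
    refine h1.mono (hm.measurable.indicator hSm).aestronglyMeasurable (Eventually.of_forall ?_)
    intro ξ
    by_cases hξ : ξ ∈ S
    · simp only [Set.indicator_of_mem hξ]
      refine (hC ξ hξ).trans ?_
      rw [Complex.norm_real]
      exact le_abs_self C
    · simp [Set.indicator_of_notMem hξ]
  have hchar : ∀ x : E3, Continuous fun ξ : E3 => (Real.fourierChar (inner ℝ ξ x) : ℂ) := fun x =>
    continuous_subtype_val.comp (Real.continuous_fourierChar.comp (by fun_prop))
  -- The conjugate compensates for the inner product being conjugate linear in its first argument.
  have hv : ∀ x : E3, MemLp (fun ξ => starRingEnd ℂ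
      ((Real.fourierChar (inner ℝ ξ x) : ℂ) * S.indicator m ξ)) 2 (volume : Measure E3) := by
    intro x
    refine hb.mono ?_ (Eventually.of_forall fun ξ => ?_)
    · exact Complex.continuous_conj.comp_aestronglyMeasurable
        ((hchar x).aestronglyMeasurable.mul hb.1)
    · rw [RCLike.norm_conj, norm_mul, Circle.norm_coe, one_mul]
  -- On the ball, |exp(2πi ξ·x) - exp(2πi ξ·y)| ≤ 2πR|x - y|. The resulting norm continuity of the
  -- functionals later provides their strong measurability in x.
  have hLip : LipschitzWith (Real.toNNReal (2 * Real.pi * max R 0 * ‖hb.toLp‖))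
      fun x => (hv x).toLp := by
    refine LipschitzWith.of_dist_le_mul fun x y => ?_
    rw [dist_eq_norm, Real.coe_toNNReal _ (by positivity), mul_right_comm, dist_eq_norm,
      ← MemLp.toLp_sub]
    refine Lp.norm_le_mul_norm_of_ae_le_mul ?_
    filter_upwards [((hv x).sub (hv y)).coeFn_toLp, hb.coeFn_toLp] with ξ h₁ h₂
    rw [h₁, h₂, Pi.sub_apply, ← map_sub, RCLike.norm_conj, ← sub_mul, norm_mul]
    by_cases hξ : ξ ∈ S
    · gcongr
      have e := Real.norm_exp_I_mul_ofReal_sub_one_le (x := 2 * Real.pi * inner ℝ ξ (x - y))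
      have hfac : (Real.fourierChar (inner ℝ ξ x) : ℂ) - (Real.fourierChar (inner ℝ ξ y) : ℂ) =
          (Real.fourierChar (inner ℝ ξ y) : ℂ) *
            (Complex.exp (Complex.I * ((2 * Real.pi * inner ℝ ξ (x - y) : ℝ) : ℂ)) - 1) := by
        rw [mul_sub, mul_one, Real.fourierChar_apply, Real.fourierChar_apply, ← Complex.exp_add,
          inner_sub_right]
        congr 2
        push_cast
        ring
      rw [hfac, norm_mul, Circle.norm_coe, one_mul]
      refine e.trans ?_
      rw [norm_mul, norm_mul, Real.norm_of_nonneg Real.pi_pos.le, Real.norm_ofNat]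
      have h3 : ‖inner ℝ ξ (x - y)‖ ≤ max R 0 * ‖x - y‖ := by
        refine (norm_inner_le_norm _ _).trans ?_
        gcongr
        exact (mem_closedBall_zero_iff.1 hξ).trans (le_max_left _ _)
      calc 2 * Real.pi * ‖inner ℝ ξ (x - y)‖ ≤ 2 * Real.pi * (max R 0 * ‖x - y‖) := by gcongr
        _ = _ := by ring
    · simp [Set.indicator_of_notMem hξ]
  refine ⟨fun x => innerSL ℂ (hv x).toLp, (innerSL ℂ).continuous.comp hLip.continuous,
    ⟨‖hb.toLp‖, fun x => ?_⟩, fun x g => ?_⟩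
  · rw [innerSL_apply_norm]
    refine Lp.norm_le_norm_of_ae_le ?_
    filter_upwards [(hv x).coeFn_toLp, hb.coeFn_toLp] with ξ h₁ h₂
    rw [h₁, h₂, RCLike.norm_conj, norm_mul, Circle.norm_coe, one_mul]
  · rw [innerSL_apply_apply, L2.inner_def]
    refine integral_congr_ae ?_
    filter_upwards [(hv x).coeFn_toLp] with ξ h₁
    rw [h₁, RCLike.inner_apply, Complex.conj_conj]
    ring

/-- With both factors cut off to a ball, the operator is the Fourier transform followed by a
bounded, compactly supported, hence square integrable family of plane wave functionals. -/
theorem isCompactOperator_cutoff {a m : E3 → ℂ} (ha : Continuous a) (hm : Continuous m) (R : ℝ)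
    (ha' : MemLp ((Metric.closedBall (0 : E3) R).indicator a) ⊤ (volume : Measure E3))
    (hm' : MemLp ((Metric.closedBall (0 : E3) R).indicator m) ⊤ (volume : Measure E3)) :
    IsCompactOperator (mulL2 ha' ∘L fourierMulL2 hm') := by
  set S := Metric.closedBall (0 : E3) R with hS
  have hSm : MeasurableSet S := Metric.isClosed_closedBall.measurableSet
  obtain ⟨k, hk, ⟨C, hC⟩, hkg⟩ := exists_planeWave hm R
  obtain ⟨D, hD⟩ := (isCompact_closedBall (0 : E3) R).exists_bound_of_continuousOn ha.continuousOn
  have hK : MemLp (fun x => S.indicator a x • k x) 2 (volume : Measure E3) := by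
    have h1 : MemLp (S.indicator fun _ => (D * C : ℝ)) 2 (volume : Measure E3) :=
      memLp_indicator_const 2 hSm _ (Or.inr measure_closedBall_lt_top.ne)
    refine h1.mono ?_ (Eventually.of_forall fun x => ?_)
    · exact ((ha.measurable.indicator hSm).aestronglyMeasurable).smul hk.aestronglyMeasurable
    · by_cases hx : x ∈ S
      · rw [Set.indicator_of_mem hx, Set.indicator_of_mem hx, norm_smul]
        refine le_trans ?_ (le_abs_self _)
        exact mul_le_mul (hD x hx) (hC x) (norm_nonneg _) ((norm_nonneg _).trans (hD x hx))
      · rw [Set.indicator_of_notMem hx, Set.indicator_of_notMem hx, norm_smul, norm_zero, zero_mul,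
          norm_zero]
  have heq : mulL2 ha' ∘L fourierMulL2 hm' = dualKernelOp hK.toLp ∘L
      ((Lp.fourierTransformₗᵢ E3 ℂ).toContinuousLinearEquiv : L2 →L[ℂ] L2) := by
    ext1 f
    set g : L2 := Lp.fourierTransformₗᵢ E3 ℂ f with hg
    have hgm : fourierMulL2 hm' f = (FourierTransformInv.fourierInv (mulL2 hm' g) : L2) := rfl
    have hint : Integrable (mulL2 hm' g) (volume : Measure E3) := by
      have h1 : MemLp (S.indicator fun _ => (1 : ℂ)) 2 (volume : Measure E3) :=
        memLp_indicator_const 2 hSm _ (Or.inr measure_closedBall_lt_top.ne)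
      have h2 := MemLp.integrable_mul h1 (Lp.memLp (mulL2 hm' g))
      refine h2.congr ?_
      filter_upwards [coeFn_mulL2 hm' g] with ξ h
      rw [Pi.mul_apply, h]
      by_cases hξ : ξ ∈ S <;> simp [hξ]
    refine Lp.ext ?_
    filter_upwards [coeFn_mulL2 ha' (fourierMulL2 hm' f), coeFn_fourierInv_l2 _ hint,
      coeFn_dualKernelOp hK.toLp g, hK.coeFn_toLp] with x h₁ h₂ h₃ h₄
    change (mulL2 ha' (fourierMulL2 hm' f)) x = (dualKernelOp hK.toLp g) x
    rw [h₁, h₃, h₄, hgm, h₂, _root_.smul_apply, hkg, smul_eq_mul, Real.fourierInv_eq]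
    congr 1
    refine integral_congr_ae ?_
    filter_upwards [coeFn_mulL2 hm' g] with ξ h
    rw [h, Circle.smul_def, smul_eq_mul]
  rw [heq]
  exact (isCompactOperator_dualKernelOp _).comp_clm _

theorem memLp_indicator {a : E3 → ℂ} (ha : Continuous a) {C : ℝ} (h : ∀ x, ‖a x‖ ≤ C) {S : Set E3}
    (hS : MeasurableSet S) : MemLp (S.indicator a) ⊤ (volume : Measure E3) :=
  memLp_top_of_bound (ha.measurable.indicator hS).aestronglyMeasurable C fun x =>
    (norm_indicator_le_norm_self a x).trans (h x)

theorem norm_mulL2_sub_le {a b : E3 → ℂ} (ha : MemLp a ⊤ (volume : Measure E3))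
    (hb : MemLp b ⊤ (volume : Measure E3)) {C : ℝ} (hC : 0 ≤ C) (h : ∀ x, ‖a x - b x‖ ≤ C) :
    ‖mulL2 ha - mulL2 hb‖ ≤ C := by
  have : mulL2 ha - mulL2 hb = mulL2 (ha.sub hb) := by
    rw [mulL2, mulL2, mulL2, MemLp.toLp_sub, map_sub]
  rw [this]
  exact norm_mulL2_le _ hC h

theorem norm_fourierMulL2_sub_le {a b : E3 → ℂ} (ha : MemLp a ⊤ (volume : Measure E3))
    (hb : MemLp b ⊤ (volume : Measure E3)) {C : ℝ} (hC : 0 ≤ C) (h : ∀ x, ‖a x - b x‖ ≤ C) :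
    ‖fourierMulL2 ha - fourierMulL2 hb‖ ≤ C := by
  have : fourierMulL2 ha - fourierMulL2 hb = fourierMulL2 (ha.sub hb) := by
    have h2 : mulL2 ha - mulL2 hb = mulL2 (ha.sub hb) := by
      rw [mulL2, mulL2, mulL2, MemLp.toLp_sub, map_sub]
    rw [fourierMulL2, fourierMulL2, fourierMulL2, ← h2]
    ext1 f
    simp
  rw [this]
  exact norm_fourierMulL2_le _ hC h

/-- The operator `a(x) m(D)` is compact if `a` and `m` are continuous and vanish at infinity. -/
theorem isCompactOperator_mul_fourierMul {a m : E3 → ℂ} (ha : Continuous a) (hm : Continuous m)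
    (ha₁ : ∀ x, ‖a x‖ ≤ 1) (hm₁ : ∀ x, ‖m x‖ ≤ 1)
    (ha₀ : ∀ ε > 0, ∃ R, ∀ x, R < ‖x‖ → ‖a x‖ ≤ ε) (hm₀ : ∀ ε > 0, ∃ R, ∀ x, R < ‖x‖ → ‖m x‖ ≤ ε)
    (ha' : MemLp a ⊤ (volume : Measure E3)) (hm' : MemLp m ⊤ (volume : Measure E3)) :
    IsCompactOperator (mulL2 ha' ∘L fourierMulL2 hm') := by
  refine isClosed_setOfPred_isCompactOperator.closure_subset (s := {T : L2 →L[ℂ] L2 |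
    IsCompactOperator T}) (Metric.mem_closure_iff.2 fun ε hε => ?_)
  obtain ⟨R₁, h₁⟩ := ha₀ (ε / 3) (by positivity)
  obtain ⟨R₂, h₂⟩ := hm₀ (ε / 3) (by positivity)
  set R := max R₁ R₂
  have hSm : MeasurableSet (Metric.closedBall (0 : E3) R) :=
    Metric.isClosed_closedBall.measurableSet
  have hA := memLp_indicator ha ha₁ hSm
  have hM := memLp_indicator hm hm₁ hSm
  have key : ∀ b : E3 → ℂ, (∀ x, R < ‖x‖ → ‖b x‖ ≤ ε / 3) → ∀ x,
      ‖b x - (Metric.closedBall (0 : E3) R).indicator b x‖ ≤ ε / 3 := by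
    intro b hb x
    by_cases hx : x ∈ Metric.closedBall (0 : E3) R
    · simp only [Set.indicator_of_mem hx, sub_self, norm_zero]
      positivity
    · rw [Set.indicator_of_notMem hx, sub_zero]
      exact hb x (by simpa using hx)
  have d₁ := norm_mulL2_sub_le ha' hA (by positivity)
    (key a fun x hx => h₁ x ((le_max_left _ _).trans_lt hx))
  have d₂ := norm_fourierMulL2_sub_le hm' hM (by positivity)
    (key m fun x hx => h₂ x ((le_max_right _ _).trans_lt hx))
  have n₁ := norm_mulL2_le ha' zero_le_one ha₁
  have n₂ := norm_fourierMulL2_le hM zero_le_one fun x =>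
    (norm_indicator_le_norm_self m x).trans (hm₁ x)
  refine ⟨_, isCompactOperator_cutoff ha hm R hA hM, ?_⟩
  rw [dist_eq_norm]
  have : mulL2 ha' ∘L fourierMulL2 hm' - mulL2 hA ∘L fourierMulL2 hM =
      mulL2 ha' ∘L (fourierMulL2 hm' - fourierMulL2 hM) +
        (mulL2 ha' - mulL2 hA) ∘L fourierMulL2 hM := by
    ext1 f
    simp
  rw [this]
  calc _ ≤ ‖mulL2 ha'‖ * ‖fourierMulL2 hm' - fourierMulL2 hM‖ +
        ‖mulL2 ha' - mulL2 hA‖ * ‖fourierMulL2 hM‖ :=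
        (norm_add_le _ _).trans (add_le_add (ContinuousLinearMap.opNorm_comp_le _ _)
          (ContinuousLinearMap.opNorm_comp_le _ _))
    _ ≤ 1 * (ε / 3) + ε / 3 * 1 := by gcongr
    _ < ε := by linarith

end Compactness

/-! ### Derivatives and the spaces `H^{1,s}` and `H^{-1,s}` -/

/-- The partial derivative `∂_j` on tempered distributions. -/
def der (j : Fin 3) : Dist3 →L[ℂ] Dist3 :=
  LineDeriv.lineDerivOpCLM ℂ Dist3 (basisVec j)

theorem der_apply (j : Fin 3) (u : Dist3) : der j u = ∂_{basisVec j} u := rfl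

/-- The operator `-i ∂_j (1 - Δ) ^ (-1/2)`. -/
def riesz (j : Fin 3) : Dist3 →L[ℂ] Dist3 := fourierMultiplierCLM ℂ (rieszSymbol j)

theorem hasTemperateGrowth_derSymbol (j : Fin 3) : Function.HasTemperateGrowth
    fun ξ : E3 => (2 * Real.pi * Complex.I) * ((inner ℝ ξ (basisVec j) : ℝ) : ℂ) := by
  fun_prop

theorem fourierMultiplierCLM_comm {m n : E3 → ℂ} (hm : m.HasTemperateGrowth)
    (hn : n.HasTemperateGrowth) (u : Dist3) : fourierMultiplierCLM ℂ m (fourierMultiplierCLM ℂ n u) =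
      fourierMultiplierCLM ℂ n (fourierMultiplierCLM ℂ m u) := by
  rw [fourierMultiplierCLM_fourierMultiplierCLM_apply hm hn,
    fourierMultiplierCLM_fourierMultiplierCLM_apply hn hm, mul_comm]

theorem fourierMultiplierCLM_add_apply {m n : E3 → ℂ} (hm : m.HasTemperateGrowth)
    (hn : n.HasTemperateGrowth) (u : Dist3) : fourierMultiplierCLM ℂ (m + n) u =
      fourierMultiplierCLM ℂ m u + fourierMultiplierCLM ℂ n u := by
  simp [fourierMultiplierCLM_apply, smulLeftCLM_add hm hn, FourierTransform.fourierInv_add]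

theorem fourierMultiplierCLM_smul_apply {m : E3 → ℂ} (hm : m.HasTemperateGrowth) (c : ℂ)
    (u : Dist3) : fourierMultiplierCLM ℂ (c • m) u = c • fourierMultiplierCLM ℂ m u := by
  rw [fourierMultiplierCLM_smul hm, _root_.smul_apply]

theorem der_eq (j : Fin 3) (u : Dist3) : der j u = fourierMultiplierCLM ℂ
    (fun ξ : E3 => (2 * Real.pi * Complex.I) * ((inner ℝ ξ (basisVec j) : ℝ) : ℂ)) u := by
  have h : Function.HasTemperateGrowth fun ξ : E3 => ((inner ℝ ξ (basisVec j) : ℝ) : ℂ) := by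
    fun_prop
  rw [der_apply, lineDeriv_eq_fourierMultiplierCLM, ← _root_.smul_apply,
    ← fourierMultiplierCLM_smul h]
  rfl

theorem bessel_neg_one_der (j : Fin 3) (u : Dist3) :
    bessel (-1) (der j u) = Complex.I • riesz j u := by
  have h := hasTemperateGrowth_rieszSymbol j
  rw [der_eq, bessel, fourierMultiplierCLM_fourierMultiplierCLM_apply
    (hasTemperateGrowth_derSymbol j) (hasTemperateGrowth_besselSymbol _), riesz,
    ← fourierMultiplierCLM_smul_apply h]
  congr 2
  funext ξ
  simp only [Pi.mul_apply, Pi.smul_apply, rieszSymbol, smul_eq_mul]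
  ring

theorem bessel_der (k : ℝ) (j : Fin 3) (u : Dist3) : bessel k (der j u) = der j (bessel k u) := by
  rw [der_eq, der_eq, bessel, fourierMultiplierCLM_comm (hasTemperateGrowth_besselSymbol _)
    (hasTemperateGrowth_derSymbol j)]

theorem laplacian_eq_sum_der (u : Dist3) : Δ u = ∑ j, der j (der j u) := by
  rw [laplacian_eq_sum (EuclideanSpace.basisFun (Fin 3) ℝ)]
  simp only [EuclideanSpace.basisFun_apply]
  rfl

theorem besselSymbol_two (ξ : E3) :
    besselSymbol 2 ξ = 1 + (2 * Real.pi) ^ 2 * ((‖ξ‖ ^ 2 : ℝ) : ℂ) := by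
  simp only [besselSymbol, weight, norm_smul]
  norm_num
  rw [abs_of_pos Real.pi_pos]
  ring

theorem bessel_two (u : Dist3) : bessel 2 u = u - Δ u := by
  have h : besselSymbol 2 = (fun _ => 1) + fun ξ : E3 => (2 * Real.pi : ℂ) ^ 2 * ((‖ξ‖ ^ 2 : ℝ) : ℂ) := by
    funext ξ
    exact besselSymbol_two ξ
  have h2 : Function.HasTemperateGrowth fun ξ : E3 => ((‖ξ‖ ^ 2 : ℝ) : ℂ) := by fun_prop
  rw [bessel, h, fourierMultiplierCLM_add_apply (by fun_prop) (by fun_prop),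
    fourierMultiplierCLM_const, laplacian_eq_fourierMultiplierCLM]
  have h3 := fourierMultiplierCLM_smul_apply h2 ((2 * Real.pi : ℂ) ^ 2) u
  have h4 : (fun ξ : E3 => (2 * Real.pi : ℂ) ^ 2 * ((‖ξ‖ ^ 2 : ℝ) : ℂ)) =
    (2 * Real.pi : ℂ) ^ 2 • fun ξ : E3 => ((‖ξ‖ ^ 2 : ℝ) : ℂ) := rfl
  rw [h4, h3]
  simp only [one_smul, ContinuousLinearMap.id_apply, sub_eq_add_neg, neg_smul, neg_neg]
  congr 1
  rw [← Complex.coe_smul]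
  norm_num

theorem der_wmul (r : ℝ) (j : Fin 3) (u : Dist3) : der j (wmul r u) =
    (r : ℂ) • smulLeftCLM ℂ (coordRatio j) (wmul (r - 1) u) + wmul r (der j u) := by
  have hb : Function.HasTemperateGrowth ((r : ℂ) • (coordRatio j * weight (r - 1))) := 
    (Function.HasTemperateGrowth.const (r : ℂ)).mul
    ((hasTemperateGrowth_coordRatio j).mul (hasTemperateGrowth_weight (r - 1)))
  rw [der_apply, wmul, lineDeriv_smulLeftCLM (hasTemperateGrowth_weight r) hb, wmul,
    smulLeftCLM_smulLeftCLM_apply (hasTemperateGrowth_weight _) (hasTemperateGrowth_coordRatio j),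
    mul_comm (weight (r - 1)),
    smulLeftCLM_smul ((hasTemperateGrowth_coordRatio j).mul (hasTemperateGrowth_weight (r - 1)))]
  · rfl
  · intro x
    rw [fderiv_weight]
    simp only [Pi.smul_apply, Pi.mul_apply, coordRatio, smul_eq_mul]
    rw [mul_assoc (_ : ℂ) (weight (-1) x), weight_mul_apply, mul_assoc]
    congr 3
    ring

theorem bessel_neg_one_mem {s : ℝ} {u : Dist3} (hu : u ∈ weightedSobolev 0 s) :
    bessel (-1) u ∈ weightedSobolev 0 s :=
  symbolsPreserve s _ .bessel u hu

theorem riesz_mem (j : Fin 3) {s : ℝ} {u : Dist3} (hu : u ∈ weightedSobolev 0 s) :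
    riesz j u ∈ weightedSobolev 0 s :=
  symbolsPreserve s _ (.riesz j) u hu

theorem mem_weightedSobolev_one {s : ℝ} {u : Dist3} :
    u ∈ weightedSobolev 1 s ↔ bessel 1 u ∈ weightedSobolev 0 s := by
  rw [bessel_mem_iff, zero_add]

theorem mem_weightedSobolev_neg_one {s : ℝ} {u : Dist3} :
    u ∈ weightedSobolev (-1) s ↔ bessel (-1) u ∈ weightedSobolev 0 s := by
  rw [bessel_mem_iff, zero_add]

/-- One direction uses u = ⟨D⟩⁻¹⟨D⟩u and ∂_j⟨D⟩⁻¹, the other ⟨D⟩u = ⟨D⟩⁻¹u - Σ ∂_j⟨D⟩⁻¹∂_j u. Every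
multiplier involved preserves weighted L². In this form H^{1,s} is easily multiplied by weights. -/
theorem mem_weightedSobolev_one_iff {s : ℝ} {u : Dist3} : u ∈ weightedSobolev 1 s ↔
    u ∈ weightedSobolev 0 s ∧ ∀ j, der j u ∈ weightedSobolev 0 s := by
  rw [mem_weightedSobolev_one]
  constructor
  · intro h
    have hu : u = bessel (-1) (bessel 1 u) := by
      rw [bessel_bessel, neg_add_cancel, bessel_zero]
    refine ⟨hu ▸ bessel_neg_one_mem h, fun j => ?_⟩
    rw [hu, ← bessel_der, bessel_neg_one_der]
    exact Submodule.smul_mem _ _ (riesz_mem j h)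
  · rintro ⟨h₀, h₁⟩
    have hu : bessel 1 u = bessel (-1) u - ∑ j, Complex.I • riesz j (der j u) := by
      have : bessel 1 u = bessel (-1) (bessel 2 u) := by
        rw [bessel_bessel]; norm_num
      rw [this, bessel_two, map_sub, laplacian_eq_sum_der, map_sum]
      simp only [bessel_neg_one_der]
    rw [hu]
    exact sub_mem (bessel_neg_one_mem h₀)
      (sum_mem fun j _ => Submodule.smul_mem _ _ (riesz_mem j (h₁ j)))

theorem weightedSobolev_one_le {s : ℝ} {u : Dist3} (hu : u ∈ weightedSobolev 1 s) :
    u ∈ weightedSobolev 0 s := (mem_weightedSobolev_one_iff.1 hu).1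

theorem der_mem {s : ℝ} {u : Dist3} (hu : u ∈ weightedSobolev 1 s) (j : Fin 3) :
    der j u ∈ weightedSobolev 0 s := (mem_weightedSobolev_one_iff.1 hu).2 j

theorem mem_neg_one_of_mem_zero {s : ℝ} {u : Dist3} (hu : u ∈ weightedSobolev 0 s) :
    u ∈ weightedSobolev (-1) s :=
  mem_weightedSobolev_neg_one.2 (bessel_neg_one_mem hu)

theorem der_mem_neg_one {s : ℝ} {u : Dist3} (hu : u ∈ weightedSobolev 0 s) (j : Fin 3) :
    der j u ∈ weightedSobolev (-1) s := by
  rw [mem_weightedSobolev_neg_one, bessel_neg_one_der]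
  exact Submodule.smul_mem _ _ (riesz_mem j hu)

theorem bessel_neg_one_mem_one {s : ℝ} {u : Dist3} (hu : u ∈ weightedSobolev 0 s) :
    bessel (-1) u ∈ weightedSobolev 1 s := by
  rw [mem_weightedSobolev_one, bessel_bessel, add_neg_cancel, bessel_zero]
  exact hu

theorem bessel_neg_one_mem_one' {s : ℝ} {u : Dist3} (hu : u ∈ weightedSobolev (-1) s) :
    bessel (-1) u ∈ weightedSobolev 0 s :=
  mem_weightedSobolev_neg_one.1 hu

theorem wmul_mem_one {s r : ℝ} {u : Dist3} (hu : u ∈ weightedSobolev 1 (s + r)) :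
    wmul r u ∈ weightedSobolev 1 s := by
  obtain ⟨h₀, h₁⟩ := mem_weightedSobolev_one_iff.1 hu
  refine mem_weightedSobolev_one_iff.2 ⟨wmul_mem_iff.2 h₀, fun j => ?_⟩
  rw [der_wmul]
  refine add_mem (Submodule.smul_mem _ _ (smulLeft_mem (hasTemperateGrowth_coordRatio j) 1
    (norm_coordRatio_le j) (wmul_mem_iff.2 (weightedSobolev_zero_mono (by linarith) h₀))))
    (wmul_mem_iff.2 (h₁ j))

theorem exists_norm_weight_le {s ε : ℝ} (hs : s < 0) (hε : 0 < ε) :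
    ∃ R, ∀ x : E3, R < ‖x‖ → ‖weight s x‖ ≤ ε := by
  have h : Tendsto (fun t : ℝ => (1 + t ^ 2) ^ (s / 2)) atTop (𝓝 0) := by
    have h1 : Tendsto (fun t : ℝ => 1 + t ^ 2) atTop atTop :=
      tendsto_atTop_add_const_left _ _ (tendsto_pow_atTop two_ne_zero)
    have h2 := (tendsto_rpow_neg_atTop (y := -(s / 2)) (by linarith)).comp h1
    simpa [Function.comp_def] using h2
  obtain ⟨R, hR⟩ := eventually_atTop.1 (h.eventually (ge_mem_nhds hε))
  exact ⟨R, fun x hx => by rw [norm_weight]; exact hR _ hx.le⟩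

/-- Up to isomorphisms and bounded maps the embedding is ⟨x⟩^{s-r}⟨D⟩⁻¹ on L², and both factors
vanish at infinity. -/
theorem exists_compact_embed {r s : ℝ} (h : s < r) :
    ∃ J : WSob 1 r →L[ℂ] WSob 0 s, IsCompactOperator J ∧ ∀ u, toDist (J u) = toDist u := by
  have hw := memLp_weight (sub_neg.2 h).le
  have hb : MemLp (besselSymbol (-1)) ⊤ (volume : Measure E3) := IsSymbol.bessel.memLp
  have hK : IsCompactOperator (mulL2 hw ∘L fourierMulL2 hb) := by
    refine isCompactOperator_mul_fourierMul (continuous_weight _)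
      (hasTemperateGrowth_besselSymbol _).1.continuous (norm_weight_le_one (sub_neg.2 h).le)
      (besselSymbol_hasBound (by norm_num)) (fun ε hε => exists_norm_weight_le (sub_neg.2 h) hε)
      (fun ε hε => ?_) _ _
    obtain ⟨R, hR⟩ := exists_norm_weight_le (s := -1) (by norm_num) hε
    refine ⟨|R|, fun ξ hξ => hR _ ?_⟩
    rw [norm_smul, Real.norm_of_nonneg (by positivity)]
    nlinarith [Real.pi_gt_three, le_abs_self R, abs_nonneg R]
  let w : WSob 1 r →L[ℂ] WSob 1 0 :=
    restrictWSob (wmul r) fun u hu => wmul_mem_one (by rwa [zero_add])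
  let e₁ : WSob 1 0 →L[ℂ] L2 := (wsobEquiv 1 0).toContinuousLinearEquiv
  let e₂ : L2 →L[ℂ] WSob 0 s := (wsobEquiv 0 s).symm.toContinuousLinearEquiv
  refine ⟨e₂ ∘L (mulL2 hw ∘L fourierMulL2 hb) ∘L (e₁ ∘L w), ?_, fun u => ?_⟩
  · exact (hK.comp_clm (e₁ ∘L w)).clm_comp e₂
  · change toDist ((wsobEquiv 0 s).symm (mulL2 hw (fourierMulL2 hb (wsobEquiv 1 0 (w u))))) = _
    rw [toDist_wsobEquiv_symm, neg_zero, bessel_zero, l2ToDist_mulL2 hw (hasTemperateGrowth_weight _),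
      l2ToDist_fourierMulL2 hb (hasTemperateGrowth_besselSymbol _), l2ToDist_wsobEquiv,
      toDist_restrictWSob]
    change wmul (-s) (wmul (s - r) (bessel (-1) (wmul 0 (bessel 1 (wmul r (toDist u)))))) = _
    rw [wmul_zero, bessel_bessel, neg_add_cancel, bessel_zero, wmul_wmul, wmul_wmul,
      show -s + (s - r) + r = 0 by ring, wmul_zero]

/-! ### The perturbation `W` -/

theorem momentum_eq (j : Fin 3) (u : Dist3) : momentum j u = -(Complex.I • der j u) :=
  neg_smul Complex.I (der j u)

section CompactOperators

variable {X Y Z : Type*} [NormedAddCommGroup X] [NormedSpace ℂ X] [NormedAddCommGroup Y]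
  [NormedSpace ℂ Y] [NormedAddCommGroup Z] [NormedSpace ℂ Z]

theorem isCompactOperator_add {S T : X →L[ℂ] Y} (hS : IsCompactOperator S)
    (hT : IsCompactOperator T) : IsCompactOperator (S + T : X →L[ℂ] Y) := hS.add hT

theorem isCompactOperator_sub {S T : X →L[ℂ] Y} (hS : IsCompactOperator S)
    (hT : IsCompactOperator T) : IsCompactOperator (S - T : X →L[ℂ] Y) := hS.sub hT

theorem isCompactOperator_clm_comp (S : Y →L[ℂ] Z) {T : X →L[ℂ] Y} (hT : IsCompactOperator T) :
    IsCompactOperator (S ∘L T) := hT.clm_comp S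

theorem isCompactOperator_comp_clm {S : Y →L[ℂ] Z} (hS : IsCompactOperator S) (T : X →L[ℂ] Y) :
    IsCompactOperator (S ∘L T) := hS.comp_clm T

theorem isCompactOperator_sum {T : Fin 3 → X →L[ℂ] Y} (hT : ∀ j, IsCompactOperator (T j)) :
    IsCompactOperator (∑ j, T j : X →L[ℂ] Y) := by
  rw [Fin.sum_univ_three]
  exact isCompactOperator_add (isCompactOperator_add (hT 0) (hT 1)) (hT 2)

end CompactOperators

/-- The operator `P_j` from `H^{1,s}` to `H^{0,s}`. -/
def momentumOne (j : Fin 3) (s : ℝ) : WSob 1 s →L[ℂ] WSob 0 s :=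
  restrictWSob ((-Complex.I) • der j) fun _ hu => Submodule.smul_mem _ _ (der_mem hu j)

theorem toDist_momentumOne (j : Fin 3) {s : ℝ} (u : WSob 1 s) :
    toDist (momentumOne j s u) = momentum j (toDist u) := by
  rw [momentumOne, toDist_restrictWSob, _root_.smul_apply, momentum_eq, neg_smul]

/-- The operator `P_j` from `H^{0,s}` to `H^{-1,s}`. -/
def momentumZero (j : Fin 3) (s : ℝ) : WSob 0 s →L[ℂ] WSob (-1) s :=
  restrictWSob ((-Complex.I) • der j) fun _ hu => Submodule.smul_mem _ _ (der_mem_neg_one hu j)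

theorem toDist_momentumZero (j : Fin 3) {s : ℝ} (u : WSob 0 s) :
    toDist (momentumZero j s u) = momentum j (toDist u) := by
  rw [momentumZero, toDist_restrictWSob, _root_.smul_apply, momentum_eq, neg_smul]

/-- The embedding of `H^{1,s}` into `H^{0,s}`. -/
def oneToZero (s : ℝ) : WSob 1 s →L[ℂ] WSob 0 s :=
  restrictWSob (ContinuousLinearMap.id ℂ Dist3) fun _ hu => weightedSobolev_one_le hu

theorem toDist_oneToZero {s : ℝ} (u : WSob 1 s) : toDist (oneToZero s u) = toDist u := by
  rw [oneToZero, toDist_restrictWSob, ContinuousLinearMap.id_apply]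

/-- The embedding of `H^{0,s}` into `H^{-1,s}`. -/
def zeroToNegOne (s : ℝ) : WSob 0 s →L[ℂ] WSob (-1) s :=
  restrictWSob (ContinuousLinearMap.id ℂ Dist3) fun _ hu => mem_neg_one_of_mem_zero hu

theorem toDist_zeroToNegOne {s : ℝ} (u : WSob 0 s) : toDist (zeroToNegOne s u) = toDist u := by
  rw [zeroToNegOne, toDist_restrictWSob, ContinuousLinearMap.id_apply]

/-- The embedding of `H^{0,r}` into `H^{-1,s}` is compact for `s < r`. -/
theorem exists_compact_embed_neg_one {r s : ℝ} (h : s < r) :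
    ∃ J : WSob 0 r →L[ℂ] WSob (-1) s, IsCompactOperator J ∧ ∀ u, toDist (J u) = toDist u := by
  obtain ⟨J, hJ, hJu⟩ := exists_compact_embed h
  let a : WSob 0 r →L[ℂ] WSob 1 r := restrictWSob (bessel (-1)) fun _ hu => bessel_neg_one_mem_one hu
  let b : WSob 0 s →L[ℂ] WSob (-1) s := restrictWSob (bessel 1) fun _ hu =>
    bessel_mem_iff.2 (by rwa [neg_add_cancel])
  refine ⟨b ∘L J ∘L a, (hJ.comp_clm a).clm_comp b, fun u => ?_⟩
  rw [ContinuousLinearMap.comp_apply, ContinuousLinearMap.comp_apply, toDist_restrictWSob, hJu,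
    toDist_restrictWSob, bessel_bessel, add_neg_cancel, bessel_zero]

section Perturbation

variable {β : ℝ} {V : E3 → ℝ} {B A : E3 → E3}

/-- The operator `W` assembled from operators realizing `u ↦ A_j u`, `u ↦ A_j (P_j - A_j) u` and
`u ↦ V u`. -/
theorem isPerturbationOp_of {r s : ℝ} {M : Fin 3 → WSob 1 r →L[ℂ] WSob 0 s}
    {N : Fin 3 → WSob 1 r →L[ℂ] WSob (-1) s} {Q : WSob 1 r →L[ℂ] WSob 0 s}
    (hM : ∀ j u, IsMul (fun x => A x j) (toDist u) (toDist (M j u)))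
    (hN : ∀ j u, IsMul (fun x => A x j) (momentum j (toDist u) - toDist (M j u)) (toDist (N j u)))
    (hQ : ∀ u, IsMul V (toDist u) (toDist (Q u))) :
    IsPerturbationOp A V (zeroToNegOne s ∘L Q - ∑ j, momentumZero j s ∘L M j - ∑ j, N j) := by
  intro u
  -- The identity behind the formula is (P_j - A_j)²u = P_j²u - P_j(A_j u) - A_j(P_j - A_j)u with Σ
  -- P_j² = -Δ. No derivative ever falls on A alone.
  set d : Fin 3 → Dist3 := fun j => momentum j (toDist u) - toDist (M j u) with hd
  refine ⟨d, fun j => momentum j (d j) - toDist (N j u), toDist (Q u), fun j => ?_, fun j => ?_,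
    hQ u, ?_⟩
  · rw [IsMagneticMomentum, hd, sub_sub_cancel]
    exact hM j u
  · rw [IsMagneticMomentum, sub_sub_cancel]
    exact hN j u
  · simp only [_root_.sub_apply, _root_.sum_apply, ContinuousLinearMap.comp_apply, map_sub, map_sum,
      toDist_zeroToNegOne, toDist_momentumZero, hd, laplacian_eq_sum_der, Finset.sum_sub_distrib,
      momentum_eq, smul_sub, map_smul, map_neg, smul_smul, smul_neg, neg_neg, Complex.I_mul_I,
      neg_smul, one_smul, Finset.sum_neg_distrib]
    abel

theorem IsVectorPotential.exists_bound (hA : IsVectorPotential β B A) :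
    ∃ C : ℝ, ∀ j x, |A x j| ≤ C * (1 + ‖x‖ ^ 2) ^ (-β / 2) := by
  obtain ⟨C, hC⟩ := hA.decay_A
  refine ⟨C, fun j x => le_trans ?_ (hC x)⟩
  exact PiLp.norm_apply_le (A x) j

theorem IsVectorPotential.aestronglyMeasurable (hA : IsVectorPotential β B A) (j : Fin 3) :
    AEStronglyMeasurable (fun x => A x j) (volume : Measure E3) := by
  have h := hA.contDiff_A.continuous
  exact Continuous.aestronglyMeasurable (by fun_prop)

theorem IsVectorPotential.exists_mulOp (hA : IsVectorPotential β B A) {s r : ℝ} (h : r ≤ s + β)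
    (j : Fin 3) : ∃ M : WSob 0 s →L[ℂ] WSob 0 r,
      ∀ u, IsMul (fun x => A x j) (toDist u) (toDist (M u)) := by
  obtain ⟨C, hC⟩ := hA.exists_bound
  exact MagneticThreshold.exists_mulOp (hA.aestronglyMeasurable j) (hC j) h

/-- The operator `(P_j - A_j)` from `H^{1,r}` to `H^{0,r}`. -/
theorem IsVectorPotential.exists_magneticMomentum (hA : IsVectorPotential β B A) (hβ : 0 ≤ β)
    (r : ℝ) (j : Fin 3) : ∃ D : WSob 1 r →L[ℂ] WSob 0 r,
      ∀ u, IsMagneticMomentum A j (toDist u) (toDist (D u)) := by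
  obtain ⟨M, hM⟩ := hA.exists_mulOp (s := r) (r := r) (by linarith) j
  refine ⟨momentumOne j r - M ∘L oneToZero r, fun u => ?_⟩
  have h := hM (oneToZero r u)
  rw [toDist_oneToZero] at h
  simpa only [IsMagneticMomentum, _root_.sub_apply, ContinuousLinearMap.comp_apply, map_sub,
    toDist_momentumOne, sub_sub_cancel] using h

theorem exists_perturbationOp (hβ : 0 ≤ β) (hV : FieldAssumption β V B)
    (hA : IsVectorPotential β B A) {r s : ℝ} (h : s ≤ r + β) :
    ∃ T : WSob 1 r →L[ℂ] WSob (-1) s, IsPerturbationOp A V T := by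
  obtain ⟨C, hC⟩ := hV.decay_V
  obtain ⟨Q, hQ⟩ := exists_mulOp hV.aestronglyMeasurable_V hC h
  choose M hM using fun j => hA.exists_mulOp h j
  choose D hD using fun j => hA.exists_magneticMomentum hβ r j
  have hM' : ∀ j (u : WSob 1 r), IsMul (fun x => A x j) (toDist u)
      (toDist ((M j ∘L oneToZero r) u)) := fun j u => by
    simpa only [ContinuousLinearMap.comp_apply, toDist_oneToZero] using hM j (oneToZero r u)
  refine ⟨_, isPerturbationOp_of (M := fun j => M j ∘L oneToZero r)
    (N := fun j => zeroToNegOne s ∘L M j ∘L D j) (Q := Q ∘L oneToZero r) hM' (fun j u => ?_)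
    (fun u => ?_)⟩
  · have := hM j (D j u)
    rw [← (hD j u).unique (hM' j u), sub_sub_cancel]
    simpa only [ContinuousLinearMap.comp_apply, toDist_zeroToNegOne] using this
  · simpa only [ContinuousLinearMap.comp_apply, toDist_oneToZero] using hQ (oneToZero r u)

/-- The strict loss of weight leaves room for a compact embedding. For P_j A_j and V it is used
before the multiplication, on H^{1,r}; for A_j(P_j - A_j) the factor to be multiplied is only in
L^{2,r}, so the compact embedding into H^{-1,s} is used afterwards. -/
theorem exists_compact_perturbationOp (hβ : 0 ≤ β) (hV : FieldAssumption β V B)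
    (hA : IsVectorPotential β B A) {r s : ℝ} (h : s < r + β) :
    ∃ T : WSob 1 r →L[ℂ] WSob (-1) s, IsPerturbationOp A V T ∧ IsCompactOperator T := by
  obtain ⟨C, hC⟩ := hV.decay_V
  have hr : s - β < r := by linarith
  obtain ⟨J, hJ, hJu⟩ := exists_compact_embed hr
  obtain ⟨J', hJ', hJu'⟩ := exists_compact_embed_neg_one h
  have h' : s ≤ s - β + β := by linarith
  obtain ⟨Q, hQ⟩ := exists_mulOp hV.aestronglyMeasurable_V hC h'
  choose M hM using fun j => hA.exists_mulOp h' j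
  choose N hN using fun j => hA.exists_mulOp (le_refl (r + β)) j
  choose D hD using fun j => hA.exists_magneticMomentum hβ r j
  have hM' : ∀ j (u : WSob 1 r), IsMul (fun x => A x j) (toDist u)
      (toDist ((M j ∘L J) u)) := fun j u => by
    simpa only [ContinuousLinearMap.comp_apply, hJu] using hM j (J u)
  refine ⟨_, isPerturbationOp_of (M := fun j => M j ∘L J)
    (N := fun j => J' ∘L N j ∘L D j) (Q := Q ∘L J) hM' (fun j u => ?_) (fun u => ?_), ?_⟩
  · have := hN j (D j u)
    rw [← (hD j u).unique (hM' j u), sub_sub_cancel]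
    simpa only [ContinuousLinearMap.comp_apply, hJu'] using this
  · simpa only [ContinuousLinearMap.comp_apply, hJu] using hQ (J u)
  · exact isCompactOperator_sub (isCompactOperator_sub
      (isCompactOperator_clm_comp _ (isCompactOperator_clm_comp _ hJ))
      (isCompactOperator_sum fun j => isCompactOperator_clm_comp _ (isCompactOperator_clm_comp _ hJ)))
      (isCompactOperator_sum fun j => isCompactOperator_comp_clm hJ' _)

end Perturbation

/-! ### Schur's test -/

section Schur

open scoped ENNReal NNReal

theorem two_mul_le_sq_mul_add {f g P Q : ℝ} (hP : 0 < P) (hQ : 0 < Q) :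
    g * f ≤ (f ^ 2 * (P * Q⁻¹) + g ^ 2 * (Q * P⁻¹)) / 2 := by
  have h : f ^ 2 * (P * Q⁻¹) + g ^ 2 * (Q * P⁻¹) - 2 * (g * f) =
      (f * P - g * Q) ^ 2 * (P⁻¹ * Q⁻¹) := by
    field_simp
    ring
  have : 0 ≤ (f * P - g * Q) ^ 2 * (P⁻¹ * Q⁻¹) := by positivity
  linarith

theorem enorm_mul_le_of_pos {f g k : ℂ} {P Q : ℝ} (hP : 0 < P) (hQ : 0 < Q) :
    ‖g * (k * f)‖ₑ ≤ 2⁻¹ * (‖f‖ₑ ^ 2 * (ENNReal.ofReal Q)⁻¹ * (‖k‖ₑ * ENNReal.ofReal P) +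
      ‖g‖ₑ ^ 2 * (ENNReal.ofReal P)⁻¹ * (‖k‖ₑ * ENNReal.ofReal Q)) := by
  rw [← ENNReal.ofReal_inv_of_pos hP, ← ENNReal.ofReal_inv_of_pos hQ]
  simp only [← ofReal_norm, norm_mul]
  have h2 : (2⁻¹ : ℝ≥0∞) = ENNReal.ofReal 2⁻¹ := by
    rw [ENNReal.ofReal_inv_of_pos two_pos]; simp
  rw [h2, ← ENNReal.ofReal_pow (norm_nonneg _), ← ENNReal.ofReal_pow (norm_nonneg _),
    ← ENNReal.ofReal_mul (norm_nonneg _), ← ENNReal.ofReal_mul (norm_nonneg _),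
    ← ENNReal.ofReal_mul (by positivity), ← ENNReal.ofReal_mul (by positivity),
    ← ENNReal.ofReal_mul (by positivity), ← ENNReal.ofReal_mul (by positivity),
    ← ENNReal.ofReal_add (by positivity) (by positivity), ← ENNReal.ofReal_mul (by norm_num)]
  refine ENNReal.ofReal_le_ofReal ?_
  have := mul_le_mul_of_nonneg_left (two_mul_le_sq_mul_add (f := ‖f‖) (g := ‖g‖) hP hQ)
    (norm_nonneg k)
  calc ‖g‖ * (‖k‖ * ‖f‖) = ‖k‖ * (‖g‖ * ‖f‖) := by ring
    _ ≤ _ := this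
    _ = _ := by ring

/-- Schur's test, as a bound for the bilinear form of the kernel. -/
theorem lintegral_schur {K : E3 × E3 → ℂ} (hK : AEStronglyMeasurable K (volume.prod volume))
    {p q : E3 → ℝ} (hp : Measurable p) (hq : Measurable q) (hp₀ : ∀ᵐ x, 0 < p x)
    (hq₀ : ∀ᵐ x, 0 < q x) {M : ℝ≥0∞}
    (h₁ : ∀ᵐ x, ∫⁻ y, ‖K (x, y)‖ₑ * ENNReal.ofReal (q y) ≤ M * ENNReal.ofReal (p x))
    (h₂ : ∀ᵐ y, ∫⁻ x, ‖K (x, y)‖ₑ * ENNReal.ofReal (p x) ≤ M * ENNReal.ofReal (q y)) (f g : L2) :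
    ∫⁻ z, ‖g z.1 * (K z * f z.2)‖ₑ ∂(volume.prod volume) ≤ 2⁻¹ * (M * (‖f‖ₑ ^ 2 + ‖g‖ₑ ^ 2)) := by
  have hf : AEMeasurable (fun x => ‖f x‖ₑ) (volume : Measure E3) :=
    (Lp.aestronglyMeasurable f).enorm
  have hg : AEMeasurable (fun x => ‖g x‖ₑ) (volume : Measure E3) :=
    (Lp.aestronglyMeasurable g).enorm
  have hf' : AEMeasurable (fun z : E3 × E3 => ‖f z.2‖ₑ) (volume.prod volume) :=
    hf.comp_quasiMeasurePreserving Measure.quasiMeasurePreserving_snd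
  have hg' : AEMeasurable (fun z : E3 × E3 => ‖g z.1‖ₑ) (volume.prod volume) :=
    hg.comp_quasiMeasurePreserving Measure.quasiMeasurePreserving_fst
  have hK' := hK.enorm
  have hP : Measurable fun z : E3 × E3 => ENNReal.ofReal (p z.1) :=
    (hp.comp measurable_fst).ennreal_ofReal
  have hQ : Measurable fun z : E3 × E3 => ENNReal.ofReal (q z.2) :=
    (hq.comp measurable_snd).ennreal_ofReal
  have hae : ∀ᵐ z : E3 × E3 ∂(volume.prod volume), ‖g z.1 * (K z * f z.2)‖ₑ ≤
      2⁻¹ * (‖f z.2‖ₑ ^ 2 * (ENNReal.ofReal (q z.2))⁻¹ * (‖K z‖ₑ * ENNReal.ofReal (p z.1)) +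
      ‖g z.1‖ₑ ^ 2 * (ENNReal.ofReal (p z.1))⁻¹ * (‖K z‖ₑ * ENNReal.ofReal (q z.2))) := by
    filter_upwards [Measure.quasiMeasurePreserving_fst.ae hp₀,
      Measure.quasiMeasurePreserving_snd.ae hq₀] with z h h'
    exact enorm_mul_le_of_pos h h'
  refine (lintegral_mono_ae hae).trans ?_
  have m₁ : AEMeasurable (fun z : E3 × E3 => ‖f z.2‖ₑ ^ 2 * (ENNReal.ofReal (q z.2))⁻¹ *
      (‖K z‖ₑ * ENNReal.ofReal (p z.1))) (volume.prod volume) := by fun_prop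
  have m₂ : AEMeasurable (fun z : E3 × E3 => ‖g z.1‖ₑ ^ 2 * (ENNReal.ofReal (p z.1))⁻¹ *
      (‖K z‖ₑ * ENNReal.ofReal (q z.2))) (volume.prod volume) := by fun_prop
  rw [lintegral_const_mul' _ _ (by simp), lintegral_add_left' m₁, lintegral_prod_symm _ m₁,
    lintegral_prod _ m₂, mul_add]
  have key : ∀ (h : L2) {a b : E3 → ℝ} (_ : ∀ᵐ x, 0 < b x) {L : E3 → E3 → ℝ≥0∞}
      (_ : ∀ᵐ y, ∫⁻ x, L y x * ENNReal.ofReal (a x) ≤ M * ENNReal.ofReal (b y)),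
      ∫⁻ y, ∫⁻ x, ‖h y‖ₑ ^ 2 * (ENNReal.ofReal (b y))⁻¹ * (L y x * ENNReal.ofReal (a x)) ≤
        M * ‖h‖ₑ ^ 2 := by
    intro h a b hb L hL
    rw [← lintegral_sq_enorm]
    calc _ ≤ ∫⁻ y, ‖h y‖ₑ ^ 2 * M := by
          refine lintegral_mono_ae ?_
          filter_upwards [hb, hL] with y h₁ h₂
          have h0 : ENNReal.ofReal (b y) ≠ 0 := by simpa using h₁
          rw [lintegral_const_mul' _ _ (ENNReal.mul_ne_top (by simp) (by simpa using h₁)), mul_assoc]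
          gcongr
          calc _ ≤ (ENNReal.ofReal (b y))⁻¹ * (M * ENNReal.ofReal (b y)) := by gcongr
            _ = M := by
              rw [mul_left_comm, ENNReal.inv_mul_cancel h0 (by simp), mul_one]
      _ = _ := by
          rw [lintegral_mul_const'' _ (by
            exact (Lp.aestronglyMeasurable h).enorm.pow_const 2), mul_comm]
  rw [mul_add, mul_add]
  exact add_le_add (mul_le_mul_right (key f hq₀ h₂) _) (mul_le_mul_right (key g hp₀ h₁) _)

/-- The quadratic bound is applied to normalized vectors. -/
theorem norm_bilin_le_of_sq {X Y : Type*} [NormedAddCommGroup X] [NormedSpace ℂ X]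
    [NormedAddCommGroup Y] [NormedSpace ℂ Y] (b : X →ₗ[ℂ] Y →ₗ[ℂ] ℂ) {M : ℝ}
    (h : ∀ x y, ‖b x y‖ ≤ 2⁻¹ * (M * (‖x‖ ^ 2 + ‖y‖ ^ 2))) (x : X) (y : Y) :
    ‖b x y‖ ≤ M * ‖x‖ * ‖y‖ := by
  by_cases hx : x = 0
  · simp [hx]
  by_cases hy : y = 0
  · simp [hy]
  have hx' : 0 < ‖x‖ := norm_pos_iff.2 hx
  have hy' : 0 < ‖y‖ := norm_pos_iff.2 hy
  have h1 := h (((‖x‖⁻¹ : ℝ) : ℂ) • x) (((‖y‖⁻¹ : ℝ) : ℂ) • y)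
  simp only [map_smul, LinearMap.smul_apply, norm_smul, Complex.norm_real, norm_inv, norm_norm,
    inv_mul_cancel₀ hx'.ne', inv_mul_cancel₀ hy'.ne'] at h1
  have h2 : ‖x‖⁻¹ * (‖y‖⁻¹ * ‖b x y‖) ≤ M := by linarith
  rw [← mul_assoc, ← mul_inv, inv_mul_le_iff₀ (by positivity)] at h2
  linarith

/-- Complex conjugation on `L²`. -/
def conjL2 : L2 →L⋆[ℂ] L2 :=
  LinearMap.mkContinuous
    { toFun := fun f => star f
      map_add' := fun f g => by
        refine Lp.ext ?_
        filter_upwards [Lp.coeFn_star (f + g), Lp.coeFn_star f, Lp.coeFn_star g,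
          Lp.coeFn_add f g, Lp.coeFn_add (star f) (star g)] with x h₁ h₂ h₃ h₄ h₅
        rw [h₁, h₅, Pi.add_apply, h₂, h₃, Pi.star_apply, Pi.star_apply, Pi.star_apply, h₄,
          Pi.add_apply, star_add]
      map_smul' := fun c f => by
        refine Lp.ext ?_
        filter_upwards [Lp.coeFn_star (c • f), Lp.coeFn_star f, Lp.coeFn_smul c f,
          Lp.coeFn_smul (starRingEnd ℂ c) (star f)] with x h₁ h₂ h₃ h₄
        rw [h₁, h₄, Pi.smul_apply, h₂, Pi.star_apply, Pi.star_apply, h₃, Pi.smul_apply, star_smul]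
        rfl } 1 fun f => by
    rw [one_mul]
    refine Lp.norm_le_norm_of_ae_le ?_
    filter_upwards [Lp.coeFn_star f] with x h
    change ‖(star f : L2) x‖ ≤ _
    rw [h, Pi.star_apply, norm_star]

theorem coeFn_conjL2 (f : L2) : conjL2 f =ᵐ[volume] fun x => starRingEnd ℂ (f x) :=
  Lp.coeFn_star f

theorem norm_conjL2_le : ‖conjL2‖ ≤ 1 :=
  LinearMap.mkContinuous_norm_le _ zero_le_one _

/-- The bounded bilinear form of the kernel is represented by the Riesz theorem. The pairing ∫ g T f
carries no conjugate, so the antilinear Riesz map is composed with complex conjugation to give a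
linear `T`. -/
theorem exists_schur {K : E3 × E3 → ℂ} (hK : AEStronglyMeasurable K (volume.prod volume))
    {p q : E3 → ℝ} (hp : Measurable p) (hq : Measurable q) (hp₀ : ∀ᵐ x, 0 < p x)
    (hq₀ : ∀ᵐ x, 0 < q x) {M : ℝ} (hM : 0 ≤ M)
    (h₁ : ∀ᵐ x, ∫⁻ y, ‖K (x, y)‖ₑ * ENNReal.ofReal (q y) ≤ ENNReal.ofReal M * ENNReal.ofReal (p x))
    (h₂ : ∀ᵐ y, ∫⁻ x, ‖K (x, y)‖ₑ * ENNReal.ofReal (p x) ≤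
      ENNReal.ofReal M * ENNReal.ofReal (q y)) :
    ∃ T : L2 →L[ℂ] L2, ‖T‖ ≤ M ∧ ∀ f g : L2,
      Integrable (fun z : E3 × E3 => g z.1 * (K z * f z.2)) (volume.prod volume) ∧
      ∫ x, g x * T f x = ∫ z, g z.1 * (K z * f z.2) ∂(volume.prod volume) := by
  have hb := lintegral_schur hK hp hq hp₀ hq₀ h₁ h₂
  have hfin : ∀ f g : L2, ENNReal.ofReal M * (‖f‖ₑ ^ 2 + ‖g‖ₑ ^ 2) ≠ ⊤ := fun f g =>
    ENNReal.mul_ne_top (by simp) (by simp)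
  have hi : ∀ f g : L2,
      Integrable (fun z : E3 × E3 => g z.1 * (K z * f z.2)) (volume.prod volume) := by
    intro f g
    refine ⟨?_, lt_of_le_of_lt (hb f g) (ENNReal.mul_lt_top (by simp) (hfin f g).lt_top)⟩
    exact ((Lp.aestronglyMeasurable g).comp_quasiMeasurePreserving
      Measure.quasiMeasurePreserving_fst).mul (hK.mul
      ((Lp.aestronglyMeasurable f).comp_quasiMeasurePreserving Measure.quasiMeasurePreserving_snd))
  let b : L2 →ₗ[ℂ] L2 →ₗ[ℂ] ℂ := LinearMap.mk₂ ℂ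
    (fun f g => ∫ z, g z.1 * (K z * f z.2) ∂(volume.prod volume))
    (fun f f' g => by
      rw [← integral_add (hi f g) (hi f' g)]
      refine integral_congr_ae ?_
      filter_upwards [Measure.quasiMeasurePreserving_snd.ae (Lp.coeFn_add f f')] with z hz
      rw [hz, Pi.add_apply]
      ring)
    (fun c f g => by
      rw [smul_eq_mul, ← integral_const_mul]
      refine integral_congr_ae ?_
      filter_upwards [Measure.quasiMeasurePreserving_snd.ae (Lp.coeFn_smul c f)] with z hz
      rw [hz, Pi.smul_apply, smul_eq_mul]
      ring)
    (fun f g g' => by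
      rw [← integral_add (hi f g) (hi f g')]
      refine integral_congr_ae ?_
      filter_upwards [Measure.quasiMeasurePreserving_fst.ae (Lp.coeFn_add g g')] with z hz
      rw [hz, Pi.add_apply]
      ring)
    (fun c f g => by
      rw [smul_eq_mul, ← integral_const_mul]
      refine integral_congr_ae ?_
      filter_upwards [Measure.quasiMeasurePreserving_fst.ae (Lp.coeFn_smul c g)] with z hz
      rw [hz, Pi.smul_apply, smul_eq_mul]
      ring)
  have hbn : ∀ f g, ‖b f g‖ ≤ 2⁻¹ * (M * (‖f‖ ^ 2 + ‖g‖ ^ 2)) := by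
    intro f g
    have h := (enorm_integral_le_lintegral_enorm _).trans (hb f g)
    have h3 : 2⁻¹ * (ENNReal.ofReal M * (‖f‖ₑ ^ 2 + ‖g‖ₑ ^ 2)) =
        ENNReal.ofReal (2⁻¹ * (M * (‖f‖ ^ 2 + ‖g‖ ^ 2))) := by
      rw [ENNReal.ofReal_mul (by norm_num), ENNReal.ofReal_mul hM,
        ENNReal.ofReal_add (by positivity) (by positivity), ENNReal.ofReal_pow (norm_nonneg _),
        ENNReal.ofReal_pow (norm_nonneg _), ofReal_norm, ofReal_norm,
        ENNReal.ofReal_inv_of_pos two_pos]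
      simp
    rw [h3, ← ofReal_norm, ENNReal.ofReal_le_ofReal_iff (by positivity)] at h
    exact h
  let B : L2 →L[ℂ] L2 →L[ℂ] ℂ := b.mkContinuous₂ M (norm_bilin_le_of_sq b hbn)
  have hBn : ‖B‖ ≤ M := LinearMap.mkContinuous₂_norm_le _ hM _
  let Φ : (L2 →L[ℂ] ℂ) →L⋆[ℂ] L2 := (InnerProductSpace.toDual ℂ L2).symm.toContinuousLinearEquiv
  have hΦ : ‖Φ‖ ≤ 1 := ContinuousLinearMap.opNorm_le_bound _ zero_le_one fun x => by
    rw [one_mul]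
    exact ((InnerProductSpace.toDual ℂ L2).symm.norm_map x).le
  refine ⟨conjL2.comp (Φ.comp B), ?_, fun f g => ⟨hi f g, ?_⟩⟩
  · refine (ContinuousLinearMap.opNorm_comp_le _ _).trans ?_
    calc _ ≤ 1 * (‖Φ‖ * ‖B‖) := by
          gcongr
          · exact norm_conjL2_le
          · exact ContinuousLinearMap.opNorm_comp_le _ _
      _ ≤ 1 * (1 * M) := by gcongr
      _ = M := by ring
  · have h : ∫ x, g x * (conjL2.comp (Φ.comp B)) f x = inner ℂ (Φ (B f)) g := by
      rw [L2.inner_def]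
      refine integral_congr_ae ?_
      filter_upwards [coeFn_conjL2 (Φ (B f))] with x hx
      rw [ContinuousLinearMap.comp_apply, ContinuousLinearMap.comp_apply, hx, RCLike.inner_apply]
    rw [h]
    exact InnerProductSpace.toDual_symm_apply

end Schur

/-! ### Convolution operators between weighted spaces -/

section Convolution

open scoped ENNReal NNReal

theorem finrank_E3 : Module.finrank ℝ E3 = 3 := by simp

theorem integrableOn_norm_rpow {b : ℝ} (hb : b < 3) (R : ℝ) :
    IntegrableOn (fun x : E3 => ‖x‖ ^ (-b)) (Metric.ball 0 R) := by
  rw [integrableOn_fun_norm_addHaar volume (f := fun t : ℝ => t ^ (-b)), finrank_E3]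
  rcases le_or_gt R 0 with hR | hR
  · rw [Set.Ioo_eq_empty (not_lt.2 hR)]
    exact integrableOn_empty
  have h := (intervalIntegral.intervalIntegrable_rpow' (a := 0) (b := R) (r := 2 - b)
    (by linarith)).1
  refine (h.mono_set Set.Ioo_subset_Ioc_self).congr_fun (fun t ht => ?_) measurableSet_Ioo
  simp only [smul_eq_mul]
  rw [sub_eq_add_neg, Real.rpow_add ht.1]
  norm_num

/-- Three regions: near y = 0 the factor |x - y|⁻¹ is at most 2; for |y| ≥ 1/2 and |x - y| < 4 the
factor |y|^{-a} is at most 2^a ≤ 8; and for |x - y| ≥ 4 one has |y| ≥ (1 + |x - y|)/2, which gives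
the decay exponent 1 + a > 3. Each majorant is integrable. -/
theorem rieszPotential_pointwise {a : ℝ} (h₂ : 2 < a) (h₃ : a < 3) {x : E3} (hx : ‖x‖ = 1) (y : E3) :
    ‖x - y‖⁻¹ * ‖y‖ ^ (-a) ≤ 2 * (Metric.ball (0 : E3) 1).indicator (fun z => ‖z‖ ^ (-a)) y +
      (8 * (Metric.ball (0 : E3) 4).indicator (fun z => ‖z‖ ^ (-1 : ℝ)) (x - y) +
        16 * (1 + ‖x - y‖) ^ (-(1 + a))) := by
  have p₁ : 0 ≤ (Metric.ball (0 : E3) 1).indicator (fun z => ‖z‖ ^ (-a)) y :=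
    Set.indicator_nonneg (fun _ _ => by positivity) _
  have p₂ : 0 ≤ (Metric.ball (0 : E3) 4).indicator (fun z => ‖z‖ ^ (-1 : ℝ)) (x - y) :=
    Set.indicator_nonneg (fun _ _ => by positivity) _
  have p₃ : 0 ≤ (1 + ‖x - y‖) ^ (-(1 + a)) := by positivity
  have h2a : (2 : ℝ) ^ a ≤ 8 := by
    calc (2 : ℝ) ^ a ≤ 2 ^ (3 : ℝ) := Real.rpow_le_rpow_of_exponent_le one_le_two h₃.le
      _ = 8 := by norm_num
  have htri : 1 ≤ ‖x - y‖ + ‖y‖ := by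
    rw [← hx]
    simpa using norm_add_le (x - y) y
  have htri' : ‖x - y‖ ≤ 1 + ‖y‖ := hx ▸ norm_sub_le x y
  rcases lt_or_ge ‖y‖ (1 / 2) with hy | hy
  · rw [Set.indicator_of_mem (by rw [mem_ball_zero_iff]; linarith)]
    have : ‖x - y‖⁻¹ ≤ 2 := by
      rw [inv_le_comm₀ (by linarith) two_pos]
      linarith
    have := mul_le_mul_of_nonneg_right this (Real.rpow_nonneg (norm_nonneg y) (-a))
    linarith
  rcases lt_or_ge ‖x - y‖ 4 with hxy | hxy
  · rw [Set.indicator_of_mem (s := Metric.ball (0 : E3) 4) (by rwa [mem_ball_zero_iff]),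
      Real.rpow_neg_one]
    have : ‖y‖ ^ (-a) ≤ 8 := by
      calc ‖y‖ ^ (-a) ≤ (1 / 2) ^ (-a) :=
            Real.rpow_le_rpow_of_nonpos (by norm_num) hy (by linarith)
        _ = 2 ^ a := by rw [one_div, Real.inv_rpow two_pos.le, Real.rpow_neg two_pos.le, inv_inv]
        _ ≤ 8 := h2a
    have := mul_le_mul_of_nonneg_left this (inv_nonneg.2 (norm_nonneg (x - y)))
    linarith
  · have e₁ : ‖x - y‖⁻¹ ≤ 2 * (1 + ‖x - y‖) ^ (-1 : ℝ) := by
      rw [Real.rpow_neg_one, ← div_eq_mul_inv, inv_eq_one_div,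
        div_le_div_iff₀ (by linarith) (by linarith)]
      linarith
    have e₂ : ‖y‖ ^ (-a) ≤ 8 * (1 + ‖x - y‖) ^ (-a) := by
      calc ‖y‖ ^ (-a) ≤ ((1 + ‖x - y‖) / 2) ^ (-a) :=
            Real.rpow_le_rpow_of_nonpos (by linarith) (by linarith) (by linarith)
        _ = 2 ^ a * (1 + ‖x - y‖) ^ (-a) := by
            rw [Real.div_rpow (by positivity) two_pos.le, Real.rpow_neg two_pos.le, div_inv_eq_mul,
              mul_comm]
        _ ≤ _ := by gcongr
    have e₃ := mul_le_mul e₁ e₂ (by positivity) (by positivity)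
    have e₄ : (1 + ‖x - y‖) ^ (-1 : ℝ) * (1 + ‖x - y‖) ^ (-a) = (1 + ‖x - y‖) ^ (-(1 + a)) := by
      rw [← Real.rpow_add (by positivity)]
      congr 1
      ring
    have e₅ : 2 * (1 + ‖x - y‖) ^ (-1 : ℝ) * (8 * (1 + ‖x - y‖) ^ (-a)) =
        16 * (1 + ‖x - y‖) ^ (-(1 + a)) := by
      rw [← e₄]
      ring
    linarith

theorem rieszPotential_unit {a : ℝ} (h₂ : 2 < a) (h₃ : a < 3) : ∃ C : ℝ, 0 ≤ C ∧
    ∀ x : E3, ‖x‖ = 1 → ∫⁻ y, ENNReal.ofReal (‖x - y‖⁻¹ * ‖y‖ ^ (-a)) ≤ ENNReal.ofReal C := by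
  set F₁ : E3 → ℝ := (Metric.ball (0 : E3) 1).indicator (fun z => ‖z‖ ^ (-a))
  set F₂ : E3 → ℝ := (Metric.ball (0 : E3) 4).indicator (fun z => ‖z‖ ^ (-1 : ℝ))
  set F₃ : E3 → ℝ := fun z => (1 + ‖z‖) ^ (-(1 + a))
  have i₁ : Integrable F₁ := (integrableOn_norm_rpow h₃ 1).integrable_indicator measurableSet_ball
  have i₂ : Integrable F₂ :=
    (integrableOn_norm_rpow (by norm_num) 4).integrable_indicator measurableSet_ball
  have i₃ : Integrable F₃ := integrable_one_add_norm (by rw [finrank_E3]; push_cast; linarith)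
  have n₁ : ∀ y, 0 ≤ F₁ y := Set.indicator_nonneg fun _ _ => by positivity
  have n₂ : ∀ y, 0 ≤ F₂ y := Set.indicator_nonneg fun _ _ => by positivity
  have n₃ : ∀ y, 0 ≤ F₃ y := fun y => by positivity
  refine ⟨2 * (∫ y, F₁ y) + (8 * (∫ y, F₂ y) + 16 * ∫ y, F₃ y), ?_, fun x hx => ?_⟩
  · have := integral_nonneg (μ := volume) (f := F₁) n₁
    have := integral_nonneg (μ := volume) (f := F₂) n₂
    have := integral_nonneg (μ := volume) (f := F₃) n₃
    positivity
  · have j₁ := i₁.const_mul 2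
    have j₂ := (i₂.comp_sub_left x).const_mul 8
    have j₃ := (i₃.comp_sub_left x).const_mul 16
    have j₂₃ : Integrable fun y => 8 * F₂ (x - y) + 16 * F₃ (x - y) := j₂.add j₃
    have j : Integrable fun y => 2 * F₁ y + (8 * F₂ (x - y) + 16 * F₃ (x - y)) := j₁.add j₂₃
    calc _ ≤ ∫⁻ y, ENNReal.ofReal (2 * F₁ y + (8 * F₂ (x - y) + 16 * F₃ (x - y))) :=
          lintegral_mono fun y => ENNReal.ofReal_le_ofReal (rieszPotential_pointwise h₂ h₃ hx y)
      _ = ENNReal.ofReal (∫ y, (2 * F₁ y + (8 * F₂ (x - y) + 16 * F₃ (x - y)))) := by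
          rw [ofReal_integral_eq_lintegral_ofReal j]
          refine Eventually.of_forall fun y => ?_
          have := n₁ y
          have := n₂ (x - y)
          have := n₃ (x - y)
          simp only [Pi.zero_apply]
          positivity
      _ = _ := by
          rw [integral_add j₁ j₂₃, integral_add j₂ j₃, integral_const_mul,
            integral_const_mul, integral_const_mul, integral_sub_left_eq_self F₂ volume x,
            integral_sub_left_eq_self F₃ volume x]

/-- By scaling y ↦ |x|y the bound reduces to the unit sphere; the exponent is 3 - 1 - a. -/
theorem rieszPotential_le {a : ℝ} (h₂ : 2 < a) (h₃ : a < 3) : ∃ C : ℝ, 0 ≤ C ∧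
    ∀ x : E3, x ≠ 0 → ∫⁻ y, ENNReal.ofReal (‖x - y‖⁻¹ * ‖y‖ ^ (-a)) ≤
      ENNReal.ofReal (C * ‖x‖ ^ (2 - a)) := by
  obtain ⟨C, hC, h⟩ := rieszPotential_unit h₂ h₃
  refine ⟨C, hC, fun x hx => ?_⟩
  have hx' : 0 < ‖x‖ := norm_pos_iff.2 hx
  have hm : Measurable fun y : E3 => ENNReal.ofReal (‖x - y‖⁻¹ * ‖y‖ ^ (-a)) := by fun_prop
  have hs : ∫⁻ y, ENNReal.ofReal (‖x - y‖⁻¹ * ‖y‖ ^ (-a)) = ENNReal.ofReal (‖x‖ ^ 3) *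
      ∫⁻ y, ENNReal.ofReal (‖x - ‖x‖ • y‖⁻¹ * ‖‖x‖ • y‖ ^ (-a)) := by
    have h1 := lintegral_map (μ := (volume : Measure E3)) hm (measurable_const_smul ‖x‖)
    rw [← h1, Measure.map_addHaar_smul volume hx'.ne', lintegral_smul_measure, finrank_E3,
      smul_eq_mul, ← mul_assoc, ← ENNReal.ofReal_mul (by positivity), abs_of_pos (by positivity),
      mul_inv_cancel₀ (by positivity)]
    simp
  have he : ∀ y : E3, ‖x - ‖x‖ • y‖⁻¹ * ‖‖x‖ • y‖ ^ (-a) =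
      (‖x‖⁻¹ * ‖x‖ ^ (-a)) * (‖‖x‖⁻¹ • x - y‖⁻¹ * ‖y‖ ^ (-a)) := by
    intro y
    have : x - ‖x‖ • y = ‖x‖ • (‖x‖⁻¹ • x - y) := by
      rw [smul_sub, smul_smul, mul_inv_cancel₀ hx'.ne', one_smul]
    rw [this, norm_smul, norm_smul, norm_norm, mul_inv, Real.mul_rpow hx'.le (norm_nonneg y)]
    ring
  rw [hs]
  simp_rw [he, ENNReal.ofReal_mul (show 0 ≤ ‖x‖⁻¹ * ‖x‖ ^ (-a) by positivity)]
  rw [lintegral_const_mul _ (by fun_prop), ← mul_assoc, ← ENNReal.ofReal_mul (by positivity)]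
  have hfac : ‖x‖ ^ 3 * (‖x‖⁻¹ * ‖x‖ ^ (-a)) = ‖x‖ ^ (2 - a) := by
    rw [← Real.rpow_neg_one, ← Real.rpow_add hx', ← Real.rpow_natCast, ← Real.rpow_add hx']
    congr 1
    push_cast
    ring
  rw [hfac, mul_comm C, ENNReal.ofReal_mul (by positivity)]
  gcongr
  exact h _ (by rw [norm_smul, norm_inv, norm_norm, inv_mul_cancel₀ hx'.ne'])

/-- The bounded operator `N` between weighted spaces is the convolution with `k`. -/
def IsConv (k : E3 → ℂ) {s r : ℝ} (N : WSob 0 s →L[ℂ] WSob 0 r) : Prop :=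
  ∀ (u : WSob 0 s) (φ : 𝓢(E3, ℂ)),
    Integrable (fun z : E3 × E3 => φ z.1 * (k (z.1 - z.2) * wfun u z.2)) (volume.prod volume) ∧
      toDist (N u) φ = ∫ z, φ z.1 * (k (z.1 - z.2) * wfun u z.2) ∂(volume.prod volume)

/-- Conjugated to L², the convolution has the kernel ⟨x⟩^r k(x - y)⟨y⟩^{-s}, to which Schur's test
applies. -/
theorem exists_isConv {k : E3 → ℂ} (hk : Measurable k) {s r : ℝ}
    {p q : E3 → ℝ} (hp : Measurable p) (hq : Measurable q) (hp₀ : ∀ᵐ x, 0 < p x)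
    (hq₀ : ∀ᵐ x, 0 < q x) {M : ℝ} (hM : 0 ≤ M)
    (h₁ : ∀ᵐ x, ∫⁻ y, ‖weight r x * (k (x - y) * weight (-s) y)‖ₑ * ENNReal.ofReal (q y) ≤
      ENNReal.ofReal M * ENNReal.ofReal (p x))
    (h₂ : ∀ᵐ y, ∫⁻ x, ‖weight r x * (k (x - y) * weight (-s) y)‖ₑ * ENNReal.ofReal (p x) ≤
      ENNReal.ofReal M * ENNReal.ofReal (q y)) :
    ∃ N : WSob 0 s →L[ℂ] WSob 0 r, IsConv k N ∧ ‖N‖ ≤ M := by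
  have hK : Measurable fun z : E3 × E3 => weight r z.1 * (k (z.1 - z.2) * weight (-s) z.2) := by
    have h1 := (continuous_weight r).measurable
    have h2 := (continuous_weight (-s)).measurable
    fun_prop
  obtain ⟨T, hT, h⟩ := exists_schur hK.aestronglyMeasurable hp hq hp₀ hq₀ hM h₁ h₂
  let e₁ : WSob 0 s →L[ℂ] L2 := (wsobEquiv 0 s).toContinuousLinearEquiv
  let e₂ : L2 →L[ℂ] WSob 0 r := (wsobEquiv 0 r).symm.toContinuousLinearEquiv
  refine ⟨e₂ ∘L T ∘L e₁, fun u φ => ?_, ?_⟩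
  · set g : L2 := (SchwartzMap.smulLeftCLM ℂ (weight (-r)) φ).toLp 2 with hg
    have hgc : g =ᵐ[volume] fun x => weight (-r) x * φ x := by
      filter_upwards [(SchwartzMap.smulLeftCLM ℂ (weight (-r)) φ).coeFn_toLp 2 volume] with x hx
      rw [hx, SchwartzMap.smulLeftCLM_apply_apply (hasTemperateGrowth_weight _), smul_eq_mul]
    obtain ⟨hi, he⟩ := h (e₁ u) g
    have hae : (fun z : E3 × E3 => g z.1 * (weight r z.1 * (k (z.1 - z.2) * weight (-s) z.2) *
        e₁ u z.2)) =ᵐ[volume.prod volume] fun z => φ z.1 * (k (z.1 - z.2) * wfun u z.2) := by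
      filter_upwards [Measure.quasiMeasurePreserving_fst.ae hgc] with z hz
      have h1 : weight (-r) z.1 * weight r z.1 = 1 := congrFun (weight_mul_neg r) z.1
      rw [hz, wfun]
      change _ = φ z.1 * (k (z.1 - z.2) * (weight (-s) z.2 * e₁ u z.2))
      linear_combination (φ z.1 * (k (z.1 - z.2) * (weight (-s) z.2 * e₁ u z.2))) * h1
    refine ⟨hi.congr hae, ?_⟩
    rw [← integral_congr_ae hae, ← he]
    change toDist ((wsobEquiv 0 r).symm (T (e₁ u))) φ = _
    rw [toDist_wsobEquiv_symm, neg_zero, bessel_zero, (represents_wmul _ φ).2]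
    refine integral_congr_ae ?_
    filter_upwards [hgc] with x hx
    rw [hx]
    ring
  · refine ContinuousLinearMap.opNorm_le_bound _ hM fun u => ?_
    change ‖(wsobEquiv 0 r).symm (T (wsobEquiv 0 s u))‖ ≤ _
    rw [LinearIsometryEquiv.norm_map, ← (wsobEquiv 0 s).norm_map u]
    exact T.le_of_opNorm_le hT _

theorem norm_weight_le_rpow {a : ℝ} (ha : a ≤ 0) {x : E3} (hx : x ≠ 0) :
    ‖weight a x‖ ≤ ‖x‖ ^ a := by
  have hx' : 0 < ‖x‖ := norm_pos_iff.2 hx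
  rw [norm_weight]
  calc (1 + ‖x‖ ^ 2) ^ (a / 2) ≤ (‖x‖ ^ 2) ^ (a / 2) :=
        Real.rpow_le_rpow_of_nonpos (by positivity) (by linarith) (by linarith)
    _ = ‖x‖ ^ a := by
        rw [← Real.rpow_natCast, ← Real.rpow_mul hx'.le]
        congr 1
        push_cast
        ring

theorem ae_ne_zero : ∀ᵐ x : E3, x ≠ 0 := by
  rw [ae_iff]
  simp

/-- One of the two estimates in Schur's test for a kernel with `|k(z)| ≤ M / |z|`. -/
theorem lintegral_weight_inv_le {a : ℝ} (h₂ : 1 / 2 < a) (h₃ : a < 3 / 2) : ∃ C : ℝ, 0 ≤ C ∧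
    ∀ (r s : ℝ), s ≤ -a → r ≤ a - 2 → ∀ (k : E3 → E3 → ℂ) (M : ℝ), 0 ≤ M →
      (∀ x y, ‖k x y‖ ≤ M * ‖x - y‖⁻¹) → ∀ᵐ x,
      ∫⁻ y, ‖weight r x * (k x y * weight s y)‖ₑ * ENNReal.ofReal (‖y‖ ^ (-3 / 2 : ℝ)) ≤
        ENNReal.ofReal (C * M) * ENNReal.ofReal (‖x‖ ^ (-3 / 2 : ℝ)) := by
  -- The weight contributes |y|^{-a} and the Schur function |y|^{-3/2}, so the Riesz potential has
  -- exponent a + 3/2 in (2, 3). It returns |x|^{1/2-a}, and the factor |x|^{a-2} restores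
  -- |x|^{-3/2}.
  obtain ⟨C, hC, h⟩ := rieszPotential_le (a := a + 3 / 2) (by linarith) (by linarith)
  refine ⟨C, hC, fun r s hs hr k M hM hk => ?_⟩
  filter_upwards [ae_ne_zero] with x hx
  have hx' : 0 < ‖x‖ := norm_pos_iff.2 hx
  calc _ ≤ ∫⁻ y, ENNReal.ofReal (‖x‖ ^ (a - 2) * M) *
        ENNReal.ofReal (‖x - y‖⁻¹ * ‖y‖ ^ (-(a + 3 / 2))) := by
        refine lintegral_mono_ae ?_
        filter_upwards [ae_ne_zero] with y hy
        have hy' : 0 < ‖y‖ := norm_pos_iff.2 hy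
        rw [← ofReal_norm, ← ENNReal.ofReal_mul (norm_nonneg _), ← ENNReal.ofReal_mul (by positivity)]
        refine ENNReal.ofReal_le_ofReal ?_
        rw [norm_mul, norm_mul]
        have e₁ := (norm_weight_mono hr x).trans (norm_weight_le_rpow (by linarith) hx)
        have e₂ := (norm_weight_mono hs y).trans (norm_weight_le_rpow (by linarith) hy)
        have e₃ : ‖y‖ ^ (-(a + 3 / 2)) = ‖y‖ ^ (-a) * ‖y‖ ^ (-3 / 2 : ℝ) := by
          rw [← Real.rpow_add hy']
          congr 1
          ring
        calc ‖weight r x‖ * (‖k x y‖ * ‖weight s y‖) * ‖y‖ ^ (-3 / 2 : ℝ)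
            ≤ ‖x‖ ^ (a - 2) * ((M * ‖x - y‖⁻¹) * ‖y‖ ^ (-a)) * ‖y‖ ^ (-3 / 2 : ℝ) := by
              gcongr
              exact hk x y
          _ = _ := by rw [e₃]; ring
    _ ≤ ENNReal.ofReal (‖x‖ ^ (a - 2) * M) * ENNReal.ofReal (C * ‖x‖ ^ (2 - (a + 3 / 2))) := by
        rw [lintegral_const_mul _ (by fun_prop)]
        gcongr
        exact h x hx
    _ = _ := by
        rw [← ENNReal.ofReal_mul (by positivity), ← ENNReal.ofReal_mul (by positivity)]
        congr 1
        have : ‖x‖ ^ (a - 2) * ‖x‖ ^ (2 - (a + 3 / 2)) = ‖x‖ ^ (-3 / 2 : ℝ) := by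
          rw [← Real.rpow_add hx']
          congr 1
          ring
        rw [← this]
        ring

/-- Convolution with a kernel bounded by `M / |z|`. -/
theorem exists_isConv_inv {s r : ℝ} (hs : 1 / 2 < s) (hr : r < -1 / 2) (hsr : 2 ≤ s - r) :
    ∃ C : ℝ, 0 ≤ C ∧ ∀ (k : E3 → ℂ) (M : ℝ), Measurable k → 0 ≤ M →
      (∀ z, ‖k z‖ ≤ M * ‖z‖⁻¹) → ∃ N : WSob 0 s →L[ℂ] WSob 0 r, IsConv k N ∧ ‖N‖ ≤ C * M := by
  -- The two Schur estimates use the parameters a and 2 - a. Both apply exactly when a lies in (1/2,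
  -- 3/2) and r + 2 ≤ a ≤ s; the hypotheses make this intersection nonempty.
  obtain ⟨a, ha₁, ha₂, ha₃, ha₄⟩ : ∃ a : ℝ, 1 / 2 < a ∧ a < 3 / 2 ∧ a ≤ s ∧ r + 2 ≤ a := by
    rcases lt_or_ge (1 / 2) (r + 2) with h | h
    · exact ⟨r + 2, h, by linarith, by linarith, le_rfl⟩
    · exact ⟨min s 1, lt_min hs (by norm_num), (min_le_right _ _).trans_lt (by norm_num),
        min_le_left _ _, le_min (by linarith) (by linarith)⟩
  obtain ⟨C₁, hC₁, h₁⟩ := lintegral_weight_inv_le ha₁ ha₂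
  obtain ⟨C₂, hC₂, h₂⟩ := lintegral_weight_inv_le (a := 2 - a) (by linarith) (by linarith)
  refine ⟨max C₁ C₂, le_max_of_le_left hC₁, fun k M hk hM hkM => ?_⟩
  have hm : Measurable fun x : E3 => ‖x‖ ^ (-3 / 2 : ℝ) := by fun_prop
  have hpos : ∀ᵐ x : E3, 0 < ‖x‖ ^ (-3 / 2 : ℝ) := by
    filter_upwards [ae_ne_zero] with x hx
    have hx' : 0 < ‖x‖ := norm_pos_iff.2 hx
    positivity
  refine exists_isConv hk hm hm hpos hpos (mul_nonneg (le_max_of_le_left hC₁) hM) ?_ ?_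
  · filter_upwards [h₁ r (-s) (by linarith) (by linarith) (fun x y => k (x - y)) M hM
      fun x y => hkM _] with x hx
    refine hx.trans ?_
    gcongr
    exact le_max_left _ _
  · filter_upwards [h₂ (-s) r (by linarith) (by linarith) (fun y x => k (x - y)) M hM
      fun y x => (norm_sub_rev y x).symm ▸ hkM _] with y hy
    refine le_trans (le_of_eq (lintegral_congr fun x => ?_)) (hy.trans ?_)
    · congr 2
      ring
    · gcongr
      exact le_max_right _ _

theorem integrable_norm_weight_sq {a : ℝ} (ha : a < -3 / 2) :
    Integrable fun x : E3 => ‖weight a x‖ * ‖weight a x‖ := by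
  have h := integrable_rpow_neg_one_add_norm_sq (E := E3) (μ := volume) (r := -2 * a)
    (by rw [finrank_E3]; push_cast; linarith)
  refine h.congr (Eventually.of_forall fun x => ?_)
  simp only [norm_weight]
  rw [← Real.rpow_add (by positivity)]
  congr 1
  ring

/-- Convolution with a kernel bounded by `M ⟨x⟩ ^ j ⟨y⟩ ^ j`. -/
theorem exists_isConv_weight {j s r : ℝ} (hs : 3 / 2 + j < s) (hr : r < -3 / 2 - j) :
    ∃ C : ℝ, 0 ≤ C ∧ ∀ (k : E3 → ℂ) (M : ℝ), Measurable k → 0 ≤ M →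
      (∀ x y, ‖k (x - y)‖ ≤ M * (‖weight j x‖ * ‖weight j y‖)) →
      ∃ N : WSob 0 s →L[ℂ] WSob 0 r, IsConv k N ∧ ‖N‖ ≤ C * M := by
  -- The Schur functions ⟨x⟩^{r+j} and ⟨y⟩^{-s+j} are square integrable, their exponents being below
  -- -3/2. The conjugated kernel is dominated by their product.
  have key : ∀ {a b : ℝ}, b + j < -3 / 2 → ∀ (k : E3 → E3 → ℂ) (M : ℝ), 0 ≤ M →
      (∀ x y, ‖k x y‖ ≤ M * (‖weight j x‖ * ‖weight j y‖)) → ∀ x,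
      ∫⁻ y, ‖weight a x * (k x y * weight b y)‖ₑ * ENNReal.ofReal ‖weight (b + j) y‖ ≤
        ENNReal.ofReal ((∫ y, ‖weight (b + j) y‖ * ‖weight (b + j) y‖) * M) *
          ENNReal.ofReal ‖weight (a + j) x‖ := by
    intro a b hb k M hM hk x
    have hi := integrable_norm_weight_sq hb
    calc _ ≤ ∫⁻ y, ENNReal.ofReal (‖weight (a + j) x‖ * M) *
          ENNReal.ofReal (‖weight (b + j) y‖ * ‖weight (b + j) y‖) := by
          refine lintegral_mono fun y => ?_
          rw [← ofReal_norm, ← ENNReal.ofReal_mul (norm_nonneg _),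
            ← ENNReal.ofReal_mul (by positivity)]
          refine ENNReal.ofReal_le_ofReal ?_
          rw [norm_mul, norm_mul]
          calc ‖weight a x‖ * (‖k x y‖ * ‖weight b y‖) * ‖weight (b + j) y‖
              ≤ ‖weight a x‖ * ((M * (‖weight j x‖ * ‖weight j y‖)) * ‖weight b y‖) *
                ‖weight (b + j) y‖ := by
                gcongr
                exact hk x y
            _ = _ := by
                rw [← weight_mul_apply a j, ← weight_mul_apply b j, norm_mul, norm_mul]
                ring
      _ = _ := by
          rw [lintegral_const_mul' _ _ ENNReal.ofReal_ne_top, ← ofReal_integral_eq_lintegral_ofReal hi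
            (Eventually.of_forall fun y => by positivity), ← ENNReal.ofReal_mul (by positivity),
            ← ENNReal.ofReal_mul (mul_nonneg (integral_nonneg fun y => by positivity) hM)]
          congr 1
          ring
  set c₁ := ∫ y : E3, ‖weight (-s + j) y‖ * ‖weight (-s + j) y‖
  set c₂ := ∫ y : E3, ‖weight (r + j) y‖ * ‖weight (r + j) y‖
  have hc₁ : 0 ≤ c₁ := integral_nonneg fun y => by positivity
  refine ⟨max c₁ c₂, le_max_of_le_left hc₁, fun k M hk hM hkM => ?_⟩
  refine exists_isConv hk (p := fun x => ‖weight (r + j) x‖) (q := fun x => ‖weight (-s + j) x‖)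
    (continuous_weight _).norm.measurable (continuous_weight _).norm.measurable
    (Eventually.of_forall fun x => norm_pos_iff.2 (weight_ne_zero _ x))
    (Eventually.of_forall fun x => norm_pos_iff.2 (weight_ne_zero _ x))
    (mul_nonneg (le_max_of_le_left hc₁) hM) (Eventually.of_forall fun x => ?_)
    (Eventually.of_forall fun y => ?_)
  · refine (key (by linarith) (fun x y => k (x - y)) M hM hkM x).trans ?_
    gcongr
    exact le_max_left _ _
  · refine le_trans (le_of_eq (lintegral_congr fun x => ?_)) ((key (a := -s) (b := r) (by linarith)
      (fun y x => k (x - y)) M hM (fun y x => ?_) y).trans ?_)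
    · congr 2
      ring
    · rw [mul_comm ‖weight j y‖]
      exact hkM x y
    · gcongr
      exact le_max_right _ _

end Convolution

/-! ### The fundamental solution of `κ² - Δ` -/

section FundamentalSolution

theorem integral_mul_lineDeriv {f f' : E3 → ℂ} {v : E3} (hf : ∀ x, HasLineDerivAt ℝ f (f' x) x v)
    (hc : Continuous f) (hc' : Continuous f') {C C' : ℝ} (hC : ∀ x, ‖f x‖ ≤ C)
    (hC' : ∀ x, ‖f' x‖ ≤ C') (φ : 𝓢(E3, ℂ)) :
    ∫ x, f x * (∂_{v} φ : 𝓢(E3, ℂ)) x = -∫ x, f' x * φ x := by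
  refine integral_bilinear_hasLineDerivAt_right_eq_neg_left_of_integrable
    (B := ContinuousLinearMap.mul ℝ ℂ) ?_ ?_ ?_ (fun x _ => hf x) fun x _ => ?_
  · exact φ.integrable.bdd_mul hc'.aestronglyMeasurable (Eventually.of_forall hC')
  · exact (∂_{v} φ : 𝓢(E3, ℂ)).integrable.bdd_mul hc.aestronglyMeasurable (Eventually.of_forall hC)
  · exact φ.integrable.bdd_mul hc.aestronglyMeasurable (Eventually.of_forall hC)
  · rw [SchwartzMap.lineDerivOp_apply_eq_fderiv]
    exact φ.differentiableAt.hasFDerivAt.hasLineDerivAt v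

/-- The regularized distance to the origin. -/
def regNorm (ε : ℝ) (x : E3) : ℝ := √(‖x‖ ^ 2 + ε ^ 2)

theorem regNorm_sq (ε : ℝ) (x : E3) : regNorm ε x ^ 2 = ‖x‖ ^ 2 + ε ^ 2 :=
  Real.sq_sqrt (by positivity)

theorem regNorm_nonneg (ε : ℝ) (x : E3) : 0 ≤ regNorm ε x := Real.sqrt_nonneg _

theorem norm_le_regNorm (ε : ℝ) (x : E3) : ‖x‖ ≤ regNorm ε x :=
  Real.le_sqrt_of_sq_le (by nlinarith [sq_nonneg ε])

theorem le_regNorm (ε : ℝ) (x : E3) : ε ≤ regNorm ε x :=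
  Real.le_sqrt_of_sq_le (by nlinarith [sq_nonneg ‖x‖])

theorem continuous_regNorm (ε : ℝ) : Continuous (regNorm ε) := by
  unfold regNorm
  fun_prop

theorem hasLineDerivAt_regNorm {ε : ℝ} (hε : 0 < ε) (x : E3) (j : Fin 3) :
    HasLineDerivAt ℝ (regNorm ε) (x j * (regNorm ε x)⁻¹) x (basisVec j) := by
  have h₁ : HasFDerivAt (fun y : E3 => ‖y‖ ^ 2 + ε ^ 2) (2 • (innerSL ℝ x)) x :=
    ((hasStrictFDerivAt_norm_sq x).hasFDerivAt).add_const _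
  have hx : (‖x‖ ^ 2 + ε ^ 2 : ℝ) ≠ 0 := by positivity
  convert! (h₁.sqrt hx).hasLineDerivAt (basisVec j) using 1
  simp only [_root_.smul_apply, innerSL_apply_apply, inner_basisVec, smul_eq_mul, regNorm]
  field_simp
  ring

theorem hasLineDerivAt_comp_regNorm {ε : ℝ} (hε : 0 < ε) {g : ℝ → ℂ} {g' : ℂ} (x : E3) (j : Fin 3)
    (hg : HasDerivAt g g' (regNorm ε x)) :
    HasLineDerivAt ℝ (fun y => g (regNorm ε y)) (x j * (regNorm ε x : ℂ)⁻¹ * g') x (basisVec j) := by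
  have h₁ := hasLineDerivAt_regNorm hε x j
  unfold HasLineDerivAt at h₁ ⊢
  have h₂ : HasDerivAt g g' (regNorm ε (x + (0 : ℝ) • basisVec j)) := by simpa using hg
  convert! h₂.scomp (0 : ℝ) h₁ using 1
  rw [Complex.real_smul]
  push_cast
  ring

theorem hasLineDerivAt_coord (x : E3) (j : Fin 3) :
    HasLineDerivAt ℝ (fun y : E3 => ((y j : ℝ) : ℂ)) 1 x (basisVec j) := by
  unfold HasLineDerivAt
  have : (fun t : ℝ => (((x + t • basisVec j : E3) j : ℝ) : ℂ)) = fun t : ℝ => (x j : ℂ) + t := by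
    funext t
    simp
  rw [this]
  exact (hasDerivAt_id (0 : ℝ)).ofReal_comp.const_add _

variable (κ : ℂ)

theorem hasDerivAt_yukawa {t : ℝ} (ht : t ≠ 0) :
    HasDerivAt (fun t : ℝ => Complex.exp (-(κ * t)) * (t : ℂ)⁻¹)
      (-Complex.exp (-(κ * t)) * (κ * (t : ℂ)⁻¹ + ((t : ℂ)⁻¹) ^ 2)) t := by
  have ht' : (t : ℂ) ≠ 0 := by exact_mod_cast ht
  have h₁ : HasDerivAt (fun z : ℂ => Complex.exp (-(κ * z)) * z⁻¹)
      (Complex.exp (-(κ * t)) * (-(κ * 1)) * (t : ℂ)⁻¹ +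
        Complex.exp (-(κ * t)) * (-((t : ℂ) ^ 2)⁻¹)) (t : ℂ) :=
    ((((hasDerivAt_id (t : ℂ)).const_mul κ).neg).cexp).mul (hasDerivAt_inv ht')
  convert! h₁.comp_ofReal using 1
  field_simp
  ring

theorem hasDerivAt_yukawa' {t : ℝ} (ht : t ≠ 0) :
    HasDerivAt (fun t : ℝ => -Complex.exp (-(κ * t)) * (κ * ((t : ℂ)⁻¹) ^ 2 + ((t : ℂ)⁻¹) ^ 3))
      (Complex.exp (-(κ * t)) * (κ ^ 2 * ((t : ℂ)⁻¹) ^ 2 + 3 * κ * ((t : ℂ)⁻¹) ^ 3 +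
        3 * ((t : ℂ)⁻¹) ^ 4)) t := by
  have ht' : (t : ℂ) ≠ 0 := by exact_mod_cast ht
  have hi := hasDerivAt_inv ht'
  have h₁ : HasDerivAt (fun z : ℂ => -Complex.exp (-(κ * z)) * (κ * (z⁻¹) ^ 2 + (z⁻¹) ^ 3)) _
      (t : ℂ) :=
    ((((hasDerivAt_id (t : ℂ)).const_mul κ).neg).cexp.neg).mul
      (((hi.pow 2).const_mul κ).add (hi.pow 3))
  convert! h₁.comp_ofReal using 1
  simp
  field_simp
  ring

variable {κ}

theorem norm_exp_le_one (hκ : 0 ≤ κ.re) {t : ℝ} (ht : 0 ≤ t) : ‖Complex.exp (-(κ * t))‖ ≤ 1 := by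
  rw [Complex.norm_exp, Real.exp_le_one_iff]
  simp only [Complex.neg_re, Complex.re_mul_ofReal]
  nlinarith

/-- Replacing |x| by ρ = (|x|² + ε²)^{1/2} makes exp(-κρ)/ρ and the derivatives that occur bounded
and continuous, so two integrations by parts are allowed. Away from the origin exp(-κ|x|)/|x| solves
the Helmholtz equation, and the defect created by the regularization is proportional to ε². -/
theorem integral_regularized (hκ : 0 ≤ κ.re) {ε : ℝ} (hε : 0 < ε) (φ : 𝓢(E3, ℂ)) :
    ∫ x, Complex.exp (-(κ * regNorm ε x)) * (regNorm ε x : ℂ)⁻¹ * (κ ^ 2 * φ x - (Δ φ) x) =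
      ∫ x, (ε : ℂ) ^ 2 * (Complex.exp (-(κ * regNorm ε x)) * (κ ^ 2 * ((regNorm ε x : ℂ)⁻¹) ^ 3 +
        3 * κ * ((regNorm ε x : ℂ)⁻¹) ^ 4 + 3 * ((regNorm ε x : ℂ)⁻¹) ^ 5)) * φ x := by
  have hpos : ∀ x, 0 < regNorm ε x := fun x => hε.trans_le (le_regNorm ε x)
  have hinv : ∀ x, ‖(regNorm ε x : ℂ)⁻¹‖ ≤ ε⁻¹ := fun x => by
    rw [norm_inv, Complex.norm_real, Real.norm_of_nonneg (hpos x).le]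
    exact inv_anti₀ hε (le_regNorm ε x)
  have hexp : ∀ x, ‖Complex.exp (-(κ * regNorm ε x))‖ ≤ 1 := fun x =>
    norm_exp_le_one hκ (hpos x).le
  have hcr : Continuous fun x => (regNorm ε x : ℂ) :=
    Complex.continuous_ofReal.comp (continuous_regNorm ε)
  have hci : Continuous fun x => (regNorm ε x : ℂ)⁻¹ :=
    hcr.inv₀ fun x => by exact_mod_cast (hpos x).ne'
  have hxinv : ∀ (x : E3) (j : Fin 3), ‖(x j : ℂ) * (regNorm ε x : ℂ)⁻¹‖ ≤ 1 := fun x j => by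
    rw [norm_mul, norm_inv, Complex.norm_real, Complex.norm_real,
      Real.norm_of_nonneg (hpos x).le, ← div_eq_mul_inv, div_le_one (hpos x)]
    exact (PiLp.norm_apply_le x j).trans (norm_le_regNorm ε x)
  set F : E3 → ℂ := fun x => Complex.exp (-(κ * regNorm ε x)) * (regNorm ε x : ℂ)⁻¹ with hF
  set G : E3 → ℂ := fun x => -Complex.exp (-(κ * regNorm ε x)) *
    (κ * ((regNorm ε x : ℂ)⁻¹) ^ 2 + ((regNorm ε x : ℂ)⁻¹) ^ 3) with hG
  set H : E3 → ℂ := fun x => (regNorm ε x : ℂ)⁻¹ * (Complex.exp (-(κ * regNorm ε x)) *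
    (κ ^ 2 * ((regNorm ε x : ℂ)⁻¹) ^ 2 + 3 * κ * ((regNorm ε x : ℂ)⁻¹) ^ 3 +
      3 * ((regNorm ε x : ℂ)⁻¹) ^ 4)) with hH
  have hFc : Continuous F := by fun_prop
  have hGc : Continuous G := by fun_prop
  have hHc : Continuous H := by fun_prop
  have hF' : ∀ (j : Fin 3) x, HasLineDerivAt ℝ F ((x j : ℂ) * G x) x (basisVec j) := by
    intro j x
    convert! hasLineDerivAt_comp_regNorm hε x j (hasDerivAt_yukawa κ (hpos x).ne') using 1
    simp only [hG]
    ring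
  have hG' : ∀ (j : Fin 3) x, HasLineDerivAt ℝ (fun x : E3 => (x j : ℂ) * G x)
      (G x + (x j : ℂ) ^ 2 * H x) x (basisVec j) := by
    intro j x
    have h₁ := hasLineDerivAt_coord x j
    have h₂ := hasLineDerivAt_comp_regNorm hε x j (hasDerivAt_yukawa' κ (hpos x).ne')
    unfold HasLineDerivAt at h₁ h₂ ⊢
    convert! h₁.mul h₂ using 1
    simp only [zero_smul, add_zero, one_mul, hG, hH]
    ring
  obtain ⟨C₁, hC₁⟩ : ∃ C, ∀ x, ‖F x‖ ≤ C := by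
    refine ⟨1 * ε⁻¹, fun x => ?_⟩
    rw [hF, norm_mul]
    gcongr
    exacts [hexp x, hinv x]
  have hG₁ : ∀ x, ‖G x‖ ≤ 1 * (‖κ‖ * ε⁻¹ ^ 2 + ε⁻¹ ^ 3) := by
    intro x
    rw [hG, norm_mul, norm_neg]
    gcongr
    · exact hexp x
    · refine (norm_add_le _ _).trans ?_
      rw [norm_mul, norm_pow, norm_pow]
      gcongr <;> exact hinv x
  have hC₂ : ∀ (j : Fin 3) (x : E3), ‖(x j : ℂ) * G x‖ ≤ 1 * (1 * (‖κ‖ * ε⁻¹ + ε⁻¹ ^ 2)) := by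
    intro j x
    have : (x j : ℂ) * G x = ((x j : ℂ) * (regNorm ε x : ℂ)⁻¹) *
        (-Complex.exp (-(κ * regNorm ε x)) * (κ * (regNorm ε x : ℂ)⁻¹ + ((regNorm ε x : ℂ)⁻¹) ^ 2)) := by
      simp only [hG]
      ring
    rw [this, norm_mul, norm_mul (-_), norm_neg]
    gcongr
    · exact hxinv x j
    · exact hexp x
    · refine (norm_add_le _ _).trans ?_
      rw [norm_mul, norm_pow]
      gcongr <;> exact hinv x
  have hC₃ : ∀ (j : Fin 3) (x : E3), ‖G x + (x j : ℂ) ^ 2 * H x‖ ≤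
      1 * (‖κ‖ * ε⁻¹ ^ 2 + ε⁻¹ ^ 3) +
        1 ^ 2 * (1 * (‖κ‖ ^ 2 * ε⁻¹ + 3 * ‖κ‖ * ε⁻¹ ^ 2 + 3 * ε⁻¹ ^ 3)) := by
    intro j x
    have : (x j : ℂ) ^ 2 * H x = ((x j : ℂ) * (regNorm ε x : ℂ)⁻¹) ^ 2 *
        (Complex.exp (-(κ * regNorm ε x)) * (κ ^ 2 * (regNorm ε x : ℂ)⁻¹ +
          3 * κ * ((regNorm ε x : ℂ)⁻¹) ^ 2 + 3 * ((regNorm ε x : ℂ)⁻¹) ^ 3)) := by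
      simp only [hH]
      ring
    refine (norm_add_le _ _).trans (add_le_add (hG₁ x) ?_)
    rw [this, norm_mul, norm_mul, norm_pow]
    gcongr
    · exact hxinv x j
    · exact hexp x
    · refine (norm_add₃_le).trans ?_
      simp only [norm_mul, norm_pow, Complex.norm_ofNat]
      gcongr <;> exact hinv x
  have hcoord : ∀ j : Fin 3, Continuous fun x : E3 => (x j : ℂ) := fun j => by fun_prop
  have hGjc : ∀ j : Fin 3, Continuous fun x : E3 => (x j : ℂ) * G x := fun j => (hcoord j).mul hGc
  have hHjc : ∀ j : Fin 3, Continuous fun x : E3 => G x + (x j : ℂ) ^ 2 * H x := fun j =>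
    hGc.add (((hcoord j).pow 2).mul hHc)
  have hj : ∀ j : Fin 3, ∫ x, F x * (∂_{basisVec j} (∂_{basisVec j} φ) : 𝓢(E3, ℂ)) x =
      ∫ x, (G x + (x j : ℂ) ^ 2 * H x) * φ x := by
    intro j
    rw [integral_mul_lineDeriv (hF' j) hFc (hGjc j) hC₁ (hC₂ j),
      integral_mul_lineDeriv (hG' j) (hGjc j) (hHjc j) (hC₂ j) (hC₃ j), neg_neg]
  have hlap : Δ φ = ∑ j, ∂_{basisVec j} (∂_{basisVec j} φ) := by
    rw [SchwartzMap.laplacian_eq_sum (EuclideanSpace.basisFun (Fin 3) ℝ)]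
    simp only [EuclideanSpace.basisFun_apply]
  have hi₁ : ∀ ψ : 𝓢(E3, ℂ), Integrable (fun x => F x * ψ x) volume := fun ψ =>
    ψ.integrable.bdd_mul hFc.aestronglyMeasurable (Eventually.of_forall hC₁)
  have hi₂ : ∀ j : Fin 3, Integrable (fun x : E3 => (G x + (x j : ℂ) ^ 2 * H x) * φ x) volume :=
    fun j => φ.integrable.bdd_mul (hHjc j).aestronglyMeasurable (Eventually.of_forall (hC₃ j))
  have hL : ∫ x, F x * (Δ φ) x = ∫ x, (∑ j, (G x + (x j : ℂ) ^ 2 * H x) * φ x) := by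
    rw [integral_finsetSum _ fun j _ => hi₂ j]
    simp_rw [← hj]
    rw [← integral_finsetSum _ fun j _ => hi₁ _]
    refine integral_congr_ae (Eventually.of_forall fun x => ?_)
    simp only [hlap, _root_.sum_apply, Finset.mul_sum]
  have hK : (∫ x, F x * (κ ^ 2 * φ x)) - ∫ x, F x * (Δ φ) x =
      ∫ x, (F x * (κ ^ 2 * φ x) - ∑ j, (G x + (x j : ℂ) ^ 2 * H x) * φ x) := by
    rw [hL, ← integral_sub]
    · exact ((hi₁ φ).const_mul (κ ^ 2)).congr (Eventually.of_forall fun x => by ring)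
    · exact integrable_finsetSum _ fun j _ => hi₂ j
  have hK' : ∫ x, F x * (κ ^ 2 * φ x - (Δ φ) x) =
      (∫ x, F x * (κ ^ 2 * φ x)) - ∫ x, F x * (Δ φ) x := by
    rw [← integral_sub]
    · simp only [mul_sub]
    · exact ((hi₁ φ).const_mul (κ ^ 2)).congr (Eventually.of_forall fun x => by ring)
    · exact hi₁ _
  change ∫ x, F x * (κ ^ 2 * φ x - (Δ φ) x) = _
  rw [hK', hK]
  refine integral_congr_ae (Eventually.of_forall fun x => ?_)
  -- Replacing |x|² by ρ² - ε² in the Laplacian is the only source of the defect: the ρ² part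
  -- cancels against κ²F.
  have hs : ((x 0 : ℝ) : ℂ) ^ 2 + (x 1 : ℂ) ^ 2 + (x 2 : ℂ) ^ 2 = (regNorm ε x : ℂ) ^ 2 - ε ^ 2 := by
    have h := regNorm_sq ε x
    rw [EuclideanSpace.real_norm_sq_eq, Fin.sum_univ_three] at h
    rw [eq_sub_iff_add_eq]
    exact_mod_cast h.symm
  have hne : (regNorm ε x : ℂ) ≠ 0 := by exact_mod_cast (hpos x).ne'
  simp only [Fin.sum_univ_three]
  have : (G x + ((x 0 : ℝ) : ℂ) ^ 2 * H x) * φ x + (G x + (x 1 : ℂ) ^ 2 * H x) * φ x +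
      (G x + (x 2 : ℂ) ^ 2 * H x) * φ x = (3 * G x + ((regNorm ε x : ℂ) ^ 2 - ε ^ 2) * H x) * φ x := by
    rw [← hs]
    ring
  rw [this]
  simp only [hF, hG, hH]
  field_simp
  ring

end FundamentalSolution

/-! ### Removal of the regularization and the fundamental solution. -/

section FundamentalSolution

theorem SchwartzMap.exists_bound_pow (φ : 𝓢(E3, ℂ)) (n : ℕ) :
    ∃ C, 0 < C ∧ ∀ x, ‖x‖ ^ n * ‖φ x‖ ≤ C := by
  obtain ⟨C, hC, h⟩ := φ.decay n 0
  exact ⟨C, hC, fun x => by simpa using h x⟩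

theorem integrable_inv_norm_mul (φ : 𝓢(E3, ℂ)) : Integrable fun x => ‖x‖⁻¹ * ‖φ x‖ := by
  obtain ⟨C, hC, h⟩ := SchwartzMap.exists_bound_pow φ 0
  have h₁ := ((integrableOn_norm_rpow (b := 1) (by norm_num) 1).integrable_indicator
    measurableSet_ball).const_mul C
  refine (h₁.add φ.integrable.norm).mono' ?_ (Eventually.of_forall fun x => ?_)
  · exact (measurable_norm.inv.aestronglyMeasurable).mul φ.continuous.norm.aestronglyMeasurable
  · rw [Real.norm_of_nonneg (by positivity)]
    simp only [Pi.add_apply]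
    by_cases hx : x ∈ Metric.ball (0 : E3) 1
    · rw [Set.indicator_of_mem hx, Real.rpow_neg_one, mul_comm]
      have := mul_le_mul_of_nonneg_right (h x) (inv_nonneg.2 (norm_nonneg x))
      rw [pow_zero, one_mul] at this
      linarith [norm_nonneg (φ x)]
    · rw [Set.indicator_of_notMem hx, mul_zero, zero_add]
      rw [mem_ball_zero_iff, not_lt] at hx
      exact mul_le_of_le_one_left (norm_nonneg _) (inv_le_one_of_one_le₀ hx)

theorem regNorm_smul {ε : ℝ} (hε : 0 ≤ ε) (y : E3) : regNorm ε (ε • y) = ε * regNorm 1 y := by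
  rw [regNorm, regNorm, norm_smul, Real.norm_of_nonneg hε, one_pow,
    show (ε * ‖y‖) ^ 2 + ε ^ 2 = ε ^ 2 * (‖y‖ ^ 2 + 1) by ring, Real.sqrt_mul (sq_nonneg ε),
    Real.sqrt_sq hε]

theorem regNorm_one_le (y : E3) : regNorm 1 y ≤ 1 + ‖y‖ :=
  Real.sqrt_le_iff.2 ⟨by positivity, by nlinarith [norm_nonneg y]⟩

theorem regNorm_zero (x : E3) : regNorm 0 x = ‖x‖ := by
  simp [regNorm, Real.sqrt_sq (norm_nonneg x)]

theorem integrable_regNorm_inv : Integrable fun y : E3 => (regNorm 1 y)⁻¹ ^ 4 := by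
  have h := integrable_rpow_neg_one_add_norm_sq (E := E3) (μ := volume) (r := 4)
    (by rw [finrank_E3]; norm_num)
  refine h.congr (Eventually.of_forall fun y => ?_)
  have : (regNorm 1 y)⁻¹ ^ 4 = (((regNorm 1 y) ^ 2) ^ 2)⁻¹ := by
    rw [← pow_mul, inv_pow]
  simp only [this, regNorm_sq]
  rw [show (-4 / 2 : ℝ) = -((2 : ℕ) : ℝ) by norm_num, Real.rpow_neg (by positivity),
    Real.rpow_natCast]
  congr 2
  ring

/-- The total mass of the approximate identity 3ε²ρ⁻⁵, computed in polar coordinates. It explains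
the normalization by 4π. -/
theorem integral_regNorm_inv : ∫ y : E3, 3 * (regNorm 1 y)⁻¹ ^ 5 = 4 * Real.pi := by
  have h₁ := integral_fun_norm_addHaar (E := E3) volume (fun t : ℝ => 3 * (√(t ^ 2 + 1 ^ 2))⁻¹ ^ 5)
  have h₂ : ∫ t in Set.Ioi (0 : ℝ), 3 * t ^ 2 * (√(t ^ 2 + 1))⁻¹ ^ 5 = 1 - 0 := by
    have hs : ∀ t : ℝ, 0 < √(t ^ 2 + 1) := fun t => Real.sqrt_pos.2 (by positivity)
    have hsq : ∀ t : ℝ, √(t ^ 2 + 1) ^ 2 = t ^ 2 + 1 := fun t => Real.sq_sqrt (by positivity)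
    -- The radial integrand has the explicit primitive (t/√(t² + 1))³, which rises from 0 to 1.
    have hd : ∀ t : ℝ, HasDerivAt (fun t : ℝ => (t * (√(t ^ 2 + 1))⁻¹) ^ 3)
        (3 * t ^ 2 * (√(t ^ 2 + 1))⁻¹ ^ 5) t := by
      intro t
      have e₀ : HasDerivAt (fun t : ℝ => t ^ 2 + 1) (2 * t) t := by
        simpa using (hasDerivAt_pow 2 t).add_const 1
      have e₁ : HasDerivAt (fun t : ℝ => √(t ^ 2 + 1)) (2 * t / (2 * √(t ^ 2 + 1))) t :=
        e₀.sqrt (by positivity)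
      have e₂ : HasDerivAt (fun t : ℝ => (t * (√(t ^ 2 + 1))⁻¹) ^ 3) (((3 : ℕ) : ℝ) *
          (t * (√(t ^ 2 + 1))⁻¹) ^ (3 - 1) * (1 * (√(t ^ 2 + 1))⁻¹ +
            t * (-(2 * t / (2 * √(t ^ 2 + 1))) / √(t ^ 2 + 1) ^ 2))) t :=
        ((hasDerivAt_id' t).mul (e₁.inv (hs t).ne')).pow 3
      convert! e₂ using 1
      have h0 := (hs t).ne'
      have h1 := hsq t
      generalize √(t ^ 2 + 1) = r at h0 h1
      have : 1 * r⁻¹ + t * (-(2 * t / (2 * r)) / r ^ 2) = r⁻¹ ^ 3 := by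
        field_simp
        linear_combination h1
      rw [this]
      push_cast
      ring
    have ht : Tendsto (fun t : ℝ => (t * (√(t ^ 2 + 1))⁻¹) ^ 3) atTop (𝓝 1) := by
      have e₁ : Tendsto (fun t : ℝ => ((√(1 + (t⁻¹) ^ 2))⁻¹) ^ 3) atTop (𝓝 1) := by
        have : Tendsto (fun t : ℝ => ((√(1 + (t⁻¹) ^ 2))⁻¹) ^ 3) atTop
            (𝓝 (((√(1 + (0 : ℝ) ^ 2))⁻¹) ^ 3)) :=
          (((((tendsto_inv_atTop_zero.pow 2).const_add 1).sqrt).inv₀ (by simp)).pow 3)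
        simpa using this
      refine e₁.congr' ?_
      filter_upwards [eventually_gt_atTop 0] with t ht
      congr 1
      rw [show t ^ 2 + 1 = t ^ 2 * (1 + (t⁻¹) ^ 2) by field_simp, Real.sqrt_mul (sq_nonneg t),
        Real.sqrt_sq ht.le, mul_inv, ← mul_assoc, mul_inv_cancel₀ ht.ne', one_mul]
    have := integral_Ioi_of_hasDerivAt_of_nonneg (a := 0) (hd 0).continuousAt.continuousWithinAt
      (fun t _ => hd t) (fun t _ => by positivity) ht
    simpa using this
  have h₃ : volume.real (Metric.ball (0 : E3) 1) = 4 * Real.pi / 3 := by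
    rw [Measure.real, EuclideanSpace.volume_ball_fin_three]
    rw [ENNReal.ofReal_one, one_pow, one_mul, ENNReal.toReal_ofReal (by positivity)]
    ring
  have h₄ : ∀ y : E3, 3 * (regNorm 1 y)⁻¹ ^ 5 = 3 * (√(‖y‖ ^ 2 + 1 ^ 2))⁻¹ ^ 5 := fun y => rfl
  simp_rw [h₄]
  rw [h₁, h₃, finrank_E3]
  have h₅ : ∫ t in Set.Ioi (0 : ℝ), t ^ (3 - 1) • (3 * (√(t ^ 2 + 1 ^ 2))⁻¹ ^ 5) = 1 := by
    rw [sub_zero] at h₂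
    refine Eq.trans (integral_congr_ae (Eventually.of_forall fun t => ?_)) h₂
    simp only [smul_eq_mul, one_pow]
    ring
  rw [h₅]
  simp
  ring

variable {κ : ℂ}

theorem tendsto_regularized_left (hκ : 0 ≤ κ.re) (φ : 𝓢(E3, ℂ)) :
    Tendsto (fun ε : ℝ => ∫ x, Complex.exp (-(κ * regNorm ε x)) * (regNorm ε x : ℂ)⁻¹ * φ x)
      (𝓝[>] 0) (𝓝 (∫ x, Complex.exp (-(κ * (‖x‖ : ℝ))) * ((‖x‖ : ℝ) : ℂ)⁻¹ * φ x)) := by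
  refine tendsto_integral_filter_of_dominated_convergence (fun x => ‖x‖⁻¹ * ‖φ x‖) ?_ ?_
    (integrable_inv_norm_mul φ) ?_
  · refine Eventually.of_forall fun ε => ?_
    have h := (continuous_regNorm ε).measurable
    have h' := φ.continuous.measurable
    exact Measurable.aestronglyMeasurable (by fun_prop)
  · refine Eventually.of_forall fun ε => ?_
    filter_upwards [ae_ne_zero] with x hx
    rw [norm_mul, norm_mul, norm_inv, Complex.norm_real, Real.norm_of_nonneg (regNorm_nonneg ε x)]
    gcongr
    have hx' : 0 < ‖x‖ := norm_pos_iff.2 hx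
    calc _ ≤ 1 * ‖x‖⁻¹ := mul_le_mul (norm_exp_le_one hκ (regNorm_nonneg ε x))
          (inv_anti₀ hx' (norm_le_regNorm ε x)) (inv_nonneg.2 (regNorm_nonneg ε x)) zero_le_one
      _ = _ := one_mul _
  · filter_upwards [ae_ne_zero] with x hx
    have h₁ : Tendsto (fun ε : ℝ => regNorm ε x) (𝓝[>] 0) (𝓝 ‖x‖) := by
      have : Continuous fun ε : ℝ => regNorm ε x := by unfold regNorm; fun_prop
      have h := this.tendsto 0
      rw [regNorm_zero] at h
      exact h.mono_left nhdsWithin_le_nhds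
    have h₂ := (Complex.continuous_ofReal.tendsto _).comp h₁
    have hx' : ((‖x‖ : ℝ) : ℂ) ≠ 0 := by exact_mod_cast (norm_pos_iff.2 hx).ne'
    exact (((h₂.const_mul κ).neg.cexp).mul (h₂.inv₀ hx')).mul_const _

/-- After the substitution x = εy the terms containing κ keep positive powers of ε and vanish in the
limit; the remaining term is an approximate identity of mass 4π. -/
theorem tendsto_regularized_right (hκ : 0 ≤ κ.re) (φ : 𝓢(E3, ℂ)) :
    Tendsto (fun ε : ℝ => ∫ x, (ε : ℂ) ^ 2 * (Complex.exp (-(κ * regNorm ε x)) *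
      (κ ^ 2 * ((regNorm ε x : ℂ)⁻¹) ^ 3 + 3 * κ * ((regNorm ε x : ℂ)⁻¹) ^ 4 +
        3 * ((regNorm ε x : ℂ)⁻¹) ^ 5)) * φ x) (𝓝[>] 0) (𝓝 (4 * Real.pi * φ 0)) := by
  have hsub : ∀ ε : ℝ, 0 < ε → ∫ x, (ε : ℂ) ^ 2 * (Complex.exp (-(κ * regNorm ε x)) *
      (κ ^ 2 * ((regNorm ε x : ℂ)⁻¹) ^ 3 + 3 * κ * ((regNorm ε x : ℂ)⁻¹) ^ 4 +
        3 * ((regNorm ε x : ℂ)⁻¹) ^ 5)) * φ x =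
      ∫ y, Complex.exp (-(κ * (ε * regNorm 1 y))) * (ε ^ 2 * κ ^ 2 * ((regNorm 1 y : ℂ)⁻¹) ^ 3 +
        3 * ε * κ * ((regNorm 1 y : ℂ)⁻¹) ^ 4 + 3 * ((regNorm 1 y : ℂ)⁻¹) ^ 5) * φ (ε • y) := by
    intro ε hε
    have h := Measure.integral_comp_smul_of_nonneg volume (fun x : E3 => (ε : ℂ) ^ 2 *
      (Complex.exp (-(κ * regNorm ε x)) *
      (κ ^ 2 * ((regNorm ε x : ℂ)⁻¹) ^ 3 + 3 * κ * ((regNorm ε x : ℂ)⁻¹) ^ 4 +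
        3 * ((regNorm ε x : ℂ)⁻¹) ^ 5)) * φ x) ε (hR := hε.le)
    rw [finrank_E3, eq_inv_smul_iff₀ (by positivity)] at h
    rw [← h, ← integral_smul]
    refine integral_congr_ae (Eventually.of_forall fun y => ?_)
    have hε' : (ε : ℂ) ≠ 0 := by exact_mod_cast hε.ne'
    have hJ : (regNorm 1 y : ℂ) ≠ 0 := by
      exact_mod_cast (one_pos.trans_le (le_regNorm 1 y)).ne'
    simp only [regNorm_smul hε.le, Complex.real_smul, Complex.ofReal_mul, Complex.ofReal_pow]
    field_simp
  obtain ⟨C₀, hC₀, h₀⟩ := SchwartzMap.exists_bound_pow φ 0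
  obtain ⟨C₁, hC₁, h₁⟩ := SchwartzMap.exists_bound_pow φ 1
  simp only [pow_zero, one_mul, pow_one] at h₀ h₁
  have hlim : (4 * Real.pi * φ 0 : ℂ) = ∫ y : E3, 3 * ((regNorm 1 y : ℂ)⁻¹) ^ 5 * φ 0 := by
    rw [integral_mul_const]
    congr 1
    have := congrArg (fun z : ℝ => (z : ℂ)) integral_regNorm_inv
    simp only [← integral_complex_ofReal] at this
    push_cast at this
    exact this.symm
  rw [hlim]
  refine Tendsto.congr' (f₁ := fun ε : ℝ => ∫ y, Complex.exp (-(κ * (ε * regNorm 1 y))) *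
    (ε ^ 2 * κ ^ 2 * ((regNorm 1 y : ℂ)⁻¹) ^ 3 + 3 * ε * κ * ((regNorm 1 y : ℂ)⁻¹) ^ 4 +
      3 * ((regNorm 1 y : ℂ)⁻¹) ^ 5) * φ (ε • y)) ?_ ?_
  · filter_upwards [self_mem_nhdsWithin] with ε hε
    exact (hsub ε hε).symm
  refine tendsto_integral_filter_of_dominated_convergence
    (fun y => (‖κ‖ ^ 2 * (C₀ + C₁) + 3 * ‖κ‖ * C₀ + 3 * C₀) * (regNorm 1 y)⁻¹ ^ 4) ?_ ?_
    (integrable_regNorm_inv.const_mul _) ?_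
  · refine Eventually.of_forall fun ε => ?_
    have h := (continuous_regNorm 1).measurable
    have h' := φ.continuous.measurable
    exact Measurable.aestronglyMeasurable (by fun_prop)
  · filter_upwards [self_mem_nhdsWithin, nhdsWithin_le_nhds (Iic_mem_nhds (zero_lt_one' ℝ))]
      with ε hε hε₁
    rw [Set.mem_Ioi] at hε
    rw [Set.mem_Iic] at hε₁
    refine Eventually.of_forall fun y => ?_
    set J := regNorm 1 y with hJ
    have hJ1 : 1 ≤ J := le_regNorm 1 y
    have hJ0 : 0 < J := one_pos.trans_le hJ1
    -- The κ² term decays only like J⁻³, which is not integrable on three-space. One of its factors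
    -- ε, together with the decay of φ, buys the missing power of J.
    have hφ : ε * J * ‖φ (ε • y)‖ ≤ C₀ + C₁ := by
      have e₁ := h₁ (ε • y)
      rw [norm_smul, Real.norm_of_nonneg hε.le] at e₁
      calc ε * J * ‖φ (ε • y)‖ ≤ ε * (1 + ‖y‖) * ‖φ (ε • y)‖ := by
            gcongr
            exact regNorm_one_le y
        _ = ε * ‖φ (ε • y)‖ + ε * ‖y‖ * ‖φ (ε • y)‖ := by ring
        _ ≤ 1 * C₀ + C₁ := by
            gcongr
            exact h₀ _
        _ = _ := by ring
    have hE : ‖Complex.exp (-(κ * (ε * J)))‖ ≤ 1 := by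
      have := norm_exp_le_one hκ (mul_nonneg hε.le hJ0.le)
      rwa [Complex.ofReal_mul] at this
    have hJi : J⁻¹ ^ 5 ≤ J⁻¹ ^ 4 := by
      refine pow_le_pow_of_le_one (by positivity) (inv_le_one_of_one_le₀ hJ1) (by norm_num)
    calc _ ≤ 1 * (ε ^ 2 * ‖κ‖ ^ 2 * J⁻¹ ^ 3 + 3 * ε * ‖κ‖ * J⁻¹ ^ 4 + 3 * J⁻¹ ^ 5) *
          ‖φ (ε • y)‖ := by
          rw [norm_mul, norm_mul]
          gcongr
          refine norm_add₃_le.trans (le_of_eq ?_)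
          simp only [norm_mul, norm_pow, Complex.norm_ofNat, norm_inv, Complex.norm_real,
            Real.norm_of_nonneg hε.le, Real.norm_of_nonneg hJ0.le]
      _ = ε * ‖κ‖ ^ 2 * (ε * J * ‖φ (ε • y)‖) * J⁻¹ ^ 4 + 3 * ε * ‖κ‖ * ‖φ (ε • y)‖ * J⁻¹ ^ 4 +
          3 * ‖φ (ε • y)‖ * J⁻¹ ^ 5 := by
          field_simp
      _ ≤ 1 * ‖κ‖ ^ 2 * (C₀ + C₁) * J⁻¹ ^ 4 + 3 * 1 * ‖κ‖ * C₀ * J⁻¹ ^ 4 +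
          3 * C₀ * J⁻¹ ^ 4 := by
          gcongr
          · exact h₀ _
          · exact h₀ _
      _ = _ := by ring
  · refine Eventually.of_forall fun y => ?_
    have hc : Continuous fun ε : ℝ => Complex.exp (-(κ * (ε * regNorm 1 y))) *
        (ε ^ 2 * κ ^ 2 * ((regNorm 1 y : ℂ)⁻¹) ^ 3 + 3 * ε * κ * ((regNorm 1 y : ℂ)⁻¹) ^ 4 +
          3 * ((regNorm 1 y : ℂ)⁻¹) ^ 5) * φ (ε • y) := by
      have := φ.continuous
      fun_prop
    have h := (hc.tendsto 0).mono_left (nhdsWithin_le_nhds (s := Set.Ioi 0))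
    simpa using h

/-- The fundamental solution `exp(-κ|z|) / (4π|z|)` of `κ² - Δ`. -/
def yukawa (κ : ℂ) (z : E3) : ℂ :=
  (4 * Real.pi : ℂ)⁻¹ * (Complex.exp (-(κ * (‖z‖ : ℝ))) * ((‖z‖ : ℝ) : ℂ)⁻¹)

theorem measurable_yukawa (κ : ℂ) : Measurable (yukawa κ) := by
  unfold yukawa
  fun_prop

theorem norm_yukawa_le (hκ : 0 ≤ κ.re) (z : E3) : ‖yukawa κ z‖ ≤ (4 * Real.pi)⁻¹ * ‖z‖⁻¹ := by
  rw [yukawa, norm_mul, norm_mul, norm_inv, norm_inv, norm_mul, Complex.norm_real, Complex.norm_real,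
    norm_norm, Complex.norm_ofNat, Real.norm_of_nonneg Real.pi_pos.le]
  gcongr
  exact mul_le_of_le_one_left (by positivity) (norm_exp_le_one hκ (norm_nonneg z))

/-- Both sides of the regularized identity are passed to the limit. The argument includes the
boundary Re κ = 0, in particular κ = 0. -/
theorem integral_yukawa_mul (hκ : 0 ≤ κ.re) (φ : 𝓢(E3, ℂ)) :
    ∫ x, yukawa κ x * (κ ^ 2 * φ x - (Δ φ) x) = φ 0 := by
  have h₁ := tendsto_regularized_left hκ (κ ^ 2 • φ - Δ φ)
  have h₂ := tendsto_regularized_right hκ φ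
  have h₃ : ∀ x, (κ ^ 2 • φ - Δ φ) x = κ ^ 2 * φ x - (Δ φ) x := fun x => rfl
  simp only [h₃] at h₁
  have h₄ := tendsto_nhds_unique (h₁.congr' (by
    filter_upwards [self_mem_nhdsWithin] with ε hε
    exact integral_regularized hκ hε φ)) h₂
  have hp : (4 * Real.pi : ℂ) ≠ 0 := by simp [Real.pi_ne_zero]
  simp only [yukawa, mul_assoc (4 * Real.pi : ℂ)⁻¹]
  rw [integral_const_mul, h₄, ← mul_assoc, inv_mul_cancel₀ hp, one_mul]

/-- Translation of Schwartz functions. -/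
def translate (y : E3) : 𝓢(E3, ℂ) →L[ℂ] 𝓢(E3, ℂ) :=
  SchwartzMap.compCLM ℂ (g := fun x => x + y) (by fun_prop) ⟨1, 1 + ‖y‖, fun x => by
    have h := norm_sub_le (x + y) y
    rw [add_sub_cancel_right] at h
    rw [pow_one]
    nlinarith [norm_nonneg y, norm_nonneg (x + y)]⟩

theorem translate_apply (y : E3) (φ : 𝓢(E3, ℂ)) (x : E3) : translate y φ x = φ (x + y) := rfl

theorem lineDeriv_translate (y v : E3) (φ : 𝓢(E3, ℂ)) :
    ∂_{v} (translate y φ) = translate y (∂_{v} φ) := by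
  ext x
  rw [translate_apply, SchwartzMap.lineDerivOp_apply_eq_fderiv,
    SchwartzMap.lineDerivOp_apply_eq_fderiv]
  exact congrArg (fun L : E3 →L[ℝ] ℂ => L v) (fderiv_comp_add_right (𝕜 := ℝ) (f := φ) (x := x) y)

theorem laplacian_translate (y : E3) (φ : 𝓢(E3, ℂ)) : Δ (translate y φ) = translate y (Δ φ) := by
  simp only [SchwartzMap.laplacian_eq_sum (EuclideanSpace.basisFun (Fin 3) ℝ), lineDeriv_translate,
    map_sum]

theorem integral_yukawa_sub_mul (hκ : 0 ≤ κ.re) (φ : 𝓢(E3, ℂ)) (y : E3) :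
    ∫ x, yukawa κ (x - y) * (κ ^ 2 * φ x - (Δ φ) x) = φ y := by
  rw [← integral_add_right_eq_self _ y]
  have h := integral_yukawa_mul hκ (translate y φ)
  simpa only [laplacian_translate, translate_apply, zero_add, add_sub_cancel_right] using h

end FundamentalSolution

/-! ### The free resolvent on tempered distributions -/

section FreeResolvent

theorem sq_mem_slitPlane {κ : ℂ} (hκ : 0 < κ.re) : 0 < (κ ^ 2).re ∨ (κ ^ 2).im ≠ 0 := by
  rw [pow_two, Complex.mul_re, Complex.mul_im]
  by_cases h : κ.im = 0
  · left
    rw [h]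
    nlinarith
  · right
    have := mul_ne_zero hκ.ne' h
    contrapose! this
    linarith

/-- For real c > 0 this is a rescaled ⟨ξ⟩⁻². For c = a + ib with b ≠ 0 and p = a + |ξ|²,
rationalizing gives (p - ib)/(b² + p²), whose denominator is b²⟨p/b⟩². Either way only powers of
Japanese brackets and polynomials occur. -/
theorem hasTemperateGrowth_bounded_inv_add_norm_sq {c : ℂ} (hc : 0 < c.re ∨ c.im ≠ 0) :
    (fun ξ : E3 => (c + ((‖ξ‖ ^ 2 : ℝ) : ℂ))⁻¹).HasTemperateGrowth ∧
      ∃ C : ℝ, 0 ≤ C ∧ ∀ ξ : E3, ‖(c + ((‖ξ‖ ^ 2 : ℝ) : ℂ))⁻¹‖ ≤ C := by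
  by_cases hb : c.im = 0
  · have ha : 0 < c.re := hc.resolve_right (not_not.2 hb)
    have hce : c = (c.re : ℂ) := Complex.ext rfl (by simp [hb])
    have key : ∀ ξ : E3, (c + ((‖ξ‖ ^ 2 : ℝ) : ℂ))⁻¹ =
        (c.re : ℂ)⁻¹ * weight (-2) (((√c.re)⁻¹ • ContinuousLinearMap.id ℝ E3) ξ) := by
      intro ξ
      have e : 1 + ‖((√c.re)⁻¹ • ContinuousLinearMap.id ℝ E3) ξ‖ ^ 2 = (c.re + ‖ξ‖ ^ 2) / c.re := by
        have : ((√c.re)⁻¹ • ContinuousLinearMap.id ℝ E3) ξ = (√c.re)⁻¹ • ξ := rfl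
        rw [this, norm_smul, mul_pow, norm_inv, inv_pow, Real.norm_of_nonneg (Real.sqrt_nonneg _),
          Real.sq_sqrt ha.le]
        field_simp
      rw [weight, e, show (-2 / 2 : ℝ) = -1 by norm_num, Real.rpow_neg_one]
      rw [hce]
      push_cast
      have h1 : (c.re : ℂ) ≠ 0 := by exact_mod_cast ha.ne'
      simp only [Complex.ofReal_re]
      rw [inv_div, mul_div_assoc', inv_mul_cancel₀ h1, one_div]
    refine ⟨?_, c.re⁻¹, by positivity, fun ξ => ?_⟩
    · simp_rw [key]
      have h1 : (fun ξ : E3 => weight (-2) (((√c.re)⁻¹ • ContinuousLinearMap.id ℝ E3) ξ)).HasTemperateGrowth :=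
        (hasTemperateGrowth_weight (-2)).comp (ContinuousLinearMap.hasTemperateGrowth _)
      exact (Function.HasTemperateGrowth.const (c.re : ℂ)⁻¹).mul h1
    · rw [key, norm_mul, norm_inv, Complex.norm_real, Real.norm_of_nonneg ha.le]
      exact mul_le_of_le_one_right (by positivity) (norm_weight_le_one (by norm_num) _)
  · set a := c.re
    set b := c.im
    have key : ∀ ξ : E3, (c + ((‖ξ‖ ^ 2 : ℝ) : ℂ))⁻¹ =
        (((b ^ 2)⁻¹ * (1 + ‖(a + ‖ξ‖ ^ 2) * b⁻¹‖ ^ 2) ^ (-1 : ℝ) : ℝ) : ℂ) *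
          (((a + ‖ξ‖ ^ 2 : ℝ) : ℂ) - (b : ℂ) * Complex.I) := by
      intro ξ
      have hc' : c + ((‖ξ‖ ^ 2 : ℝ) : ℂ) = ((a + ‖ξ‖ ^ 2 : ℝ) : ℂ) + (b : ℂ) * Complex.I := by
        conv_lhs => rw [← Complex.re_add_im c]
        push_cast
        ring
      have hb2 : 0 < b ^ 2 := by positivity
      have e : (b ^ 2)⁻¹ * (1 + ‖(a + ‖ξ‖ ^ 2) * b⁻¹‖ ^ 2) ^ (-1 : ℝ) =
          (b ^ 2 + (a + ‖ξ‖ ^ 2) ^ 2)⁻¹ := by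
        rw [Real.rpow_neg_one, ← mul_inv, Real.norm_eq_abs, sq_abs]
        congr 1
        field_simp
      rw [hc', e]
      set p := a + ‖ξ‖ ^ 2
      have hp : ((b ^ 2 + p ^ 2 : ℝ) : ℂ) = ((p : ℂ) + b * Complex.I) * (p - b * Complex.I) := by
        push_cast
        linear_combination (b : ℂ) ^ 2 * Complex.I_sq
      have hp0 : ((b ^ 2 + p ^ 2 : ℝ) : ℂ) ≠ 0 := by
        have : 0 < b ^ 2 + p ^ 2 := by positivity
        exact_mod_cast this.ne'
      have h2 : ((p : ℂ) - b * Complex.I) ≠ 0 := fun h => hp0 (by rw [hp, h, mul_zero])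
      rw [Complex.ofReal_inv, hp, mul_inv, mul_assoc, inv_mul_cancel₀ h2, mul_one]
    refine ⟨?_, |b|⁻¹, by positivity, fun ξ => ?_⟩
    · simp_rw [key]
      have h1 : (fun ξ : E3 => (a + ‖ξ‖ ^ 2) * b⁻¹).HasTemperateGrowth := by fun_prop
      have h2 : (fun ξ : E3 => (1 + ‖(a + ‖ξ‖ ^ 2) * b⁻¹‖ ^ 2) ^ (-1 : ℝ)).HasTemperateGrowth :=
        (Function.hasTemperateGrowth_one_add_norm_sq_rpow ℝ (-1)).comp h1
      have h3 : (fun ξ : E3 => a + ‖ξ‖ ^ 2).HasTemperateGrowth := by fun_prop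
      have h4 : ∀ {f : E3 → ℝ}, f.HasTemperateGrowth → (fun ξ => (f ξ : ℂ)).HasTemperateGrowth :=
        fun hf => (ContinuousLinearMap.hasTemperateGrowth Complex.ofRealCLM).comp hf
      exact (h4 ((Function.HasTemperateGrowth.const (b ^ 2)⁻¹).mul h2)).mul
        ((h4 h3).sub (Function.HasTemperateGrowth.const _))
    · rw [norm_inv]
      refine inv_anti₀ (abs_pos.2 hb) ((le_of_eq ?_).trans (Complex.abs_im_le_norm _))
      simp only [Complex.add_im, Complex.ofReal_im, add_zero]
      rfl

/-- The symbol of `(-Δ + κ²)⁻¹`. -/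
def helmholtzSymbol (κ : ℂ) (ξ : E3) : ℂ := (κ ^ 2 + ((‖(2 * Real.pi) • ξ‖ ^ 2 : ℝ) : ℂ))⁻¹

theorem hasTemperateGrowth_helmholtzSymbol {κ : ℂ} (hκ : 0 < κ.re) :
    (helmholtzSymbol κ).HasTemperateGrowth :=
  (hasTemperateGrowth_bounded_inv_add_norm_sq (sq_mem_slitPlane hκ)).1.comp
    (g := fun ξ : E3 => (κ ^ 2 + ((‖ξ‖ ^ 2 : ℝ) : ℂ))⁻¹)
    (ContinuousLinearMap.hasTemperateGrowth ((2 * Real.pi) • ContinuousLinearMap.id ℝ E3))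

theorem memLp_helmholtzSymbol {κ : ℂ} (hκ : 0 < κ.re) :
    MemLp (helmholtzSymbol κ) ⊤ (volume : Measure E3) := by
  obtain ⟨C, -, hC⟩ := (hasTemperateGrowth_bounded_inv_add_norm_sq (sq_mem_slitPlane hκ)).2
  exact MagneticThreshold.memLp_top_of_bound
    (hasTemperateGrowth_helmholtzSymbol hκ).1.continuous.aestronglyMeasurable C fun ξ => hC _

/-- The free resolvent `(-Δ + κ²)⁻¹` on tempered distributions. -/
def freeResolvent (κ : ℂ) : Dist3 →L[ℂ] Dist3 := fourierMultiplierCLM ℂ (helmholtzSymbol κ)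

theorem hasTemperateGrowth_smul_one (c : ℂ) :
    (c • fun _ : E3 => (1 : ℂ)).HasTemperateGrowth :=
  Function.HasTemperateGrowth.const (c • (1 : ℂ))

theorem helmholtz_eq (κ : ℂ) (u : Dist3) : κ ^ 2 • u - Δ u =
    fourierMultiplierCLM ℂ (besselSymbol 2 + (κ ^ 2 - 1) • fun _ => (1 : ℂ)) u := by
  have h1 : (fun _ : E3 => (1 : ℂ)).HasTemperateGrowth := Function.HasTemperateGrowth.const _
  rw [fourierMultiplierCLM_add_apply (hasTemperateGrowth_besselSymbol 2)
    (hasTemperateGrowth_smul_one _),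
    fourierMultiplierCLM_smul_apply h1, fourierMultiplierCLM_const]
  change _ = bessel 2 u + (κ ^ 2 - 1) • ((1 : ℂ) • u)
  have e : (κ ^ 2 - 1) • u = κ ^ 2 • u - (1 : ℂ) • u := sub_smul (κ ^ 2) (1 : ℂ) u
  rw [bessel_two, one_smul, e, one_smul]
  abel

theorem helmholtzSymbol_mul {κ : ℂ} (hκ : 0 < κ.re) :
    helmholtzSymbol κ * (besselSymbol 2 + (κ ^ 2 - 1) • fun _ => (1 : ℂ)) = fun _ => 1 := by
  funext ξ
  have hne : κ ^ 2 + ((‖(2 * Real.pi) • ξ‖ ^ 2 : ℝ) : ℂ) ≠ 0 := by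
    intro h
    have hre := congrArg Complex.re h
    have him := congrArg Complex.im h
    simp only [Complex.add_re, Complex.add_im, Complex.ofReal_re, Complex.ofReal_im,
      Complex.zero_re, Complex.zero_im, add_zero] at hre him
    rcases sq_mem_slitPlane hκ with h' | h'
    · nlinarith [sq_nonneg ‖(2 * Real.pi) • ξ‖]
    · exact h' him
  rw [Pi.mul_apply, Pi.add_apply, Pi.smul_apply, besselSymbol_two, helmholtzSymbol, smul_eq_mul,
    mul_one]
  have : (1 : ℂ) + (2 * Real.pi) ^ 2 * ((‖ξ‖ ^ 2 : ℝ) : ℂ) + (κ ^ 2 - 1) =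
      κ ^ 2 + ((‖(2 * Real.pi) • ξ‖ ^ 2 : ℝ) : ℂ) := by
    rw [norm_smul, Real.norm_of_nonneg (by positivity)]
    push_cast
    ring
  rw [this, inv_mul_cancel₀ hne]

theorem freeResolvent_helmholtz {κ : ℂ} (hκ : 0 < κ.re) (u : Dist3) :
    freeResolvent κ (κ ^ 2 • u - Δ u) = u := by
  have h1 := (hasTemperateGrowth_besselSymbol 2).add (hasTemperateGrowth_smul_one (κ ^ 2 - 1))
  rw [helmholtz_eq, freeResolvent, fourierMultiplierCLM_fourierMultiplierCLM_apply h1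
    (hasTemperateGrowth_helmholtzSymbol hκ), mul_comm, helmholtzSymbol_mul hκ,
    fourierMultiplierCLM_const]
  simp

theorem helmholtz_freeResolvent {κ : ℂ} (hκ : 0 < κ.re) (u : Dist3) :
    κ ^ 2 • freeResolvent κ u - Δ (freeResolvent κ u) = u := by
  have h1 := (hasTemperateGrowth_besselSymbol 2).add (hasTemperateGrowth_smul_one (κ ^ 2 - 1))
  rw [helmholtz_eq, freeResolvent, fourierMultiplierCLM_fourierMultiplierCLM_apply
    (hasTemperateGrowth_helmholtzSymbol hκ) h1, helmholtzSymbol_mul hκ,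
    fourierMultiplierCLM_const]
  simp

theorem bessel_freeResolvent {κ : ℂ} (hκ : 0 < κ.re) (k : ℝ) (u : Dist3) :
    bessel k (freeResolvent κ u) = freeResolvent κ (bessel k u) :=
  fourierMultiplierCLM_comm (hasTemperateGrowth_besselSymbol k)
    (hasTemperateGrowth_helmholtzSymbol hκ) u

theorem bessel_two_freeResolvent {κ : ℂ} (hκ : 0 < κ.re) (u : Dist3) :
    bessel 2 (freeResolvent κ u) = u + (1 - κ ^ 2) • freeResolvent κ u := by
  have := helmholtz_freeResolvent hκ u
  have e : (1 - κ ^ 2) • freeResolvent κ u =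
      (1 : ℂ) • freeResolvent κ u - κ ^ 2 • freeResolvent κ u :=
    sub_smul (1 : ℂ) (κ ^ 2) (freeResolvent κ u)
  rw [bessel_two, e, one_smul]
  calc _ = (κ ^ 2 • freeResolvent κ u - Δ (freeResolvent κ u)) +
        (freeResolvent κ u - κ ^ 2 • freeResolvent κ u) := by abel
    _ = _ := by rw [this]

/-- The free resolvent on `L²`. -/
def freeResolventL2 {κ : ℂ} (hκ : 0 < κ.re) : L2 →L[ℂ] L2 := fourierMulL2 (memLp_helmholtzSymbol hκ)

theorem l2ToDist_freeResolventL2 {κ : ℂ} (hκ : 0 < κ.re) (f : L2) :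
    l2ToDist (freeResolventL2 hκ f) = freeResolvent κ (l2ToDist f) :=
  l2ToDist_fourierMulL2 _ (hasTemperateGrowth_helmholtzSymbol hκ) f

theorem freeResolvent_mem_zero {κ : ℂ} (hκ : 0 < κ.re) {u : Dist3} (hu : u ∈ weightedSobolev 0 0) :
    freeResolvent κ u ∈ weightedSobolev 0 0 := by
  rw [mem_weightedSobolev_zero, wmul_zero] at hu ⊢
  obtain ⟨f, rfl⟩ := hu
  exact ⟨freeResolventL2 hκ f, l2ToDist_freeResolventL2 hκ f⟩

/-- The identity ⟨D⟩R₀ = ⟨D⟩⁻¹ + (1 - κ²)R₀⟨D⟩⁻¹ for the free resolvent R₀ turns its L² boundedness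
into a gain of two derivatives. -/
theorem freeResolvent_mem {κ : ℂ} (hκ : 0 < κ.re) {u : Dist3} (hu : u ∈ weightedSobolev (-1) 0) :
    freeResolvent κ u ∈ weightedSobolev 1 0 := by
  have hv := bessel_neg_one_mem_one' hu
  have h : bessel 1 (freeResolvent κ u) =
      bessel (-1) u + (1 - κ ^ 2) • freeResolvent κ (bessel (-1) u) := by
    rw [← bessel_two_freeResolvent hκ, bessel_freeResolvent hκ, bessel_freeResolvent hκ,
      bessel_bessel]
    norm_num
  rw [mem_weightedSobolev_one, h]
  exact Submodule.add_mem _ hv (Submodule.smul_mem _ _ (freeResolvent_mem_zero hκ hv))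

end FreeResolvent

/-! ### Convolution as a relation between distributions -/

section ConvolutionRelation

/-- `v` is the convolution of the function `u` with `k`. -/
def IsConvolution (k : E3 → ℂ) (u v : Dist3) : Prop :=
  ∃ f : E3 → ℂ, Represents f u ∧ ∀ φ : 𝓢(E3, ℂ),
    Integrable (fun z : E3 × E3 => φ z.1 * (k (z.1 - z.2) * f z.2)) (volume.prod volume) ∧
      v φ = ∫ z, φ z.1 * (k (z.1 - z.2) * f z.2) ∂(volume.prod volume)

theorem IsConv.isConvolution {k : E3 → ℂ} {s r : ℝ} {N : WSob 0 s →L[ℂ] WSob 0 r}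
    (h : IsConv k N) (u : WSob 0 s) : IsConvolution k (toDist u) (toDist (N u)) :=
  ⟨wfun u, represents_wfun u, h u⟩

theorem IsConvolution.of_represents {k : E3 → ℂ} {u v : Dist3} (h : IsConvolution k u v)
    {f : E3 → ℂ} (hf : Represents f u) (φ : 𝓢(E3, ℂ)) :
    Integrable (fun z : E3 × E3 => φ z.1 * (k (z.1 - z.2) * f z.2)) (volume.prod volume) ∧
      v φ = ∫ z, φ z.1 * (k (z.1 - z.2) * f z.2) ∂(volume.prod volume) := by
  obtain ⟨g, hg, h⟩ := h
  have hae : (fun z : E3 × E3 => φ z.1 * (k (z.1 - z.2) * g z.2)) =ᵐ[volume.prod volume]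
      fun z => φ z.1 * (k (z.1 - z.2) * f z.2) := by
    filter_upwards [Measure.quasiMeasurePreserving_snd.ae (hg.unique hf)] with z hz
    rw [hz]
  exact ⟨(h φ).1.congr hae, (h φ).2.trans (integral_congr_ae hae)⟩

theorem IsConvolution.unique {k : E3 → ℂ} {u v w : Dist3} (hv : IsConvolution k u v)
    (hw : IsConvolution k u w) : v = w := by
  obtain ⟨f, hf, h⟩ := hv
  ext φ
  rw [(h φ).2, (hw.of_represents hf φ).2]

theorem IsConvolution.add_smul {k l : E3 → ℂ} {u v w : Dist3} (hv : IsConvolution k u v)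
    (hw : IsConvolution l u w) (c : ℂ) : IsConvolution (fun z => k z + c * l z) u (v + c • w) := by
  obtain ⟨f, hf, h⟩ := hv
  have hae : ∀ φ : 𝓢(E3, ℂ), (fun z : E3 × E3 => φ z.1 * ((k (z.1 - z.2) + c * l (z.1 - z.2)) * f z.2)) =
      fun z => φ z.1 * (k (z.1 - z.2) * f z.2) + c * (φ z.1 * (l (z.1 - z.2) * f z.2)) := by
    intro φ
    funext z
    ring
  refine ⟨f, hf, fun φ => ?_⟩
  have hw := hw.of_represents hf φ
  rw [hae]
  refine ⟨(h φ).1.add (hw.1.const_mul c), ?_⟩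
  rw [integral_add (h φ).1 (hw.1.const_mul c), integral_const_mul, ← (h φ).2, ← hw.2]
  rfl

/-- The operator is moved to the test function, and after Fubini the integral in x is evaluated by
the fundamental solution. This remains valid at κ = 0, where the multiplier is singular. -/
theorem IsConvolution.helmholtz {κ : ℂ} (hκ : 0 ≤ κ.re) {u v : Dist3}
    (h : IsConvolution (yukawa κ) u v) : κ ^ 2 • v - Δ v = u := by
  obtain ⟨f, hf, h⟩ := h
  ext φ
  have h1 : (κ ^ 2 • v - Δ v) φ = v (κ ^ 2 • φ - Δ φ) := by
    rw [map_sub, map_smul, ← laplacian_apply_apply]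
    rfl
  obtain ⟨hi, he⟩ := h (κ ^ 2 • φ - Δ φ)
  rw [h1, he, (hf φ).2, integral_prod_symm _ hi]
  refine integral_congr_ae (Eventually.of_forall fun y => ?_)
  simp only
  rw [← integral_yukawa_sub_mul hκ φ y, ← integral_mul_const]
  refine integral_congr_ae (Eventually.of_forall fun x => ?_)
  simp only [_root_.sub_apply, _root_.smul_apply, smul_eq_mul]
  ring

end ConvolutionRelation

/-! ### The operators `(-Δ + κ²)⁻¹` between weighted Sobolev spaces -/

section Green

/-- The operator `(1 - Δ) ^ (-1/2)` from `H^{-1,s}` to `H^{0,s}`. -/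
def besselDown (s : ℝ) : WSob (-1) s →L[ℂ] WSob 0 s :=
  restrictWSob (bessel (-1)) fun _ hu => bessel_neg_one_mem_one' hu

/-- The operator `(1 - Δ) ^ (-1/2)` from `H^{0,r}` to `H^{1,r}`. -/
def besselUp (r : ℝ) : WSob 0 r →L[ℂ] WSob 1 r :=
  restrictWSob (bessel (-1)) fun _ hu => bessel_neg_one_mem_one hu

theorem toDist_besselDown {s : ℝ} (u : WSob (-1) s) :
    toDist (besselDown s u) = bessel (-1) (toDist u) := toDist_restrictWSob _ _ u

theorem toDist_besselUp {r : ℝ} (u : WSob 0 r) :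
    toDist (besselUp r u) = bessel (-1) (toDist u) := toDist_restrictWSob _ _ u

/-- `v = (-Δ + κ²)⁻¹ u`, written as
`(1 - Δ) ^ (-1/2) (1 + (1 - κ²) (-Δ + κ²)⁻¹) (1 - Δ) ^ (-1/2) u`. -/
def GreenRel (κ : ℂ) (u v : Dist3) : Prop :=
  ∃ w, IsConvolution (yukawa κ) (bessel (-1) u) w ∧ v = bessel (-1) (bessel (-1) u + (1 - κ ^ 2) • w)

/-- `v` is the convolution of `u` with `-1 / 4π`. -/
def GreenOneRel (u v : Dist3) : Prop :=
  ∃ w, IsConvolution (fun _ => -(4 * Real.pi : ℂ)⁻¹) (bessel (-1) u) w ∧ v = bessel (-1) w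

/-- The bounded operator `G` is `(-Δ + κ²)⁻¹`. -/
def IsGreenOp (κ : ℂ) {s r : ℝ} (G : WSob (-1) s →L[ℂ] WSob 1 r) : Prop :=
  ∀ u, GreenRel κ (toDist u) (toDist (G u))

/-- The bounded operator `G` is the convolution with `-1 / 4π`. -/
def IsGreenOneOp {s r : ℝ} (G : WSob (-1) s →L[ℂ] WSob 1 r) : Prop :=
  ∀ u, GreenOneRel (toDist u) (toDist (G u))

theorem GreenRel.unique {κ : ℂ} {u v v' : Dist3} (h : GreenRel κ u v) (h' : GreenRel κ u v') :
    v = v' := by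
  obtain ⟨w, hw, rfl⟩ := h
  obtain ⟨w', hw', rfl⟩ := h'
  rw [hw.unique hw']

theorem GreenOneRel.unique {u v v' : Dist3} (h : GreenOneRel u v) (h' : GreenOneRel u v') :
    v = v' := by
  obtain ⟨w, hw, rfl⟩ := h
  obtain ⟨w', hw', rfl⟩ := h'
  rw [hw.unique hw']

theorem helmholtz_bessel (κ : ℂ) (k : ℝ) (u : Dist3) :
    κ ^ 2 • bessel k u - Δ (bessel k u) = bessel k (κ ^ 2 • u - Δ u) := by
  have h1 := (hasTemperateGrowth_besselSymbol 2).add (hasTemperateGrowth_smul_one (κ ^ 2 - 1))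
  rw [helmholtz_eq, helmholtz_eq, bessel, fourierMultiplierCLM_comm h1 (hasTemperateGrowth_besselSymbol k)]

/-- With y = ⟨D⟩⁻¹u and (κ² - Δ)w = y one gets (κ² - Δ)(y + (1 - κ²)w) = (1 - Δ)y, and the two outer
Bessel potentials cancel 1 - Δ. -/
theorem GreenRel.helmholtz {κ : ℂ} (hκ : 0 ≤ κ.re) {u v : Dist3} (h : GreenRel κ u v) :
    κ ^ 2 • v - Δ v = u := by
  obtain ⟨w, hw, rfl⟩ := h
  have h1 := hw.helmholtz hκ
  rw [helmholtz_bessel]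
  set y := bessel (-1) u with hy
  have h2 : κ ^ 2 • (y + (1 - κ ^ 2) • w) - Δ (y + (1 - κ ^ 2) • w) = bessel 2 y := by
    rw [helmholtz_eq, map_add, map_smul, ← helmholtz_eq, ← helmholtz_eq, h1, bessel_two]
    module
  rw [h2, hy, bessel_bessel, bessel_bessel]
  norm_num [bessel_zero]

theorem GreenRel.eq_freeResolvent {κ : ℂ} (hκ : 0 < κ.re) {u v : Dist3} (h : GreenRel κ u v) :
    v = freeResolvent κ u := by
  rw [← h.helmholtz hκ.le, freeResolvent_helmholtz hκ]

theorem IsConvolution.eq_freeResolvent {κ : ℂ} (hκ : 0 < κ.re) {u v : Dist3}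
    (h : IsConvolution (yukawa κ) u v) : v = freeResolvent κ u := by
  rw [← h.helmholtz hκ.le, freeResolvent_helmholtz hκ]

/-- The two Bessel potentials carry the whole gain of derivatives, so only the weighted L² bound for
a kernel of size 1/|z| is needed; it dictates the conditions on the exponents. -/
theorem exists_isGreenOp {κ : ℂ} (hκ : 0 ≤ κ.re) {s r : ℝ} (hs : 1 / 2 < s) (hr : r < -1 / 2)
    (hsr : 2 ≤ s - r) : ∃ G : WSob (-1) s →L[ℂ] WSob 1 r, IsGreenOp κ G := by
  obtain ⟨C, -, h⟩ := exists_isConv_inv hs hr hsr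
  obtain ⟨N, hN, -⟩ := h _ _ (measurable_yukawa κ) (by positivity) (norm_yukawa_le hκ)
  have hrs : r ≤ s := by linarith
  refine ⟨besselUp r ∘L (embed hrs + (1 - κ ^ 2) • N) ∘L besselDown s, fun u =>
    ⟨toDist (N (besselDown s u)), ?_, ?_⟩⟩
  · rw [← toDist_besselDown]
    exact hN.isConvolution _
  · rw [ContinuousLinearMap.comp_apply, ContinuousLinearMap.comp_apply, _root_.add_apply,
      _root_.smul_apply, toDist_besselUp, map_add, map_smul, toDist_embed, toDist_besselDown]

theorem exists_isGreenOneOp {s r : ℝ} (hs : 3 / 2 < s) (hr : r < -3 / 2) :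
    ∃ G : WSob (-1) s →L[ℂ] WSob 1 r, IsGreenOneOp G := by
  obtain ⟨C, -, h⟩ := exists_isConv_weight (j := 0) (s := s) (r := r) (by linarith) (by linarith)
  obtain ⟨N, hN, -⟩ := h (fun _ => -(4 * Real.pi : ℂ)⁻¹) ‖-(4 * Real.pi : ℂ)⁻¹‖ measurable_const
    (norm_nonneg _) fun x y => by simp [weight_zero]
  refine ⟨besselUp r ∘L N ∘L besselDown s, fun u => ⟨toDist (N (besselDown s u)), ?_, ?_⟩⟩
  · rw [← toDist_besselDown]
    exact hN.isConvolution _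
  · exact toDist_besselUp _

end Green

/-! ### Action of G₀ and G₁ on Schwartz functions through their kernels. -/

section GreenKernel

open FourierTransform

theorem represents_schwartz (φ : 𝓢(E3, ℂ)) : Represents φ (φ : Dist3) := by
  refine fun χ => ⟨?_, schwartz_apply φ χ⟩
  refine (integrable_schwartz_mul_l2 χ (φ.toLp 2)).congr ?_
  filter_upwards [φ.coeFn_toLp 2 volume] with x hx
  rw [hx]

theorem schwartz_mem (φ : 𝓢(E3, ℂ)) (s : ℝ) : (φ : Dist3) ∈ weightedSobolev 0 s := by
  rw [mem_weightedSobolev_zero]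
  refine ⟨(SchwartzMap.smulLeftCLM ℂ (weight s) φ).toLp 2, ?_⟩
  ext χ
  rw [l2ToDist_apply]
  change _ = (φ : Dist3) (SchwartzMap.smulLeftCLM ℂ (weight s) χ)
  rw [schwartz_apply]
  refine integral_congr_ae ?_
  filter_upwards [(SchwartzMap.smulLeftCLM ℂ (weight s) φ).coeFn_toLp 2 volume] with x hx
  rw [hx, SchwartzMap.smulLeftCLM_apply_apply (hasTemperateGrowth_weight _),
    SchwartzMap.smulLeftCLM_apply_apply (hasTemperateGrowth_weight _), smul_eq_mul, smul_eq_mul]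
  ring

theorem IsConvolution.congr {k l : E3 → ℂ} {u v : Dist3} (h : IsConvolution k u v)
    (hkl : k =ᵐ[volume] l) : IsConvolution l u v := by
  obtain ⟨f, hf, h⟩ := h
  have hae : ∀ φ : 𝓢(E3, ℂ), (fun z : E3 × E3 => φ z.1 * (k (z.1 - z.2) * f z.2))
      =ᵐ[volume.prod volume] fun z => φ z.1 * (l (z.1 - z.2) * f z.2) := by
    intro φ
    filter_upwards [(quasiMeasurePreserving_sub_of_right_invariant volume volume).ae hkl] with z hz
    rw [hz]
  exact ⟨f, hf, fun φ => ⟨(h φ).1.congr (hae φ), (h φ).2.trans (integral_congr_ae (hae φ))⟩⟩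

theorem norm_yukawa_zero (z : E3) : ‖yukawa 0 z‖ = (4 * Real.pi)⁻¹ * ‖z‖⁻¹ := by
  simp [yukawa, abs_of_pos Real.pi_pos]

/-- Dominated convergence: for ε > 0 the kernel is bounded in modulus by the kernel at κ = 0. -/
theorem IsConvolution.tendsto {u w₀ : Dist3} {w : ℝ → Dist3} (h₀ : IsConvolution (yukawa 0) u w₀)
    (h : ∀ ε : ℝ, 0 < ε → IsConvolution (yukawa ε) u (w ε)) (χ : 𝓢(E3, ℂ)) :
    Tendsto (fun ε => w ε χ) (𝓝[>] 0) (𝓝 (w₀ χ)) := by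
  obtain ⟨f, hf, h₀⟩ := h₀
  rw [(h₀ χ).2]
  refine Tendsto.congr' (f₁ := fun ε : ℝ => ∫ z : E3 × E3,
    χ z.1 * (yukawa ε (z.1 - z.2) * f z.2) ∂(volume.prod volume)) ?_ ?_
  · filter_upwards [self_mem_nhdsWithin] with ε hε
    exact ((h ε hε).of_represents hf χ).2.symm
  refine tendsto_integral_filter_of_dominated_convergence
    (fun z => ‖χ z.1 * (yukawa 0 (z.1 - z.2) * f z.2)‖) ?_ ?_ (h₀ χ).1.norm ?_
  · filter_upwards [self_mem_nhdsWithin] with ε hε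
    exact ((h ε hε).of_represents hf χ).1.aestronglyMeasurable
  · filter_upwards [self_mem_nhdsWithin] with ε hε
    refine Eventually.of_forall fun z => ?_
    rw [norm_mul, norm_mul, norm_mul, norm_mul, norm_yukawa_zero]
    gcongr
    exact norm_yukawa_le (by simpa using (le_of_lt hε)) _
  · refine Eventually.of_forall fun z => Tendsto.const_mul _ (Tendsto.mul_const _ ?_)
    have hc : Continuous fun ε : ℝ => yukawa ε (z.1 - z.2) := by
      unfold yukawa
      fun_prop
    have := hc.tendsto 0
    rw [Complex.ofReal_zero] at this
    exact this.mono_left nhdsWithin_le_nhds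

theorem exists_isConvolution {u : Dist3} (hu : u ∈ weightedSobolev 0 2) {κ : ℂ} (hκ : 0 ≤ κ.re) :
    ∃ v, IsConvolution (yukawa κ) u v := by
  obtain ⟨u, rfl⟩ := exists_toDist_eq hu
  obtain ⟨C, -, h⟩ := exists_isConv_inv (s := 2) (r := -1) (by norm_num) (by norm_num) (by norm_num)
  obtain ⟨N, hN, -⟩ := h _ _ (measurable_yukawa κ) (by positivity) (norm_yukawa_le hκ)
  exact ⟨_, hN.isConvolution u⟩

theorem bessel_apply (k : ℝ) (u : Dist3) (χ : 𝓢(E3, ℂ)) :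
    bessel k u χ = u (𝓕 (SchwartzMap.smulLeftCLM ℂ (besselSymbol k) (𝓕⁻ χ))) :=
  fourierMultiplierCLM_apply_apply _ _ _

/-- For κ = ε > 0 the sandwiched formula and the direct convolution both equal the free resolvent.
At κ = 0 there is no such multiplier, so the equality is obtained by letting ε ↓ 0 in both
expressions. -/
theorem GreenRel.isConvolution {u v : Dist3} (hu : u ∈ weightedSobolev 0 2) (h : GreenRel 0 u v) :
    IsConvolution (yukawa 0) u v := by
  have hy := bessel_neg_one_mem_one' (mem_neg_one_of_mem_zero hu)
  have e₁ := fun ε : ℝ => fun hε : 0 < ε => exists_isConvolution hu (κ := ε) (by simpa using hε.le)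
  have e₂ := fun ε : ℝ => fun hε : 0 < ε => exists_isConvolution hy (κ := ε) (by simpa using hε.le)
  obtain ⟨v', hv'⟩ := exists_isConvolution hu (κ := 0) (by simp)
  choose! a ha using e₁
  choose! b hb using e₂
  suffices v = v' by rwa [this]
  obtain ⟨w, hw, rfl⟩ := h
  ext χ
  refine tendsto_nhds_unique (f := fun ε => a ε χ) (l := 𝓝[>] (0 : ℝ)) ?_ (hv'.tendsto ha χ)
  have hae : ∀ ε : ℝ, 0 < ε → a ε = bessel (-1) (bessel (-1) u + (1 - (ε : ℂ) ^ 2) • b ε) := by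
    intro ε hε
    have hε' : 0 < (ε : ℂ).re := by simpa using hε
    have h2 : GreenRel ε u (bessel (-1) (bessel (-1) u + (1 - (ε : ℂ) ^ 2) • b ε)) :=
      ⟨b ε, hb ε hε, rfl⟩
    rw [h2.eq_freeResolvent hε', (ha ε hε).eq_freeResolvent hε']
  set ψ := 𝓕 (SchwartzMap.smulLeftCLM ℂ (besselSymbol (-1)) (𝓕⁻ χ)) with hψ
  have hlim : Tendsto (fun ε : ℝ => bessel (-1) u ψ + (1 - (ε : ℂ) ^ 2) * b ε ψ) (𝓝[>] 0)
      (𝓝 (bessel (-1) u ψ + (1 - (0 : ℂ) ^ 2) * w ψ)) := by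
    refine Tendsto.const_add _ (Tendsto.mul ?_ (hw.tendsto hb ψ))
    have hc : Continuous fun ε : ℝ => 1 - (ε : ℂ) ^ 2 := by fun_prop
    have := hc.tendsto 0
    rw [Complex.ofReal_zero] at this
    exact this.mono_left nhdsWithin_le_nhds
  rw [bessel_apply, ← hψ]
  refine Tendsto.congr' ?_ hlim
  filter_upwards [self_mem_nhdsWithin] with ε hε
  rw [hae ε hε]
  exact (bessel_apply (-1) (bessel (-1) u + (1 - (ε : ℂ) ^ 2) • b ε) χ).symm

theorem greenKernel_zero (x y : E3) : (greenKernel 0 x y : ℂ) = yukawa 0 (x - y) := by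
  simp [greenKernel, yukawa, div_eq_mul_inv, mul_comm, mul_assoc, mul_left_comm]

theorem IsGreenOp.isGreen {s r : ℝ} {G : WSob (-1) s →L[ℂ] WSob 1 r} (hG : IsGreenOp 0 G) :
    IsGreen 0 G := by
  intro φ u hu χ
  have h := hG u
  rw [hu] at h
  obtain ⟨hi, he⟩ := (h.isConvolution (schwartz_mem φ 2)).of_represents (represents_schwartz φ) χ
  simp_rw [greenKernel_zero, ← integral_const_mul]
  exact ⟨hi.integral_prod_left, he.trans (integral_prod _ hi)⟩

theorem integral_eq_fourier (f : 𝓢(E3, ℂ)) : ∫ x, f x = 𝓕 f 0 := by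
  rw [SchwartzMap.fourier_coe, Real.fourier_eq]
  simp

theorem integral_eq_fourierInv (f : 𝓢(E3, ℂ)) : ∫ x, f x = 𝓕⁻ f 0 := by
  rw [SchwartzMap.fourierInv_coe, Real.fourierInv_eq]
  simp

theorem besselSymbol_at_zero (k : ℝ) : besselSymbol k 0 = 1 := by
  simp [besselSymbol, weight]

/-- Convolution with a constant sees only the integral of its argument, the Fourier transform at 0.
The Bessel symbol equals 1 there, so both Bessel potentials drop out. -/
theorem GreenOneRel.apply {φ : 𝓢(E3, ℂ)} {v : Dist3} (h : GreenOneRel (φ : Dist3) v)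
    (χ : 𝓢(E3, ℂ)) : v χ = (∫ x, χ x) * (-(4 * Real.pi : ℂ)⁻¹ * ∫ x, φ x) := by
  obtain ⟨w, hw, rfl⟩ := h
  have hb := hasTemperateGrowth_besselSymbol (-1)
  have hφ : bessel (-1) (φ : Dist3) = (SchwartzMap.fourierMultiplierCLM ℂ (besselSymbol (-1)) φ :
      𝓢(E3, ℂ)) := fourierMultiplierCLM_toTemperedDistributionCLM_eq hb φ
  set φ' := SchwartzMap.fourierMultiplierCLM ℂ (besselSymbol (-1)) φ with hφ'
  rw [hφ] at hw
  rw [bessel_apply, (hw.of_represents (represents_schwartz φ') _).2]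
  set χ' := 𝓕 (SchwartzMap.smulLeftCLM ℂ (besselSymbol (-1)) (𝓕⁻ χ))
  have e₁ : ∫ x, φ' x = ∫ x, φ x := by
    rw [integral_eq_fourier, integral_eq_fourier, hφ', SchwartzMap.fourierMultiplierCLM_apply,
      FourierTransform.fourier_fourierInv_eq, SchwartzMap.smulLeftCLM_apply_apply hb,
      besselSymbol_at_zero, one_smul]
  have e₂ : ∫ x, χ' x = ∫ x, χ x := by
    rw [integral_eq_fourierInv, integral_eq_fourierInv, FourierTransform.fourierInv_fourier_eq,
      SchwartzMap.smulLeftCLM_apply_apply hb, besselSymbol_at_zero, one_smul]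
  rw [← e₁, ← e₂, ← integral_const_mul]
  exact integral_prod_mul (χ' : E3 → ℂ) (fun y => -(4 * Real.pi : ℂ)⁻¹ * φ' y)

theorem greenKernel_one (x y : E3) : (greenKernel 1 x y : ℂ) = -(4 * Real.pi : ℂ)⁻¹ := by
  simp [greenKernel, neg_div]

theorem IsGreenOneOp.isGreen {s r : ℝ} {G : WSob (-1) s →L[ℂ] WSob 1 r} (hG : IsGreenOneOp G) :
    IsGreen 1 G := by
  intro φ u hu χ
  have h := hG u
  rw [hu] at h
  simp_rw [greenKernel_one, integral_const_mul, integral_mul_const]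
  exact ⟨χ.integrable.mul_const _, h.apply χ⟩

end GreenKernel

/-! ### Second order expansion of the free resolvent at κ = 0. -/

section Expansion

/-- The mean value inequality is used twice, starting from |exp(-z)| ≤ 1 in the right half-plane. -/
theorem norm_exp_neg_sub_one_add_le {w : ℂ} (hw : 0 ≤ w.re) : ‖Complex.exp (-w) - 1 + w‖ ≤ ‖w‖ ^ 2 := by
  have hconv : Convex ℝ {z : ℂ | 0 ≤ z.re} := convex_halfSpace_re_ge 0
  have h₁ : ∀ z : ℂ, 0 ≤ z.re → ‖Complex.exp (-z) - 1‖ ≤ ‖z‖ := by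
    intro z hz
    have := hconv.norm_image_sub_le_of_norm_hasDerivWithin_le (f := fun z => Complex.exp (-z))
      (f' := fun z => Complex.exp (-z) * -1) (C := 1) (x := 0) (y := z)
      (fun x _ => ((Complex.hasDerivAt_exp _).comp x (hasDerivAt_neg x)).hasDerivWithinAt)
      (fun x hx => by
        rw [norm_mul, norm_neg, norm_one, mul_one, Complex.norm_exp, Real.exp_le_one_iff]
        simpa using hx) (by simp) hz
    simpa using this
  have := (convex_segment (𝕜 := ℝ) (0 : ℂ) w).norm_image_sub_le_of_norm_hasDerivWithin_le
    (f := fun z => Complex.exp (-z) + z)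
    (f' := fun z => Complex.exp (-z) * -1 + 1) (C := ‖w‖) (x := 0) (y := w)
    (fun x _ => (((Complex.hasDerivAt_exp _).comp x (hasDerivAt_neg x)).add
      (hasDerivAt_id x)).hasDerivWithinAt)
    (fun x hx => by
      have hx' : 0 ≤ x.re := hconv.segment_subset (by simp) hw hx
      have hxw : ‖x‖ ≤ ‖w‖ := by
        obtain ⟨θ, hθ, rfl⟩ := (segment_eq_image' ℝ (0 : ℂ) w).subset hx
        simp only [zero_add, sub_zero, norm_smul, Real.norm_of_nonneg hθ.1]
        exact mul_le_of_le_one_left (norm_nonneg _) hθ.2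
      rw [mul_neg_one, neg_add_eq_sub, norm_sub_rev]
      exact (h₁ x hx').trans hxw) (left_mem_segment ℝ _ _) (right_mem_segment ℝ _ _)
  simp only [neg_zero, Complex.exp_zero, add_zero, sub_zero] at this
  rw [pow_two]
  convert! this using 2
  ring

theorem norm_sub_le_weight (x y : E3) : ‖x - y‖ ≤ 2 * (‖weight 1 x‖ * ‖weight 1 y‖) := by
  have h : ∀ x : E3, ‖x‖ ≤ ‖weight 1 x‖ ∧ 1 ≤ ‖weight 1 x‖ := by
    intro x
    rw [norm_weight, ← Real.sqrt_eq_rpow]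
    exact ⟨Real.le_sqrt_of_sq_le (by linarith), Real.one_le_sqrt.2 (by nlinarith [sq_nonneg ‖x‖])⟩
  have := norm_sub_le x y
  nlinarith [h x, h y, mul_nonneg (sub_nonneg.2 (h x).2) (sub_nonneg.2 (h y).2)]

/-- The second order remainder of `yukawa κ` at `κ = 0`. -/
def yukawaRemainder (κ : ℂ) (z : E3) : ℂ :=
  (4 * Real.pi : ℂ)⁻¹ * ((Complex.exp (-(κ * (‖z‖ : ℝ))) - 1 + κ * (‖z‖ : ℝ)) * ((‖z‖ : ℝ) : ℂ)⁻¹)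

theorem measurable_yukawaRemainder (κ : ℂ) : Measurable (yukawaRemainder κ) := by
  unfold yukawaRemainder
  fun_prop

theorem norm_yukawaRemainder_le {κ : ℂ} (hκ : 0 ≤ κ.re) (z : E3) :
    ‖yukawaRemainder κ z‖ ≤ (4 * Real.pi)⁻¹ * (‖κ‖ ^ 2 * ‖z‖) := by
  have h := norm_exp_neg_sub_one_add_le (w := κ * (‖z‖ : ℝ)) (by
    rw [Complex.re_mul_ofReal]
    positivity)
  rw [yukawaRemainder, norm_mul, norm_mul, norm_inv, norm_inv, norm_mul, Complex.norm_real,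
    Complex.norm_real, norm_norm, Complex.norm_ofNat, Real.norm_of_nonneg Real.pi_pos.le]
  refine mul_le_mul_of_nonneg_left ?_ (by positivity)
  rw [norm_mul, Complex.norm_real, norm_norm] at h
  rcases eq_or_ne ‖z‖ 0 with hz | hz
  · simp [hz]
  · rw [← div_eq_mul_inv, div_le_iff₀ (by positivity)]
    linarith [h]

/-- The remainder kernel grows like |x - y| ≤ 2⟨x⟩⟨y⟩, which adds one power of weight to the square
integrability threshold 3/2; hence 5/2. -/
theorem exists_bound_expansion {s r : ℝ} (hs : 5 / 2 < s) (hr : r < -5 / 2) :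
    ∃ C : ℝ, ∀ κ : ℂ, 0 ≤ κ.re → ∀ G G₀ G₁ : WSob (-1) s →L[ℂ] WSob 1 r,
      IsGreenOp κ G → IsGreenOp 0 G₀ → IsGreenOneOp G₁ → ‖G - G₀ - κ • G₁‖ ≤ C * ‖κ‖ ^ 2 := by
  obtain ⟨C, hC, h⟩ := exists_isConv_inv (s := s) (r := r) (by linarith) (by linarith) (by linarith)
  obtain ⟨C', hC', h'⟩ := exists_isConv_weight (j := 1) (s := s) (r := r) (by linarith)
    (by linarith)
  refine ⟨‖besselUp r‖ * ((C' * ((4 * Real.pi)⁻¹ * 2) + C * (4 * Real.pi)⁻¹) * ‖besselDown s‖),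
    fun κ hκ G G₀ G₁ hG hG₀ hG₁ => ?_⟩
  obtain ⟨N, hN, hNn⟩ := h _ _ (measurable_yukawa κ) (by positivity) (norm_yukawa_le hκ)
  obtain ⟨N', hN', hNn'⟩ := h' _ ((4 * Real.pi)⁻¹ * 2 * ‖κ‖ ^ 2) (measurable_yukawaRemainder κ)
    (by positivity) (fun x y => (norm_yukawaRemainder_le hκ _).trans (by
      have := norm_sub_le_weight x y
      calc _ ≤ (4 * Real.pi)⁻¹ * (‖κ‖ ^ 2 * (2 * (‖weight 1 x‖ * ‖weight 1 y‖))) := by gcongr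
        _ = _ := by ring))
  -- Besides the remainder of the kernel there is the term -κ²N, from the coefficient 1 - κ² of the
  -- convolution in `GreenRel`.
  have e : G - G₀ - κ • G₁ = besselUp r ∘L (N' - κ ^ 2 • N) ∘L besselDown s := by
    ext u
    apply WSob.toDist_injective
    obtain ⟨w, hw, ew⟩ := hG u
    obtain ⟨w₀, hw₀, ew₀⟩ := hG₀ u
    obtain ⟨w₁, hw₁, ew₁⟩ := hG₁ u
    rw [ContinuousLinearMap.comp_apply, ContinuousLinearMap.comp_apply, _root_.sub_apply,
      _root_.sub_apply, _root_.sub_apply, _root_.smul_apply, _root_.smul_apply, toDist_besselUp,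
      map_sub, map_sub, map_sub, map_smul, map_smul, ew, ew₀, ew₁]
    rw [← toDist_besselDown] at hw hw₀ hw₁
    have e₁ := hw.unique (hN.isConvolution _)
    have e₂ : toDist (N' (besselDown s u)) = w + (-1 : ℂ) • w₀ + (-κ) • w₁ := by
      refine (hN'.isConvolution _).unique (((hw.add_smul hw₀ (-1)).add_smul hw₁ (-κ)).congr ?_)
      filter_upwards [ae_ne_zero] with z hz
      have hz' : ((‖z‖ : ℝ) : ℂ) ≠ 0 := by simpa using hz
      simp only [yukawa, yukawaRemainder, zero_mul, neg_zero, Complex.exp_zero]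
      linear_combination (-(4 * Real.pi : ℂ)⁻¹ * κ) * mul_inv_cancel₀ hz'
    rw [← e₁, e₂, ← map_smul, ← map_sub, ← map_sub]
    congr 1
    module
  rw [e]
  refine (ContinuousLinearMap.opNorm_comp_le _ _).trans ?_
  rw [mul_assoc]
  refine mul_le_mul_of_nonneg_left ((ContinuousLinearMap.opNorm_comp_le _ _).trans ?_) (norm_nonneg _)
  rw [mul_right_comm]
  refine mul_le_mul_of_nonneg_right ((norm_sub_le _ _).trans ?_) (norm_nonneg _)
  rw [norm_smul, norm_pow, add_mul]
  refine add_le_add (hNn'.trans (by linarith)) ?_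
  calc ‖κ‖ ^ 2 * ‖N‖ ≤ ‖κ‖ ^ 2 * (C * (4 * Real.pi)⁻¹) := by gcongr
    _ = _ := by ring

end Expansion

/-! ### Inverses of `I + G₀ W` and `I + W G₀` -/

section Inverse

variable {X Y : Type*} [NormedAddCommGroup X] [NormedSpace ℂ X] [NormedAddCommGroup Y]
  [NormedSpace ℂ Y]

theorem IsInverseOneAdd.left_apply {K L : X →L[ℂ] X} (h : IsInverseOneAdd K L) (x : X) :
    L (x + K x) = x := DFunLike.congr_fun h.1 x

theorem IsInverseOneAdd.right_apply {K L : X →L[ℂ] X} (h : IsInverseOneAdd K L) (x : X) :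
    L x + K (L x) = x := DFunLike.congr_fun h.2 x

/-- From J(I + K) = (I + K')J. It is used with embeddings for J, to compare inverses on different
weighted spaces. -/
theorem IsInverseOneAdd.intertwine {K L : X →L[ℂ] X} {K' L' : Y →L[ℂ] Y}
    (h : IsInverseOneAdd K L) (h' : IsInverseOneAdd K' L') {J : X →L[ℂ] Y}
    (hJ : ∀ x, J (K x) = K' (J x)) (x : X) : J (L x) = L' (J x) := by
  conv_rhs => rw [← h.right_apply x, map_add, hJ, h'.left_apply]

/-- The push-through identity (I + WG)⁻¹ = I - W(I + GW)⁻¹G. -/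
theorem IsInverseOneAdd.swap {G : Y →L[ℂ] X} {W : X →L[ℂ] Y} {L : X →L[ℂ] X}
    (h : IsInverseOneAdd (G ∘L W) L) :
    IsInverseOneAdd (W ∘L G) (ContinuousLinearMap.id ℂ Y - W ∘L L ∘L G) := by
  constructor <;> ext y
  · have h1 : (y + W (G y)) - W (L (G (y + W (G y)))) = y := by
      rw [map_add G]
      have := h.left_apply (G y)
      rw [ContinuousLinearMap.comp_apply] at this
      rw [this]
      abel
    exact h1
  · have h1 : (y - W (L (G y))) + W (G (y - W (L (G y)))) = y := by
      have h2 := h.right_apply (G y)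
      rw [ContinuousLinearMap.comp_apply] at h2
      have h3 : W (G y) = W (L (G y)) + W (G (W (L (G y)))) := by
        rw [← map_add, h2]
      rw [map_sub, map_sub, h3]
      abel
    exact h1

/-- The Fredholm alternative: injectivity says that -1 is not an eigenvalue of the compact operator,
so -1 is in its resolvent set. -/
theorem exists_isInverseOneAdd [CompleteSpace X] {K : X →L[ℂ] X} (hK : IsCompactOperator K)
    (hinj : ∀ x, x + K x = 0 → x = 0) : ∃ L, IsInverseOneAdd K L := by
  rcases IsCompactOperator.hasEigenvalue_or_mem_resolventSet hK (μ := (-1 : ℂ)) (by simp) with h | h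
  · obtain ⟨x, hx⟩ := h.exists_hasEigenvector
    refine absurd (hinj x ?_) hx.2
    have : K x = (-1 : ℂ) • x := hx.apply_eq_smul
    rw [this, neg_one_smul, add_neg_cancel]
  · have hu : IsUnit (1 + K) := by
      have h1 : IsUnit (algebraMap ℂ (X →L[ℂ] X) (-1) - K) := h
      have h2 : 1 + K = -(algebraMap ℂ (X →L[ℂ] X) (-1) - K) := by
        rw [map_neg, map_one]
        abel
      rw [h2]
      exact h1.neg
    obtain ⟨U, hU⟩ := hu
    refine ⟨(U⁻¹ : (X →L[ℂ] X)ˣ), ?_, ?_⟩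
    · change ((U⁻¹ : (X →L[ℂ] X)ˣ) : X →L[ℂ] X) * (1 + K) = 1
      rw [← hU, Units.inv_mul]
    · change (1 + K) * ((U⁻¹ : (X →L[ℂ] X)ˣ) : X →L[ℂ] X) = 1
      rw [← hU, Units.mul_inv]

end Inverse

/-! ### Invertibility at zero energy and the coefficients F₀ and F₁. -/

section Threshold

variable {β : ℝ} {V : E3 → ℝ} {A : E3 → E3}

theorem IsPerturbation.unique {u w w' : Dist3} (h : IsPerturbation A V u w)
    (h' : IsPerturbation A V u w') : w = w' :=
  sub_left_injective (IsHamiltonian.unique h h')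

theorem IsPerturbationOp.toDist_eq {r s r' s' : ℝ} {W : WSob 1 r →L[ℂ] WSob (-1) s}
    {W' : WSob 1 r' →L[ℂ] WSob (-1) s'} (h : IsPerturbationOp A V W) (h' : IsPerturbationOp A V W')
    {u : WSob 1 r} {u' : WSob 1 r'} (hu : toDist u = toDist u') : toDist (W u) = toDist (W' u') :=
  (h u).unique (hu ▸ h' u')

theorem IsGreenOp.toDist_eq {κ : ℂ} {r s r' s' : ℝ} {G : WSob (-1) s →L[ℂ] WSob 1 r}
    {G' : WSob (-1) s' →L[ℂ] WSob 1 r'} (h : IsGreenOp κ G) (h' : IsGreenOp κ G')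
    {u : WSob (-1) s} {u' : WSob (-1) s'} (hu : toDist u = toDist u') :
    toDist (G u) = toDist (G' u') :=
  (h u).unique (hu ▸ h' u')

theorem IsGreenOneOp.toDist_eq {r s r' s' : ℝ} {G : WSob (-1) s →L[ℂ] WSob 1 r}
    {G' : WSob (-1) s' →L[ℂ] WSob 1 r'} (h : IsGreenOneOp G) (h' : IsGreenOneOp G')
    {u : WSob (-1) s} {u' : WSob (-1) s'} (hu : toDist u = toDist u') :
    toDist (G u) = toDist (G' u') :=
  (h u).unique (hu ▸ h' u')

variable {B : E3 → E3}

/-- A solution of `u + G₀ W u = 0` decays better than assumed. -/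
theorem mem_of_greenRel_neg (hβ : 5 < β) (hVB : FieldAssumption β V B)
    (hA : IsVectorPotential β B A) {r r' : ℝ} (hr : 1 / 2 - β < r) (hr' : r' < -1 / 2)
    (hrr : r' ≤ r + β - 2) {u w : Dist3} (hu : u ∈ weightedSobolev 1 r)
    (hw : IsPerturbation A V u w) (hg : GreenRel 0 w (-u)) : u ∈ weightedSobolev 1 r' := by
  obtain ⟨W, hW⟩ := exists_perturbationOp (by linarith) hVB hA (r := r) (s := r + β) le_rfl
  obtain ⟨G, hG⟩ := exists_isGreenOp (κ := 0) (by simp) (s := r + β) (r := r') (by linarith) hr'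
    (by linarith)
  obtain ⟨u, rfl⟩ := exists_toDist_eq hu
  have h := hG (W u)
  rw [(hW u).unique hw] at h
  have := (h.unique hg) ▸ toDist_mem (G (W u))
  exact neg_mem_iff.1 this

/-- Applying -Δ to u = -G₀Wu gives Hu = 0. Together with the improved decay of u this is the
situation excluded by the regularity of zero. -/
theorem eq_zero_of_greenRel_neg (hβ : 5 < β) (hVB : FieldAssumption β V B)
    (hA : IsVectorPotential β B A) (hreg : IsRegularPoint A V) {r : ℝ} (hr : 1 / 2 - β < r)
    {u w : Dist3} (hu : u ∈ weightedSobolev 1 r) (hw : IsPerturbation A V u w)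
    (hg : GreenRel 0 w (-u)) : u = 0 := by
  refine hreg u (fun t ht => ?_) ?_
  -- Two improvements suffice. Since r + β - 2 > -3/2, the first reaches the weight -3/2; from there
  -- -3/2 + β - 2 exceeds every -t with t > 1/2.
  · refine mem_of_greenRel_neg hβ hVB hA (r := -3 / 2) (by linarith) (by linarith) (by linarith)
      ?_ hw hg
    exact mem_of_greenRel_neg hβ hVB hA hr (by norm_num) (by linarith) hu hw hg
  · have h := hg.helmholtz (by simp)
    have h1 : w - Δ u = 0 := by
      rw [helmholtz_eq, map_neg, ← helmholtz_eq] at h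
      have e : (0 : ℂ) • u = 0 := zero_smul ℂ u
      rw [← h, zero_pow two_ne_zero, e]
      abel
    rw [← h1]
    exact hw

/-- Compactness is seen by factoring the same operator through a slightly larger intermediate space;
injectivity is the regularity of zero. -/
theorem exists_inverse (hβ : 5 < β) (hVB : FieldAssumption β V B) (hA : IsVectorPotential β B A)
    (hreg : IsRegularPoint A V) {r s : ℝ} (hr : 1 / 2 - β < r) (hr' : r < -1 / 2)
    {W : WSob 1 r →L[ℂ] WSob (-1) s} {G : WSob (-1) s →L[ℂ] WSob 1 r}
    (hW : IsPerturbationOp A V W) (hG : IsGreenOp 0 G) : ∃ L, IsInverseOneAdd (G ∘L W) L := by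
  refine exists_isInverseOneAdd ?_ fun u hu => ?_
  · obtain ⟨s', h₁, h₂, h₃⟩ : ∃ s' : ℝ, 1 / 2 < s' ∧ s' < r + β ∧ 2 ≤ s' - r := by
      refine ⟨max (r + 2) ((1 / 2 + (r + β)) / 2), lt_max_of_lt_right (by linarith),
        max_lt (by linarith) (by linarith), ?_⟩
      have := le_max_left (r + 2) ((1 / 2 + (r + β)) / 2)
      linarith
    obtain ⟨W', hW', hc⟩ := exists_compact_perturbationOp (by linarith) hVB hA h₂
    obtain ⟨G', hG'⟩ := exists_isGreenOp (κ := 0) (by simp) h₁ hr' h₃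
    have : G ∘L W = G' ∘L W' := by
      ext u
      exact WSob.toDist_injective (hG.toDist_eq hG' (hW.toDist_eq hW' rfl))
    rw [this]
    exact isCompactOperator_clm_comp _ hc
  · apply WSob.toDist_injective
    rw [map_zero]
    have h1 : toDist (G (W u)) = -toDist u := by
      rw [← map_neg, ← eq_neg_of_add_eq_zero_right hu]
      rfl
    exact eq_zero_of_greenRel_neg hβ hVB hA hreg hr (toDist_mem u) (hW u) (h1 ▸ hG (W u))

/-- `L = (I + G₀ W)⁻¹` on `H^{1,r}`, where `G₀` is given by `GreenRel`. -/
def IsThresholdInv (A : E3 → E3) (V : E3 → ℝ) {r : ℝ} (s : ℝ) (L : WSob 1 r →L[ℂ] WSob 1 r) : Prop :=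
  ∃ (W : WSob 1 r →L[ℂ] WSob (-1) s) (G : WSob (-1) s →L[ℂ] WSob 1 r),
    IsPerturbationOp A V W ∧ IsGreenOp 0 G ∧ IsInverseOneAdd (G ∘L W) L

/-- `L = (I + W G₀)⁻¹` on `H^{-1,s}`, where `G₀` is given by `GreenRel`. -/
def IsThresholdInvDual (A : E3 → E3) (V : E3 → ℝ) (r : ℝ) {s : ℝ}
    (L : WSob (-1) s →L[ℂ] WSob (-1) s) : Prop :=
  ∃ (G : WSob (-1) s →L[ℂ] WSob 1 r) (W : WSob 1 r →L[ℂ] WSob (-1) s),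
    IsGreenOp 0 G ∧ IsPerturbationOp A V W ∧ IsInverseOneAdd (W ∘L G) L

theorem IsThresholdInv.isInvGW {t : ℝ} {L : WSob 1 (-t) →L[ℂ] WSob 1 (-t)}
    (h : IsThresholdInv A V (β - t) L) : IsInvGW β A V t L := by
  obtain ⟨W, G, hW, hG, hL⟩ := h
  exact ⟨_, ⟨W, G, hW, hG.isGreen, rfl⟩, hL⟩

theorem IsThresholdInvDual.isInvWG {t : ℝ} {L : WSob (-1) t →L[ℂ] WSob (-1) t}
    (h : IsThresholdInvDual A V (t - β) L) : IsInvWG β A V t L := by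
  obtain ⟨G, W, hG, hW, hL⟩ := h
  exact ⟨_, ⟨G, W, hG.isGreen, hW, rfl⟩, hL⟩

theorem exists_isThresholdInv (hβ : 5 < β) (hVB : FieldAssumption β V B)
    (hA : IsVectorPotential β B A) (hreg : IsRegularPoint A V) {r s : ℝ} (hr : r < -1 / 2)
    (hs : 1 / 2 < s) (hsr : s = r + β) :
    ∃ L : WSob 1 r →L[ℂ] WSob 1 r, IsThresholdInv A V s L := by
  obtain ⟨W, hW⟩ := exists_perturbationOp (by linarith) hVB hA hsr.le
  obtain ⟨G, hG⟩ := exists_isGreenOp (κ := 0) (by simp) hs hr (by linarith)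
  obtain ⟨L, hL⟩ := exists_inverse hβ hVB hA hreg (by linarith) hr hW hG
  exact ⟨L, W, G, hW, hG, hL⟩

theorem exists_isThresholdInvDual (hβ : 5 < β) (hVB : FieldAssumption β V B)
    (hA : IsVectorPotential β B A) (hreg : IsRegularPoint A V) {r s : ℝ} (hr : r < -1 / 2)
    (hs : 1 / 2 < s) (hsr : s = r + β) :
    ∃ L : WSob (-1) s →L[ℂ] WSob (-1) s, IsThresholdInvDual A V r L := by
  obtain ⟨L, W, G, hW, hG, hL⟩ := exists_isThresholdInv hβ hVB hA hreg hr hs hsr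
  exact ⟨_, G, W, hG, hW, hL.swap⟩

/-- The embedding of the smaller space intertwines the two operators G₀W, hence also their inverses.
This makes F₀ and F₁ independent of the exponent t. -/
theorem IsThresholdInv.toDist_eq {r r' s s' : ℝ} {L : WSob 1 r →L[ℂ] WSob 1 r}
    {L' : WSob 1 r' →L[ℂ] WSob 1 r'} (h : IsThresholdInv A V s L) (h' : IsThresholdInv A V s' L')
    {u : WSob 1 r} {u' : WSob 1 r'} (hu : toDist u = toDist u') :
    toDist (L u) = toDist (L' u') := by
  wlog hle : r ≤ r' generalizing r r' s s' L L'
  · exact (this h' h hu.symm (le_of_not_ge hle)).symm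
  obtain ⟨W, G, hW, hG, hL⟩ := h
  obtain ⟨W', G', hW', hG', hL'⟩ := h'
  have hJ : ∀ x, embed hle ((G' ∘L W') x) = (G ∘L W) (embed hle x) := fun x =>
    WSob.toDist_injective ((toDist_embed _ _).trans
      (hG'.toDist_eq hG (hW'.toDist_eq hW (toDist_embed _ _).symm)))
  have hu' : u = embed hle u' := WSob.toDist_injective (hu.trans (toDist_embed _ _).symm)
  rw [hu', ← hL'.intertwine hL hJ, toDist_embed]

theorem IsThresholdInvDual.toDist_eq {r r' s s' : ℝ} {L : WSob (-1) s →L[ℂ] WSob (-1) s}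
    {L' : WSob (-1) s' →L[ℂ] WSob (-1) s'} (h : IsThresholdInvDual A V r L)
    (h' : IsThresholdInvDual A V r' L') {u : WSob (-1) s} {u' : WSob (-1) s'}
    (hu : toDist u = toDist u') : toDist (L u) = toDist (L' u') := by
  wlog hle : s ≤ s' generalizing r r' s s' L L'
  · exact (this h' h hu.symm (le_of_not_ge hle)).symm
  obtain ⟨G, W, hG, hW, hL⟩ := h
  obtain ⟨G', W', hG', hW', hL'⟩ := h'
  have hJ : ∀ x, embed hle ((W' ∘L G') x) = (W ∘L G) (embed hle x) := fun x =>
    WSob.toDist_injective ((toDist_embed _ _).trans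
      (hW'.toDist_eq hW (hG'.toDist_eq hG (toDist_embed _ _).symm)))
  have hu' : u = embed hle u' := WSob.toDist_injective (hu.trans (toDist_embed _ _).symm)
  rw [hu', ← hL'.intertwine hL hJ, toDist_embed]

/-- `F = (I + G₀ W)⁻¹ G₀` from `H^{-1,s}` to `H^{1,-s}`, for all admissible exponents between. -/
def IsThresholdF₀ (β : ℝ) (A : E3 → E3) (V : E3 → ℝ) (s : ℝ)
    (F : WSob (-1) s →L[ℂ] WSob 1 (-s)) : Prop :=
  ∀ t : ℝ, 1 / 2 < t → t < β - 1 / 2 → t ≤ s → 2 ≤ s + t →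
    ∃ (L : WSob 1 (-t) →L[ℂ] WSob 1 (-t)) (G : WSob (-1) s →L[ℂ] WSob 1 (-t)),
      IsThresholdInv A V (β - t) L ∧ IsGreenOp 0 G ∧ ∀ u, toDist (F u) = toDist (L (G u))

/-- `F = (I + G₀ W)⁻¹ G₁ (I + W G₀)⁻¹` from `H^{-1,s}` to `H^{1,-s}`, for all admissible exponents
between. -/
def IsThresholdF₁ (β : ℝ) (A : E3 → E3) (V : E3 → ℝ) (s : ℝ)
    (F : WSob (-1) s →L[ℂ] WSob 1 (-s)) : Prop :=
  ∀ t : ℝ, 3 / 2 < t → t < β - 1 / 2 → t ≤ s →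
    ∃ (L : WSob 1 (-t) →L[ℂ] WSob 1 (-t)) (G : WSob (-1) t →L[ℂ] WSob 1 (-t))
      (L' : WSob (-1) t →L[ℂ] WSob (-1) t),
      IsThresholdInv A V (β - t) L ∧ IsGreenOneOp G ∧ IsThresholdInvDual A V (t - β) L' ∧
        ∀ u : WSob (-1) s, ∃ v : WSob (-1) t,
          toDist v = toDist u ∧ toDist (F u) = toDist (L (G (L' v)))

theorem IsThresholdF₀.isF0 {s : ℝ} {F : WSob (-1) s →L[ℂ] WSob 1 (-s)}
    (h : IsThresholdF₀ β A V s F) : IsF0 β A V s F := by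
  intro t h₁ h₂ h₃ h₄
  obtain ⟨L, G, hL, hG, hF⟩ := h t h₁ h₂ h₃ h₄
  exact ⟨L, G, hL.isInvGW, hG.isGreen, hF⟩

theorem IsThresholdF₁.isF1 {s : ℝ} {F : WSob (-1) s →L[ℂ] WSob 1 (-s)}
    (h : IsThresholdF₁ β A V s F) : IsF1 β A V s F := by
  intro t h₁ h₂ h₃
  obtain ⟨L, G, L', hL, hG, hL', hF⟩ := h t h₁ h₂ h₃
  exact ⟨L, G, L', hL.isInvGW, hG.isGreen, hL'.isInvWG, hF⟩

theorem exists_isThresholdF₀ (hβ : 5 < β) (hVB : FieldAssumption β V B)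
    (hA : IsVectorPotential β B A) (hreg : IsRegularPoint A V) {s : ℝ} (hs : 1 < s) :
    ∃ F : WSob (-1) s →L[ℂ] WSob 1 (-s), IsThresholdF₀ β A V s F := by
  have key : ∀ t : ℝ, 1 / 2 < t → t < β - 1 / 2 → t ≤ s → 2 ≤ s + t →
      ∃ (L : WSob 1 (-t) →L[ℂ] WSob 1 (-t)) (G : WSob (-1) s →L[ℂ] WSob 1 (-t)),
        IsThresholdInv A V (β - t) L ∧ IsGreenOp 0 G := by
    intro t h₁ h₂ h₃ h₄
    obtain ⟨L, hL⟩ := exists_isThresholdInv hβ hVB hA hreg (r := -t) (s := β - t) (by linarith)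
      (by linarith) (by ring)
    obtain ⟨G, hG⟩ := exists_isGreenOp (κ := 0) (by simp) (s := s) (r := -t) (by linarith)
      (by linarith) (by linarith)
    exact ⟨L, G, hL, hG⟩
  -- One admissible exponent is enough to define the operator; the others give the same result. The
  -- choice min(s, 2) satisfies s + t ≥ 2 because s > 1, and t < β - 1/2 because β > 5.
  have hm : min s 2 ≤ s := min_le_left _ _
  obtain ⟨L, G, hL, hG⟩ := key (min s 2) (lt_min (by linarith) (by norm_num))
    ((min_le_right _ _).trans_lt (by linarith)) hm
    (by rcases min_choice s 2 with h | h <;> rw [h] <;> linarith)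
  refine ⟨embed (neg_le_neg hm) ∘L L ∘L G, fun t h₁ h₂ h₃ h₄ => ?_⟩
  obtain ⟨L', G', hL', hG'⟩ := key t h₁ h₂ h₃ h₄
  refine ⟨L', G', hL', hG', fun u => ?_⟩
  rw [ContinuousLinearMap.comp_apply, ContinuousLinearMap.comp_apply, toDist_embed]
  exact hL.toDist_eq hL' (hG.toDist_eq hG' rfl)

theorem exists_isThresholdF₁ (hβ : 5 < β) (hVB : FieldAssumption β V B)
    (hA : IsVectorPotential β B A) (hreg : IsRegularPoint A V) {s : ℝ} (hs : 3 / 2 < s) :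
    ∃ F : WSob (-1) s →L[ℂ] WSob 1 (-s), IsThresholdF₁ β A V s F := by
  have key : ∀ t : ℝ, 3 / 2 < t → t < β - 1 / 2 →
      ∃ (L : WSob 1 (-t) →L[ℂ] WSob 1 (-t)) (G : WSob (-1) t →L[ℂ] WSob 1 (-t))
        (L' : WSob (-1) t →L[ℂ] WSob (-1) t),
        IsThresholdInv A V (β - t) L ∧ IsGreenOneOp G ∧ IsThresholdInvDual A V (t - β) L' := by
    intro t h₁ h₂
    obtain ⟨L, hL⟩ := exists_isThresholdInv hβ hVB hA hreg (r := -t) (s := β - t) (by linarith)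
      (by linarith) (by ring)
    obtain ⟨L', hL'⟩ := exists_isThresholdInvDual hβ hVB hA hreg (r := t - β) (s := t) (by linarith)
      (by linarith) (by ring)
    obtain ⟨G, hG⟩ := exists_isGreenOneOp (s := t) (r := -t) h₁ (by linarith)
    exact ⟨L, G, L', hL, hG, hL'⟩
  have hm : min s 2 ≤ s := min_le_left _ _
  obtain ⟨L, G, L', hL, hG, hL'⟩ := key (min s 2) (lt_min hs (by norm_num))
    ((min_le_right _ _).trans_lt (by linarith))
  refine ⟨embed (neg_le_neg hm) ∘L L ∘L G ∘L L' ∘L embed hm, fun t h₁ h₂ h₃ => ?_⟩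
  obtain ⟨M, H, M', hM, hH, hM'⟩ := key t h₁ h₂
  refine ⟨M, H, M', hM, hH, hM', fun u => ⟨embed h₃ u, toDist_embed _ _, ?_⟩⟩
  simp only [ContinuousLinearMap.comp_apply, toDist_embed]
  exact hL.toDist_eq hM (hG.toDist_eq hH (hL'.toDist_eq hM'
    ((toDist_embed _ _).trans (toDist_embed _ _).symm)))

end Threshold

/-! ### The expansion of the resolvent -/

section ResolventExpansion

/-! ### Abstract expansion of (I + GW)⁻¹G. -/

section Abstract

variable {X Y : Type*} [NormedAddCommGroup X] [NormedSpace ℂ X] [NormedAddCommGroup Y]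
  [NormedSpace ℂ Y]

theorem IsInverseOneAdd.eq {K L L' : X →L[ℂ] X} (h : IsInverseOneAdd K L)
    (h' : IsInverseOneAdd K L') : L = L' := by
  ext x
  exact h.intertwine h' (J := ContinuousLinearMap.id ℂ X) (fun _ => rfl) x

/-- Apply I + GW to the left side, use (I + GW)L = I + (G - G₀)WL, and collect I - WLG₀ = L'. The
right side is visibly of second order once G - G₀ - κG₁ = O(κ²) and G - G₀ = O(κ); no Neumann series
is needed. -/
theorem inverse_comp_sub_eq {W : X →L[ℂ] Y} {G G₀ G₁ : Y →L[ℂ] X} {L : X →L[ℂ] X}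
    {L' : Y →L[ℂ] Y} (hL : IsInverseOneAdd (G₀ ∘L W) L) (hL' : IsInverseOneAdd (W ∘L G₀) L')
    {κ : ℂ} (hu : IsUnit (1 + G ∘L W)) :
    Ring.inverse (1 + G ∘L W) ∘L G - L ∘L G₀ - κ • (L ∘L G₁ ∘L L') =
      Ring.inverse (1 + G ∘L W) ∘L
        ((G - G₀ - κ • G₁) ∘L L' - κ • ((G - G₀) ∘L (W ∘L L ∘L G₁ ∘L L'))) := by
  set B := Ring.inverse (1 + G ∘L W) with hB
  have hBA : ∀ x, B (x + G (W x)) = x := DFunLike.congr_fun (Ring.inverse_mul_cancel _ hu)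
  have hAB : ∀ x, B x + G (W (B x)) = x := DFunLike.congr_fun (Ring.mul_inverse_cancel _ hu)
  have hL₂ : ∀ x, L x + G₀ (W (L x)) = x := hL.right_apply
  have hL'₂ : ∀ y, L' y = y - W (L (G₀ y)) := fun y =>
    DFunLike.congr_fun (hL'.eq hL.swap) y
  ext y
  set z := B (G y) - L (G₀ y) - κ • L (G₁ (L' y)) with hz
  change z = B ((G (L' y) - G₀ (L' y) - κ • G₁ (L' y)) -
    κ • (G (W (L (G₁ (L' y)))) - G₀ (W (L (G₁ (L' y))))))
  conv_lhs => rw [← hBA z]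
  congr 1
  have e₁ := hAB (G y)
  have e₂ := hL₂ (G₀ y)
  have e₃ := hL₂ (G₁ (L' y))
  have e₄ : G (L' y) = G y - G (W (L (G₀ y))) := by rw [hL'₂, map_sub]
  have e₅ : G₀ (L' y) = G₀ y - G₀ (W (L (G₀ y))) := by rw [hL'₂, map_sub]
  have e₆ : G (W z) = G (W (B (G y))) - G (W (L (G₀ y))) - κ • G (W (L (G₁ (L' y)))) := by
    rw [hz]
    simp only [map_sub, map_smul]
  rw [e₆, e₄, e₅, hz]
  generalize B (G y) = b at *
  generalize G (W b) = gb at *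
  generalize G₁ (L' y) = q at *
  generalize L q = lq at *
  generalize L (G₀ y) = lg at *
  generalize G₀ (W lg) = a₁ at *
  generalize G₀ (W lq) = a₂ at *
  rw [← e₁, ← e₂, ← e₃]
  module

theorem isBigO_clm_comp {Z : Type*} [NormedAddCommGroup Z] [NormedSpace ℂ Z] {l : Filter ℂ}
    {S : ℂ → Y →L[ℂ] Z} {T : ℂ → X →L[ℂ] Y} {f g : ℂ → ℝ} (hS : S =O[l] f) (hT : T =O[l] g) :
    (fun κ => S κ ∘L T κ) =O[l] fun κ => f κ * g κ := by
  refine (IsBigO.of_norm_le fun κ => ?_ : _ =O[l] fun κ => ‖S κ‖ * ‖T κ‖).trans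
    (hS.norm_left.mul hT.norm_left)
  exact ContinuousLinearMap.opNorm_comp_le _ _

/-- Invertibility is an open condition and inversion is continuous, so (I + G(κ)W)⁻¹ exists and
stays bounded near κ = 0. -/
theorem isBigO_inverse_comp_sub [CompleteSpace X] {W : X →L[ℂ] Y} {G : ℂ → Y →L[ℂ] X}
    {G₀ G₁ : Y →L[ℂ] X} {L : X →L[ℂ] X} {L' : Y →L[ℂ] Y} (hL : IsInverseOneAdd (G₀ ∘L W) L)
    (hL' : IsInverseOneAdd (W ∘L G₀) L') {l : Filter ℂ} (hl : l ≤ 𝓝 0)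
    (hG : (fun κ => G κ - G₀ - κ • G₁) =O[l] fun κ : ℂ => κ ^ 2) :
    (∀ᶠ κ in l, IsUnit (1 + G κ ∘L W)) ∧
      (fun κ => Ring.inverse (1 + G κ ∘L W) ∘L G κ - L ∘L G₀ - κ • (L ∘L G₁ ∘L L'))
        =O[l] fun κ : ℂ => κ ^ 2 := by
  have hid : (fun κ : ℂ => κ) =O[l] fun κ : ℂ => κ := isBigO_refl _ _
  have h₁ : (fun κ : ℂ => κ ^ 2) =O[l] fun κ : ℂ => κ := by
    have h := (isBigO_refl (fun κ : ℂ => κ) l).mul (Tendsto.isBigO_one ℂ (tendsto_id'.2 hl))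
    simpa [pow_two] using h
  have hD : (fun κ => G κ - G₀) =O[l] fun κ : ℂ => κ := by
    have h : (fun κ : ℂ => κ • G₁) =O[l] fun κ : ℂ => κ * 1 :=
      hid.smul (isBigO_const_const G₁ (one_ne_zero (α := ℂ)) l)
    simp only [mul_one] at h
    refine ((hG.trans h₁).add h).congr_left fun κ => ?_
    abel
  have hlim : Tendsto (fun κ => 1 + G κ ∘L W) l (𝓝 (1 + G₀ ∘L W)) := by
    have h := hD.trans_tendsto hl
    have h2 : Tendsto (fun κ => (G κ - G₀) + G₀) l (𝓝 (0 + G₀)) := h.add_const _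
    simp only [sub_add_cancel, zero_add] at h2
    exact ((((ContinuousLinearMap.compL ℂ X Y X).flip W).continuous.tendsto _).comp h2).const_add 1
  let U : (X →L[ℂ] X)ˣ := ⟨1 + G₀ ∘L W, L, hL.2, hL.1⟩
  have hunit : ∀ᶠ κ in l, IsUnit (1 + G κ ∘L W) := hlim.eventually (Units.nhds U)
  refine ⟨hunit, ?_⟩
  have hB : (fun κ => Ring.inverse (1 + G κ ∘L W)) =O[l] fun _ => (1 : ℝ) :=
    ((NormedRing.inverse_continuousAt U).tendsto.comp hlim).isBigO_one ℝ
  have hE' := isBigO_clm_comp hG.norm_right (isBigO_const_const L' one_ne_zero l)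
  have hD' := (hid.norm_right).smul (isBigO_clm_comp hD.norm_right
    (isBigO_const_const (W ∘L L ∘L G₁ ∘L L') one_ne_zero l))
  have hsum : (fun κ => (G κ - G₀ - κ • G₁) ∘L L' - κ • ((G κ - G₀) ∘L (W ∘L L ∘L G₁ ∘L L')))
      =O[l] fun κ : ℂ => ‖κ ^ 2‖ := by
    refine (hE'.congr_right fun κ => mul_one _).sub (hD'.congr_right fun κ => ?_)
    rw [mul_one, smul_eq_mul, norm_pow, pow_two]
  refine IsBigO.of_norm_right (((isBigO_clm_comp hB hsum).congr_right fun κ => one_mul _).congr' ?_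
    (EventuallyEq.refl _ _))
  filter_upwards [hunit] with κ hκ
  exact (inverse_comp_sub_eq hL hL' hκ).symm

end Abstract

/-! ### Identification with the resolvent on L² and the final expansion. -/

variable {β : ℝ} {V : E3 → ℝ} {A : E3 → E3}

/-- The weighted formula only yields values in H^{1,-t}. Rewriting it as T f = R₀(f - W(I +
GW)⁻¹R₀f), with R₀ the free resolvent, gives values in H^{1,0}, because W maps into H^{-1,t} ⊂
H^{-1,0} and Re κ > 0. Conversely, if Hu = g, then R₀(g + κ²u) = (I + GW)u, so T(g + κ²u) = u. -/
theorem exists_isResolvent {κ : ℂ} (hκ : 0 < κ.re) {t : ℝ} (ht : 0 ≤ t)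
    {W : WSob 1 (-t) →L[ℂ] WSob (-1) t} {G : WSob (-1) t →L[ℂ] WSob 1 (-t)}
    (hW : IsPerturbationOp A V W) (hG : IsGreenOp κ G) (hu : IsUnit (1 + G ∘L W)) :
    ∃ T : L2 →L[ℂ] L2, IsResolvent A V (-κ ^ 2) T ∧ ∀ (f : L2) (u : WSob (-1) t),
      toDist u = l2ToDist f → toDist (Ring.inverse (1 + G ∘L W) (G u)) = l2ToDist (T f) := by
  set B := Ring.inverse (1 + G ∘L W) with hB
  have hBA : ∀ x, B (x + G (W x)) = x := DFunLike.congr_fun (Ring.inverse_mul_cancel _ hu)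
  have hAB : ∀ x, B x + G (W (B x)) = x := DFunLike.congr_fun (Ring.mul_inverse_cancel _ hu)
  have hGR : ∀ u, toDist (G u) = freeResolvent κ (toDist u) := fun u => (hG u).eq_freeResolvent hκ
  have hl2 : ∀ f : L2, l2ToDist f ∈ weightedSobolev (-1) 0 := fun f =>
    mem_neg_one_of_mem_zero (mem_weightedSobolev_zero.2 ⟨f, by rw [wmul_zero]⟩)
  have hY : ∀ u ∈ weightedSobolev (-1) t, u ∈ weightedSobolev (-1) 0 := fun u hu =>
    weightedSobolev_mono ht hu
  -- A general f in L² does not lie in H^{-1,t}, the domain of `G`. The free resolvent on L², viewed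
  -- in H^{1,-t}, takes its place.
  let P : L2 →L[ℂ] WSob 1 (-t) := liftWSob (freeResolvent κ ∘L l2ToDist) fun f =>
    weightedSobolev_mono (by linarith) (freeResolvent_mem hκ (hl2 f))
  have hP : ∀ f, toDist (P f) = freeResolvent κ (l2ToDist f) := fun f => toDist_liftWSob _ _ f
  let Q : WSob (-1) t →L[ℂ] WSob 0 0 := restrictWSob (freeResolvent κ) fun u hu =>
    weightedSobolev_one_le (freeResolvent_mem hκ (hY u hu))
  have hQ : ∀ u, toDist (Q u) = freeResolvent κ (toDist u) := fun u => toDist_restrictWSob _ _ u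
  let e : WSob 0 0 →L[ℂ] L2 := (wsobEquiv 0 0).toContinuousLinearEquiv
  have he : ∀ u, l2ToDist (e u) = toDist u := fun u => by
    have := l2ToDist_wsobEquiv u
    rw [bessel_zero, wmul_zero] at this
    exact this
  let T : L2 →L[ℂ] L2 := freeResolventL2 hκ - e ∘L Q ∘L W ∘L B ∘L P
  have hT : ∀ f, l2ToDist (T f) = freeResolvent κ (l2ToDist f - toDist (W (B (P f)))) := by
    intro f
    rw [map_sub, ← hQ, ← he, ← l2ToDist_freeResolventL2 hκ, ← map_sub]
    rfl
  have hTB : ∀ f, l2ToDist (T f) = toDist (B (P f)) := by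
    intro f
    rw [hT, map_sub, ← hP, ← hGR, ← map_sub]
    congr 1
    exact sub_eq_of_eq_add (hAB (P f)).symm
  refine ⟨T, ⟨fun f => ⟨?_, ?_⟩, fun u g hug => ?_⟩, fun f u hf => ?_⟩
  · rw [hT]
    exact freeResolvent_mem hκ (Submodule.sub_mem _ (hl2 f) (hY _ (toDist_mem _)))
  · have h₁ := helmholtz_freeResolvent hκ (l2ToDist f - toDist (W (B (P f))))
    rw [← hT, hTB] at h₁
    rw [map_add, map_smul, hTB]
    have h₂ : l2ToDist f + (-κ ^ 2) • toDist (B (P f)) =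
        toDist (W (B (P f))) - Δ (toDist (B (P f))) := by
      have h₃ : l2ToDist f = (κ ^ 2 • toDist (B (P f)) - Δ (toDist (B (P f)))) +
          toDist (W (B (P f))) := by
        rw [h₁, sub_add_cancel]
      have h₄ : (-κ ^ 2) • toDist (B (P f)) = -(κ ^ 2 • toDist (B (P f))) :=
        neg_smul (κ ^ 2) (toDist (B (P f)))
      rw [h₃, h₄]
      abel
    rw [h₂]
    exact hW (B (P f))
  · obtain ⟨hu₁, hug⟩ := hug
    obtain ⟨x, hx⟩ := exists_toDist_eq (weightedSobolev_mono (s := -t) (by linarith) hu₁)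
    have hg : l2ToDist g = toDist (W x) - Δ (l2ToDist u) := by
      have h := hW x
      rw [hx] at h
      exact IsHamiltonian.unique hug h
    have hf : l2ToDist (g - (-κ ^ 2) • u) =
        toDist (W x) + (κ ^ 2 • l2ToDist u - Δ (l2ToDist u)) := by
      have h₄ : (-κ ^ 2) • u = -(κ ^ 2 • u) := neg_smul (κ ^ 2) u
      rw [h₄, sub_neg_eq_add, map_add, map_smul, hg]
      abel
    have hPx : P (g - (-κ ^ 2) • u) = x + G (W x) := by
      apply WSob.toDist_injective
      rw [hP, hf, map_add, freeResolvent_helmholtz hκ, map_add, hGR, hx, add_comm]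
    apply l2ToDist_injective
    rw [hTB, hPx, hBA, hx]
  · have : G u = P f := by
      apply WSob.toDist_injective
      rw [hGR, hP, hf]
    rw [this, hTB]

variable {B : E3 → E3}

theorem exists_resolvent_expansion (hβ : 5 < β) (hVB : FieldAssumption β V B)
    (hA : IsVectorPotential β B A) {s : ℝ} (hs : 5 / 2 < s)
    {F₀ F₁ : WSob (-1) s →L[ℂ] WSob 1 (-s)} (hF₀ : IsThresholdF₀ β A V s F₀)
    (hF₁ : IsThresholdF₁ β A V s F₁) :
    ∃ R : ℂ → (WSob (-1) s →L[ℂ] WSob 1 (-s)),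
      (∀ᶠ κ in 𝓝[{κ : ℂ | 0 < κ.re}] 0, IsWeightedResolvent A V s κ (R κ)) ∧
      (fun κ : ℂ => R κ - F₀ - κ • F₁) =O[𝓝[{κ : ℂ | 0 < κ.re}] 0] (fun κ : ℂ => κ ^ 2) := by
  -- The bound t ≤ β/2 lets W map H^{1,-t} into H^{-1,t}, while the kernel expansion needs t > 5/2.
  -- These are compatible because β > 5.
  obtain ⟨t, ht, hts, htβ⟩ : ∃ t : ℝ, 5 / 2 < t ∧ t ≤ s ∧ t ≤ β / 2 :=
    ⟨min s (β / 2), lt_min hs (by linarith), min_le_left _ _, min_le_right _ _⟩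
  obtain ⟨W, hW⟩ := exists_perturbationOp (by linarith) hVB hA (r := -t) (s := t) (by linarith)
  have hex : ∀ κ : ℂ, 0 ≤ κ.re → ∃ G : WSob (-1) t →L[ℂ] WSob 1 (-t), IsGreenOp κ G := fun κ hκ =>
    exists_isGreenOp hκ (by linarith) (by linarith) (by linarith)
  choose! G hG using hex
  have hG₀ := hG 0 (by simp)
  obtain ⟨L, G', hL, hG', hF₀⟩ := hF₀ t (by linarith) (by linarith) hts (by linarith)
  obtain ⟨M, G₁, L', hM, hG₁, hL', hF₁⟩ := hF₁ t (by linarith) (by linarith) hts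
  have hML : M = L := by
    ext x
    exact WSob.toDist_injective (hM.toDist_eq hL rfl)
  -- The inverse `L` was built with the intermediate space H^{-1,β-t}; here it is H^{-1,t}. The
  -- composition G₀W is the same, since both factors are determined on distributions.
  have hLi : IsInverseOneAdd (G 0 ∘L W) L := by
    obtain ⟨W', H, hW', hH, h⟩ := hL
    convert! h using 1
    ext x
    exact WSob.toDist_injective (hG₀.toDist_eq hH (hW.toDist_eq hW' rfl))
  have hLi' : IsInverseOneAdd (W ∘L G 0) L' := by
    obtain ⟨H, W', hH, hW', h⟩ := hL'
    convert! h using 1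
    ext x
    exact WSob.toDist_injective (hW.toDist_eq hW' (hG₀.toDist_eq hH rfl))
  have hO : (fun κ => G κ - G 0 - κ • G₁) =O[𝓝[{κ : ℂ | 0 < κ.re}] 0] fun κ : ℂ => κ ^ 2 := by
    obtain ⟨C, hC⟩ := exists_bound_expansion (s := t) (r := -t) ht (by linarith)
    refine IsBigO.of_bound C ?_
    filter_upwards [self_mem_nhdsWithin] with κ hκ
    rw [norm_pow]
    exact hC κ (le_of_lt hκ) _ _ _ (hG κ (le_of_lt hκ)) hG₀ hG₁
  obtain ⟨hunit, hexp⟩ := isBigO_inverse_comp_sub hLi hLi' nhdsWithin_le_nhds hO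
  let J : WSob (-1) s →L[ℂ] WSob (-1) t := embed hts
  let J' : WSob 1 (-t) →L[ℂ] WSob 1 (-s) := embed (neg_le_neg hts)
  have hJ : ∀ u, toDist (J u) = toDist u := toDist_embed _
  have hJ' : ∀ u, toDist (J' u) = toDist u := toDist_embed _
  refine ⟨fun κ => J' ∘L (Ring.inverse (1 + G κ ∘L W) ∘L G κ) ∘L J, ?_, ?_⟩
  · filter_upwards [hunit, self_mem_nhdsWithin] with κ hκ hκ'
    obtain ⟨T, hT, h⟩ := exists_isResolvent hκ' (by linarith) hW (hG κ (le_of_lt hκ')) hκ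
    refine ⟨T, hT, fun f u hu => ?_⟩
    rw [← h f (J u) ((hJ u).trans hu)]
    exact hJ' _
  · have e₀ : F₀ = J' ∘L (L ∘L G 0) ∘L J := by
      ext u
      apply WSob.toDist_injective
      rw [hF₀]
      refine Eq.trans ?_ (hJ' _).symm
      exact hL.toDist_eq hL (hG'.toDist_eq hG₀ (hJ u).symm)
    have e₁ : F₁ = J' ∘L (L ∘L G₁ ∘L L') ∘L J := by
      ext u
      apply WSob.toDist_injective
      obtain ⟨v, hv, h⟩ := hF₁ u
      have : v = J u := WSob.toDist_injective (hv.trans (hJ u).symm)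
      rw [h, hML, this]
      exact (hJ' _).symm
    have e : (fun κ : ℂ => J' ∘L (Ring.inverse (1 + G κ ∘L W) ∘L G κ) ∘L J - F₀ - κ • F₁) =
        fun κ : ℂ => J' ∘L (Ring.inverse (1 + G κ ∘L W) ∘L G κ - L ∘L G 0 -
          κ • (L ∘L G₁ ∘L L')) ∘L J := by
      funext κ
      rw [e₀, e₁]
      ext u
      simp only [ContinuousLinearMap.comp_apply, _root_.sub_apply, _root_.smul_apply, map_sub,
        map_smul]
    rw [e]
    refine IsBigO.trans (IsBigO.of_bound (‖J'‖ * ‖J‖) (Eventually.of_forall fun κ => ?_)) hexp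
    refine (ContinuousLinearMap.opNorm_comp_le _ _).trans ?_
    rw [mul_assoc, mul_comm ‖J‖]
    exact mul_le_mul_of_nonneg_left (ContinuousLinearMap.opNorm_comp_le _ _) (norm_nonneg _)

end ResolventExpansion

end MagneticThreshold

end

theorem theorem5p1 (β : ℝ) (hβ : 5 < β)
    (V : MagneticThreshold.E3 → ℝ) (B A : MagneticThreshold.E3 → MagneticThreshold.E3)
    (hVB : MagneticThreshold.FieldAssumption β V B)
    (hA : MagneticThreshold.IsVectorPotential β B A)
    (hreg : MagneticThreshold.IsRegularPoint A V) :
    (∀ s : ℝ, 1 < s →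
      ∃ F₀ : MagneticThreshold.WSob (-1) s →L[ℂ] MagneticThreshold.WSob 1 (-s),
        MagneticThreshold.IsF0 β A V s F₀) ∧
    (∀ s : ℝ, 3 / 2 < s →
      ∃ F₁ : MagneticThreshold.WSob (-1) s →L[ℂ] MagneticThreshold.WSob 1 (-s),
        MagneticThreshold.IsF1 β A V s F₁) ∧
    (∀ s : ℝ, 5 / 2 < s →
      ∃ F₀ F₁ : MagneticThreshold.WSob (-1) s →L[ℂ] MagneticThreshold.WSob 1 (-s),
        MagneticThreshold.IsF0 β A V s F₀ ∧ MagneticThreshold.IsF1 β A V s F₁ ∧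
        ∃ R : ℂ → (MagneticThreshold.WSob (-1) s →L[ℂ] MagneticThreshold.WSob 1 (-s)),
          (∀ᶠ κ in 𝓝[{κ : ℂ | 0 < κ.re}] 0, MagneticThreshold.IsWeightedResolvent A V s κ (R κ)) ∧
          (fun κ : ℂ => R κ - F₀ - κ • F₁) =O[𝓝[{κ : ℂ | 0 < κ.re}] 0] (fun κ : ℂ => κ ^ 2)) := by
  refine ⟨fun s hs => ?_, fun s hs => ?_, fun s hs => ?_⟩
  · obtain ⟨F, hF⟩ := MagneticThreshold.exists_isThresholdF₀ hβ hVB hA hreg hs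
    exact ⟨F, hF.isF0⟩
  · obtain ⟨F, hF⟩ := MagneticThreshold.exists_isThresholdF₁ hβ hVB hA hreg hs
    exact ⟨F, hF.isF1⟩
  · obtain ⟨F₀, h₀⟩ := MagneticThreshold.exists_isThresholdF₀ hβ hVB hA hreg (s := s) (by linarith)
    obtain ⟨F₁, h₁⟩ := MagneticThreshold.exists_isThresholdF₁ hβ hVB hA hreg (s := s) (by linarith)
    exact ⟨F₀, F₁, h₀.isF0, h₁.isF1,
      MagneticThreshold.exists_resolvent_expansion hβ hVB hA hs h₀ h₁⟩
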